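/- Let $\ell$ be an odd prime. For a number field $K$ let $\mathcal R_K=\mathbb Z_\ell\otimes_{\mathbb Z}K^\times$, let $\mathcal D'_K$ be the free $\mathbb Z_\ell$-module on the primes of $K$ not dividing $\ell$, and for a place $\mathfrak l\mid\ell$ let $\mathcal R_{K_{\mathfrak l}}=\varprojlim_n K_{\mathfrak l}^\times/K_{\mathfrak l}^{\times\ell^n}$. Let $\mu_K$ denote the group of roots of unity of $\ell$-power order in $K$. An element of $\mathcal R_K$ is called pseudo-infinitesimal if for every $\mathfrak l\mid\ell$ its image in $\mathcal R_{K_{\mathfrak l}}$ is a root of unity (of $\ell$-power order) of $K_{\mathfrak l}$. Let $\mathcal P_K^{bp}\subseteq\mathcal D'_K$ be the submodule of the divisors of the pseudo-infinitesimal elements, and $\mathcal{C}\ell_K^{bp}=\mathcal D'_K/\mathcal P_K^{bp}$. For an extension $L/K$ of number fields let $Cap^{bp}_{L/K}$ be the kernel of the morphism $\mathcal{C}\ell_K^{bp}\to\mathcal{C}\ell_L^{bp}$ induced by extension of divisors. The field $L$ satisfies the Leopoldt conjecture (for $\ell$) if, $E_L$ being the unit group of its ring of integers, the map $\mathbb Z_\ell\otimes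 E_L\to\prod_{\mathfrak L\mid\ell}\mathcal R_{L_{\mathfrak L}}$ is injective. An $\ell$-extension $E/K$ of number fields is locally cyclotomic if for every place $v$ of $K$ and every place $w$ of $E$ above $v$ the extension $E_w/K_v$ is contained in the cyclotomic $\mathbb Z_\ell$-extension $K_v^c$ of $K_v$, i.e. in the maximal pro-$\ell$-extension of $K_v$ inside the field generated over $K_v$ by all roots of unity of $\ell$-power order. Corollary. Let $K$ be a number field containing the $\ell$-th roots of unity, let $K^{lc}$ be its maximal abelian locally cyclotomic pro-$\ell$-extension and $K^c\subseteq K^{lc}$ its cyclotomic $\mathbb Z_\ell$-extension. Let $L/K$ be a cyclic extension of $\ell$-power degree such that $L$ satisfies the Leopoldt conjecture for $\ell$, and put $L'=K^{lc}\cap L$ and $K'=K^c\cap L$. Then $$|Cap^{bp}_{L/K}|=\min\{|\mu_K|,[L':K']\}.$$ -/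

import Mathlib

open scoped TensorProduct NumberField

noncomputable section

namespace BertrandiasPayan

open IsDedekindDomain IsDedekindDomain.HeightOneSpectrum NumberField

/-! ### `ℓ`-adification of abelian groups -/

section LAdic

variable (ℓ : ℕ) [Fact ℓ.Prime]

/-- `ℤ_ℓ ⊗_ℤ A` for a multiplicative abelian group `A` (written additively). -/
abbrev LTensor (A : Type*) [CommGroup A] : Type _ := ℤ_[ℓ] ⊗[ℤ] Additive A

/-- Functoriality of `A ↦ ℤ_ℓ ⊗ A`. -/
def LTensor.map {A B : Type*} [CommGroup A] [CommGroup B] (f : A →* B) :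
    LTensor ℓ A →ₗ[ℤ_[ℓ]] LTensor ℓ B :=
  LinearMap.baseChange ℤ_[ℓ] (MonoidHom.toAdditive f).toIntLinearMap

/-- The `ℓ`-adic compactification `lim_n A / A ^ (ℓ ^ n)` of `A`, with its `ℤ_ℓ`-module structure.
It is written as `lim_n (ℤ_ℓ ⊗ A) / ℓ ^ n (ℤ_ℓ ⊗ A)`; note that
`(ℤ_ℓ ⊗ A) / ℓ ^ n = ℤ / ℓ ^ n ⊗ A = A / A ^ (ℓ ^ n)`. -/
abbrev LCompletion (A : Type*) [CommGroup A] : Type _ :=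
  AdicCompletion (Ideal.span {(ℓ : ℤ_[ℓ])}) (LTensor ℓ A)

/-- The canonical map `ℤ_ℓ ⊗ A → lim_n A / A ^ (ℓ ^ n)`. -/
def LCompletion.of (A : Type*) [CommGroup A] : LTensor ℓ A →ₗ[ℤ_[ℓ]] LCompletion ℓ A :=
  AdicCompletion.of (Ideal.span {(ℓ : ℤ_[ℓ])}) (LTensor ℓ A)

/-- The image in `lim_n Fˣ / Fˣ ^ (ℓ ^ n)` of the group `μ_F` of roots of unity of `ℓ`-power order
of the field `F` (that is, of `ℤ_ℓ ⊗ μ_F = μ_F`). -/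
def localMu (F : Type*) [Field F] : Submodule ℤ_[ℓ] (LCompletion ℓ Fˣ) :=
  LinearMap.range
    ((LCompletion.of ℓ Fˣ).comp (LTensor.map ℓ (CommGroup.primaryComponent Fˣ ℓ).subtype))

end LAdic

/-! ### Completions in an extension of number fields -/

section Local

variable {K L : Type*} [Field K] [NumberField K] [Field L] [NumberField L] [Algebra K L]

/-- The natural embedding `K_v → L_w` of completions, for a finite place `w` of `L` above `v`. -/
def completionMap (v : HeightOneSpectrum (𝓞 K)) (w : HeightOneSpectrum (𝓞 L))
    [w.asIdeal.LiesOver v.asIdeal] : v.adicCompletion K →+* w.adicCompletion L :=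
  ((adicCompletion.equiv L w).symm.toRingHom.comp
    (UniformSpace.Completion.mapRingHom
      (algebraMap (WithVal (v.valuation K)) (WithVal (w.valuation L)))
      (uniformContinuous_algebraMap_liesOver K L v w).continuous)).comp
    (adicCompletion.equiv K v).toRingHom

theorem completionMap_algebraMap (v : HeightOneSpectrum (𝓞 K)) (w : HeightOneSpectrum (𝓞 L))
    [w.asIdeal.LiesOver v.asIdeal] (x : K) :
    completionMap v w (algebraMap K (v.adicCompletion K) x) =
      algebraMap L (w.adicCompletion L) (algebraMap K L x) := by
  apply adicCompletion.ext
  exact UniformSpace.Completion.mapRingHom_coe _ _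

end Local

/-! ### Pseudo-infinitesimal classes -/

section Classes

variable (ℓ : ℕ) [Fact ℓ.Prime]

section OneField

variable (K : Type*) [Field K] [NumberField K]

/-- The finite places of `K` dividing `ℓ`. -/
abbrev WildPlace : Type _ := {v : HeightOneSpectrum (𝓞 K) // (ℓ : 𝓞 K) ∈ v.asIdeal}

/-- The finite places of `K` not dividing `ℓ`. -/
abbrev TamePlace : Type _ := {v : HeightOneSpectrum (𝓞 K) // (ℓ : 𝓞 K) ∉ v.asIdeal}

/-- The `ℤ_ℓ`-module of divisors prime to `ℓ`: the free `ℤ_ℓ`-module on the primes of `K`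
not dividing `ℓ`. -/
abbrev TameDivisor : Type _ := TamePlace ℓ K →₀ ℤ_[ℓ]

/-- The normalized exponent of `x` at the finite place `v`. -/
def ord {K : Type*} [Field K] [NumberField K] (v : HeightOneSpectrum (𝓞 K)) (x : Kˣ) : ℤ :=
  -WithZero.log (v.valuation K (x : K))

theorem ord_mul {K : Type*} [Field K] [NumberField K] (v : HeightOneSpectrum (𝓞 K)) (x y : Kˣ) :
    ord v (x * y) = ord v x + ord v y := by
  have hx : v.valuation K (x : K) ≠ 0 := by simp
  have hy : v.valuation K (y : K) ≠ 0 := by simp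
  simp only [ord, Units.val_mul, map_mul]
  rw [WithZero.log_mul hx hy]
  ring

theorem finite_ord {K : Type*} [Field K] [NumberField K] (x : Kˣ) :
    {v : HeightOneSpectrum (𝓞 K) | ord v x ≠ 0}.Finite := by
  refine ((HeightOneSpectrum.Support.finite (𝓞 K) (x : K)).union
    (HeightOneSpectrum.Support.finite (𝓞 K) ((x : K)⁻¹))).subset ?_
  intro v hv
  have hx : v.valuation K (x : K) ≠ 0 := by simp
  by_contra hcon
  simp only [HeightOneSpectrum.Support, Set.mem_union, Set.mem_ofPred_eq, not_or, not_lt,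
    map_inv₀] at hcon
  have h1 : v.valuation K (x : K) = 1 :=
    le_antisymm hcon.1 ((inv_le_one₀ (zero_lt_iff.mpr hx)).mp hcon.2)
  exact hv (by simp [ord, h1])

/-- The prime-to-`ℓ` part of the principal divisor of an element of `Kˣ`. -/
def divUnits : Additive Kˣ →+ TameDivisor ℓ K where
  toFun x := Finsupp.ofSupportFinite (fun v => ((ord v.1 x.toMul : ℤ) : ℤ_[ℓ])) <|
    ((finite_ord x.toMul).preimage Subtype.val_injective.injOn).subset fun v hv h =>
      hv (by simp only at h ⊢; rw [h, Int.cast_zero])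
  map_zero' := by
    ext v
    simp [Finsupp.ofSupportFinite, ord]
  map_add' x y := by
    ext v
    change ((ord v.1 (x.toMul * y.toMul) : ℤ) : ℤ_[ℓ]) =
      ((ord v.1 x.toMul : ℤ) : ℤ_[ℓ]) + ((ord v.1 y.toMul : ℤ) : ℤ_[ℓ])
    rw [ord_mul, Int.cast_add]

/-- The divisor map `ℤ_ℓ ⊗ Kˣ → D'_K` (prime-to-`ℓ` part of the principal divisor). -/
def principalDivisor : LTensor ℓ Kˣ →ₗ[ℤ_[ℓ]] TameDivisor ℓ K :=
  LinearMap.liftBaseChange ℤ_[ℓ] (divUnits ℓ K).toIntLinearMap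

/-- The localization map from `ℤ_ℓ ⊗ Kˣ` to the `ℓ`-adic compactification of `K_vˣ`. -/
def localization {K : Type*} [Field K] [NumberField K] (v : HeightOneSpectrum (𝓞 K)) :
    LTensor ℓ Kˣ →ₗ[ℤ_[ℓ]] LCompletion ℓ (v.adicCompletion K)ˣ :=
  (LCompletion.of ℓ _).comp
    (LTensor.map ℓ (Units.map (algebraMap K (v.adicCompletion K)).toMonoidHom))

/-- Pseudo-infinitesimal elements: the elements of `ℤ_ℓ ⊗ Kˣ` which are local roots of unity at
every place dividing `ℓ`. -/
def pseudoInfinitesimal : Submodule ℤ_[ℓ] (LTensor ℓ Kˣ) :=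
  ⨅ v : WildPlace ℓ K, (localMu ℓ (v.1.adicCompletion K)).comap (localization ℓ v.1)

/-- The divisors of the pseudo-infinitesimal elements. (Such elements are units at the places
dividing `ℓ`, so their full divisor is prime to `ℓ`.) -/
def principalBP : Submodule ℤ_[ℓ] (TameDivisor ℓ K) :=
  (pseudoInfinitesimal ℓ K).map (principalDivisor ℓ K)

/-- The group of pseudo-infinitesimal classes. -/
abbrev ClassBP : Type _ := TameDivisor ℓ K ⧸ principalBP ℓ K

/-- The Leopoldt conjecture for `ℓ` and `K`: the semi-localization map
`ℤ_ℓ ⊗ E_K → ∏_{v ∣ ℓ} lim_n K_vˣ / K_vˣ ^ (ℓ ^ n)` is injective, where `E_K` is the group of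
units of the ring of integers of `K`. -/
def Leopoldt : Prop :=
  Function.Injective (LinearMap.pi fun v : WildPlace ℓ K =>
    (localization ℓ v.1).comp (LTensor.map ℓ (Units.map (algebraMap (𝓞 K) K).toMonoidHom)))

end OneField

section Extension

variable (K L : Type*) [Field K] [NumberField K] [Field L] [NumberField L] [Algebra K L]

/-- The place of `K` below a place of `L` not dividing `ℓ`. -/
def TamePlace.under {L : Type*} [Field L] [NumberField L] [Algebra K L] (w : TamePlace ℓ L) :
    TamePlace ℓ K :=
  ⟨HeightOneSpectrum.under (𝓞 K) w.1, fun h => w.2 (by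
    have h' : algebraMap (𝓞 K) (𝓞 L) (ℓ : 𝓞 K) ∈ w.1.asIdeal := h
    rwa [map_natCast] at h')⟩

/-- The ramification index of a finite place of `L` over `K`. -/
def ramIdx {L : Type*} [Field L] [NumberField L] [Algebra K L] (w : HeightOneSpectrum (𝓞 L)) : ℕ :=
  Ideal.ramificationIdx' (HeightOneSpectrum.under (𝓞 K) w).asIdeal w.asIdeal

theorem finite_under_fiber (v : HeightOneSpectrum (𝓞 K)) :
    {w : HeightOneSpectrum (𝓞 L) | HeightOneSpectrum.under (𝓞 K) w = v}.Finite := by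
  have : v.asIdeal.IsMaximal := v.isMaximal
  refine Set.Finite.of_finite_image
    (f := fun w : HeightOneSpectrum (𝓞 L) => w.asIdeal)
    ((IsDedekindDomain.primesOver_finite v.asIdeal (𝓞 L)).subset ?_)
    (fun _ _ _ _ h => HeightOneSpectrum.ext h)
  rintro _ ⟨w, hw, rfl⟩
  refine ⟨w.isPrime, ⟨?_⟩⟩
  rw [← show HeightOneSpectrum.under (𝓞 K) w = v from hw]
  rfl

/-- Extension of divisors from `K` to `L`: the prime `v` is sent to `∑_{w ∣ v} e(w / v) w`. -/
def extendDivisor : TameDivisor ℓ K →ₗ[ℤ_[ℓ]] TameDivisor ℓ L where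
  toFun a := Finsupp.ofSupportFinite
    (fun w : TamePlace ℓ L => (ramIdx K w.1 : ℤ_[ℓ]) * a (TamePlace.under ℓ K w)) <| by
      refine Set.Finite.subset (Set.Finite.preimage Subtype.val_injective.injOn
        (a.support.finite_toSet.biUnion fun v _ => finite_under_fiber K L v.1)) ?_
      intro w hw
      simp only [Set.mem_preimage, Set.mem_iUnion]
      refine ⟨TamePlace.under ℓ K w, ?_, rfl⟩
      simp only [Finset.mem_coe, Finsupp.mem_support_iff]
      intro h
      exact hw (by simp only [h, mul_zero])
  map_add' a b := by
    ext w
    simp [Finsupp.ofSupportFinite, mul_add]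
  map_smul' c a := by
    ext w
    simp [Finsupp.ofSupportFinite, mul_left_comm]

theorem extendDivisor_principalDivisor (x : LTensor ℓ Kˣ) :
    extendDivisor ℓ K L (principalDivisor ℓ K x) =
      principalDivisor ℓ L (LTensor.map ℓ (Units.map (algebraMap K L).toMonoidHom) x) := by
  induction x using TensorProduct.induction_on with
  | zero => simp
  | add x y hx hy => simp only [map_add, hx, hy]
  | tmul c x =>
    rw [principalDivisor, LinearMap.liftBaseChange_tmul, map_smul, LTensor.map,
      LinearMap.baseChange_tmul, principalDivisor, LinearMap.liftBaseChange_tmul]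
    congr 1
    ext w
    have : w.1.asIdeal.LiesOver (HeightOneSpectrum.under (𝓞 K) w.1).asIdeal := ⟨rfl⟩
    have h := valuation_liesOver L (HeightOneSpectrum.under (𝓞 K) w.1) w.1 (x.toMul : K)
    have h2 : ord w.1 (Units.map (algebraMap K L).toMonoidHom x.toMul) =
        (ramIdx K w.1 : ℤ) * ord (HeightOneSpectrum.under (𝓞 K) w.1) x.toMul := by
      simp only [ord, ramIdx]
      rw [show ((Units.map (algebraMap K L).toMonoidHom x.toMul : Lˣ) : L) =
        algebraMap K L (x.toMul : K) from rfl, ← h, WithZero.log_pow]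
      simp
    change (ramIdx K w.1 : ℤ_[ℓ]) *
        ((ord (HeightOneSpectrum.under (𝓞 K) w.1) x.toMul : ℤ) : ℤ_[ℓ]) =
      ((ord w.1 (Units.map (algebraMap K L).toMonoidHom x.toMul) : ℤ) : ℤ_[ℓ])
    rw [h2]
    push_cast
    rfl

theorem map_comp_apply {A B C : Type*} [CommGroup A] [CommGroup B] [CommGroup C]
    (g : B →* C) (f : A →* B) (x : LTensor ℓ A) :
    LTensor.map ℓ g (LTensor.map ℓ f x) = LTensor.map ℓ (g.comp f) x := by
  induction x using TensorProduct.induction_on with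
  | zero => simp
  | add x y hx hy => simp only [map_add, hx, hy]
  | tmul c x => rfl

theorem map_localMu {F E : Type*} [Field F] [Field E] (f : F →+* E) (x : LCompletion ℓ Fˣ)
    (hx : x ∈ localMu ℓ F) :
    AdicCompletion.map (Ideal.span {(ℓ : ℤ_[ℓ])}) (LTensor.map ℓ (Units.map f.toMonoidHom)) x ∈
      localMu ℓ E := by
  obtain ⟨z, rfl⟩ := hx
  let g : CommGroup.primaryComponent Fˣ ℓ →* CommGroup.primaryComponent Eˣ ℓ :=
    ((Units.map f.toMonoidHom).comp (CommGroup.primaryComponent Fˣ ℓ).subtype).codRestrict _ (by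
      rintro ⟨y, n, hn⟩
      refine ⟨n, ?_⟩
      rw [MonoidHom.comp_apply, ← map_pow]
      simp [hn])
  refine ⟨LTensor.map ℓ g z, ?_⟩
  simp only [LinearMap.comp_apply, LCompletion.of, AdicCompletion.map_of, map_comp_apply]
  rfl

theorem map_mem_pseudoInfinitesimal (x : LTensor ℓ Kˣ) (hx : x ∈ pseudoInfinitesimal ℓ K) :
    LTensor.map ℓ (Units.map (algebraMap K L).toMonoidHom) x ∈ pseudoInfinitesimal ℓ L := by
  rw [pseudoInfinitesimal, Submodule.mem_iInf] at hx ⊢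
  intro w
  let v : WildPlace ℓ K := ⟨HeightOneSpectrum.under (𝓞 K) w.1, by
    change algebraMap (𝓞 K) (𝓞 L) (ℓ : 𝓞 K) ∈ w.1.asIdeal
    rw [map_natCast]
    exact w.2⟩
  have : w.1.asIdeal.LiesOver v.1.asIdeal := ⟨rfl⟩
  have h := map_localMu ℓ (completionMap v.1 w.1) _ (hx v)
  rw [Submodule.mem_comap]
  convert h using 1
  simp only [localization, LinearMap.comp_apply, LCompletion.of, AdicCompletion.map_of,
    map_comp_apply]
  congr 3
  refine MonoidHom.ext fun y => Units.ext ?_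
  exact (completionMap_algebraMap v.1 w.1 (y : K)).symm

/-- The extension morphism between the groups of pseudo-infinitesimal classes of `K` and `L`. -/
def extendClass : ClassBP ℓ K →ₗ[ℤ_[ℓ]] ClassBP ℓ L :=
  Submodule.mapQ (principalBP ℓ K) (principalBP ℓ L) (extendDivisor ℓ K L) (by
    rintro _ ⟨x, hx, rfl⟩
    exact ⟨_, map_mem_pseudoInfinitesimal ℓ K L x hx, (extendDivisor_principalDivisor ℓ K L x).symm⟩)

/-- The pseudo-infinitesimal capitulation kernel of `L / K`. -/
def Cap : Submodule ℤ_[ℓ] (ClassBP ℓ K) := LinearMap.ker (extendClass ℓ K L)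

end Extension

end Classes

/-! ### Cyclotomic and locally cyclotomic extensions -/

section Cyclotomic

variable (ℓ : ℕ)

/-- For `ℓ` odd and `F` a number field or a completion of one, the cyclotomic `ℤ_ℓ`-extension of
`F` inside `Ω`: the maximal pro-`ℓ`-extension of `F` contained in the field generated over `F` by
all roots of unity of `ℓ`-power order. -/
def cyclotomicExt (F Ω : Type*) [Field F] [Field Ω] [Algebra F Ω] : IntermediateField F Ω :=
  sSup {E : IntermediateField F Ω |
    E ≤ IntermediateField.adjoin F {ζ : Ω | ∃ n : ℕ, ζ ^ ℓ ^ n = 1} ∧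
    FiniteDimensional F E ∧ IsGalois F E ∧ ∃ n : ℕ, Module.finrank F E = ℓ ^ n}

/-- `E / F` is contained in the cyclotomic `ℤ_ℓ`-extension of `F`. -/
def IsInCyclotomic (F E : Type*) [Field F] [Field E] (i : F →+* E) : Prop :=
  ∃ f : E →+* AlgebraicClosure F, f.comp i = algebraMap F (AlgebraicClosure F) ∧
    ∀ x : E, f x ∈ cyclotomicExt ℓ F (AlgebraicClosure F)

/-- `E / K` is locally cyclotomic (logarithmically unramified): for every place `v` of `K` and
every place `w` of `E` above `v`, the extension `E_w / K_v` is contained in the cyclotomic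
`ℤ_ℓ`-extension of `K_v`. -/
def LocallyCyclotomic (K E : Type*) [Field K] [NumberField K] [Field E] [NumberField E]
    [Algebra K E] : Prop :=
  (∀ (v : HeightOneSpectrum (𝓞 K)) (w : HeightOneSpectrum (𝓞 E)) [w.asIdeal.LiesOver v.asIdeal],
    IsInCyclotomic ℓ (v.adicCompletion K) (w.adicCompletion E) (completionMap v w)) ∧
  (∀ (v : InfinitePlace K) (w : InfinitePlace E) [w.LiesOver v],
    IsInCyclotomic ℓ v.Completion w.Completion (NumberField.LiesOver.completionMap (v := v) (w := w)))

/-- The maximal abelian locally cyclotomic pro-`ℓ`-extension of `K` inside `Ω`. -/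
def locallyCyclotomicExt (K Ω : Type*) [Field K] [NumberField K] [Field Ω] [Algebra K Ω] :
    IntermediateField K Ω :=
  sSup {E : IntermediateField K Ω |
    FiniteDimensional K E ∧ IsAbelianGalois K E ∧ (∃ n : ℕ, Module.finrank K E = ℓ ^ n) ∧
    ∃ _ : NumberField E, LocallyCyclotomic ℓ K E}

end Cyclotomic

end BertrandiasPayan

end

open scoped TensorProduct NumberField

noncomputable section

namespace BertrandiasPayan

open IsDedekindDomain IsDedekindDomain.HeightOneSpectrum NumberField

/-! Let `σ` generate `Gal(L/K)`, let `μ_L` be the group of roots of unity of `ℓ`-power order in `L`,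
and let `Y` be the module of pseudo-infinitesimal elements of `L` whose divisor comes from `K`. Each
`X` in `Y` gives a capitulating class of `K`, and every capitulating class arises this way. By the
Leopoldt conjecture, a pseudo-infinitesimal element of `L` with trivial divisor is a root of unity
(`exists_root_of_principalDivisor_eq_zero`). This has two consequences. The kernel of `Y → Cap` is
the sum of `μ_L` and the `σ`-fixed part of `Y`. The operator `σ - 1` maps `Y` into `μ_L`. Comparing
the two maps gives `|Cap| · |(σ - 1) μ_L| = |(σ - 1) Y|` (`card_cap_mul`).

The group `(σ - 1) Y` is then identified by Kummer theory. If `(σ - 1) X` is a root of unity, then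
up to an element from `K`, `X` is some `x` in `Lˣ` having an `ℓ`-power in `K`. Being
pseudo-infinitesimal with divisor from `K` means that at each finite place `x` is a root of unity
times an element of the completion of `K`: `locallyRootTimesBase_of_pseudoInfinitesimal` and
`exists_pseudoInfinitesimal_of_locallyRootTimesBase`. This in turn means that `x` lies in `Λ = K^lc
∩ L`: `mem_locallyCyclotomicExt` and `locallyRootTimesBase_of_mem`. So `(σ - 1) Y` consists of the
roots of unity `σ x / x` with `x` in `Λ`.

Write `|μ_K| = ℓ^a`, `|μ_L| = ℓ^b`, `[L' : K] = ℓ^d`, `[K' : K] = ℓ^c`. Hilbert 90 in the cyclic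
extension `Λ/K`, with the `ℓ`-valuation of a geometric sum, shows that these quotients are exactly
the roots of unity of order dividing `ℓ^min(b, d)` (`quotientRoots_unitsOf`). The same computation
for `K' = K(μ_L)`, where only the quotients `σ z / z` of roots of unity occur, gives `|(σ - 1) μ_L|
= ℓ^c` and `c + a = b`. Hence `|Cap| = ℓ^(min(b, d) - c) = ℓ^min(a, d - c)`. -/

section Tensor

/-! ### Tensor products with `ℤ_ℓ` and `ℓ`-adic compactifications -/

variable {ℓ : ℕ} [Fact ℓ.Prime] {A B C : Type*} [CommGroup A] [CommGroup B] [CommGroup C]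

variable (ℓ) in
/-- The canonical map `A → ℤ_ℓ ⊗ A`. -/
def LTensor.ι (a : A) : LTensor ℓ A := (1 : ℤ_[ℓ]) ⊗ₜ[ℤ] Additive.ofMul a

namespace LTensor

@[simp] theorem ι_one : ι ℓ (1 : A) = 0 := by simp [ι]

theorem ι_mul (a b : A) : ι ℓ (a * b) = ι ℓ a + ι ℓ b := by
  simp [ι, TensorProduct.tmul_add]

theorem ι_inv (a : A) : ι ℓ a⁻¹ = -ι ℓ a := by
  simp [ι, TensorProduct.tmul_neg]

theorem ι_div (a b : A) : ι ℓ (a / b) = ι ℓ a - ι ℓ b := by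
  rw [div_eq_mul_inv, ι_mul, ι_inv, sub_eq_add_neg]

theorem ι_pow (a : A) (n : ℕ) : ι ℓ (a ^ n) = (n : ℤ_[ℓ]) • ι ℓ a := by
  induction n with
  | zero => simp
  | succ n ih => rw [pow_succ, ι_mul, ih, Nat.cast_succ, add_smul, one_smul]

@[simp] theorem map_ι (f : A →* B) (a : A) : map ℓ f (ι ℓ a) = ι ℓ (f a) := rfl

theorem tmul_eq (c : ℤ_[ℓ]) (a : Additive A) :
    (c ⊗ₜ[ℤ] a : LTensor ℓ A) = c • ι ℓ a.toMul := by
  rw [ι, TensorProduct.smul_tmul']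
  simp

theorem exists_eq_nat_add (c : ℤ_[ℓ]) (n : ℕ) :
    ∃ (k : ℕ) (d : ℤ_[ℓ]), c = k + (ℓ : ℤ_[ℓ]) ^ n * d := by
  obtain ⟨d, hd⟩ := Ideal.mem_span_singleton'.1 (PadicInt.appr_spec n c)
  refine ⟨c.appr n, d, ?_⟩
  rw [mul_comm, hd]; ring

/-- Integers are dense in `ℤ_ℓ`, so modulo `ℓ^n` every tensor is an honest element of `A`. This is
what allows passing from `ℤ_ℓ ⊗ A` back to `A`. -/
theorem exists_ι_add (n : ℕ) (x : LTensor ℓ A) :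
    ∃ (a : A) (y : LTensor ℓ A), x = ι ℓ a + (ℓ : ℤ_[ℓ]) ^ n • y := by
  induction x using TensorProduct.induction_on with
  | zero => exact ⟨1, 0, by simp⟩
  | add x y hx hy =>
    obtain ⟨a, x', rfl⟩ := hx
    obtain ⟨b, y', rfl⟩ := hy
    exact ⟨a * b, x' + y', by rw [ι_mul, smul_add]; abel⟩
  | tmul c a =>
    obtain ⟨k, d, rfl⟩ := exists_eq_nat_add c n
    refine ⟨a.toMul ^ k, d • ι ℓ a.toMul, ?_⟩
    rw [tmul_eq, add_smul, ι_pow, smul_smul]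

/-- Only half of `(ℤ_ℓ ⊗ A) / ℓ^n = A / A^(ℓ^n)` is needed: the map `Φ` to `A / A^(ℓ^n)` kills
multiples of `ℓ^n`. -/
theorem exists_pow_of_ι_eq_smul {n : ℕ} {a : A} {x : LTensor ℓ A}
    (h : ι ℓ a = (ℓ : ℤ_[ℓ]) ^ n • x) : ∃ b : A, a = b ^ ℓ ^ n := by
  let f : Additive A →+ Additive A := nsmulAddMonoidHom (ℓ ^ n)
  let Q := Additive A ⧸ f.range
  let q : Additive A →+ Q := QuotientAddGroup.mk' f.range
  have hQ : ∀ y : Q, (ℓ ^ n) • y = 0 := by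
    intro y
    obtain ⟨y, rfl⟩ := QuotientAddGroup.mk'_surjective f.range y
    rw [← map_nsmul, QuotientAddGroup.mk'_apply, QuotientAddGroup.eq_zero_iff]
    exact ⟨y, rfl⟩
  let _ : Module (ZMod (ℓ ^ n)) Q := AddCommGroup.zmodModule hQ
  let φ : ℤ_[ℓ] →ₗ[ℤ] Additive A →ₗ[ℤ] Q :=
    { toFun := fun c =>
        { toFun := fun a => (PadicInt.toZModPow n c) • q a
          map_add' := by intro x y; simp
          map_smul' := by intro m x; rw [map_zsmul, smul_comm]; rfl }
      map_add' := by intro x y; ext a; simp [add_smul]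
      map_smul' := by
        intro m x; ext a
        change PadicInt.toZModPow n (m • x) • q a = m • PadicInt.toZModPow n x • q a
        rw [map_zsmul, smul_assoc] }
  let Φ : LTensor ℓ A →ₗ[ℤ] Q := TensorProduct.lift φ
  have key : ∀ x : LTensor ℓ A, Φ ((ℓ : ℤ_[ℓ]) ^ n • x) = 0 := by
    intro x
    have : ((ℓ : ℤ_[ℓ]) ^ n) • x = (ℓ ^ n : ℕ) • x := by
      rw [← Nat.cast_pow, Nat.cast_smul_eq_nsmul]
    rw [this, map_nsmul, hQ]
  have h1 : Φ (ι ℓ a) = q (Additive.ofMul a) := by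
    change (PadicInt.toZModPow n (1 : ℤ_[ℓ])) • q (Additive.ofMul a) = _
    rw [map_one, one_smul]
  rw [h, key] at h1
  obtain ⟨b, hb⟩ := (QuotientAddGroup.eq_zero_iff _).1 h1.symm
  exact ⟨b.toMul, hb.symm⟩

theorem map_injective {f : A →* B} (hf : Function.Injective f) : Function.Injective (map ℓ f) :=
  Module.Flat.lTensor_preserves_injective_linearMap (M := ℤ_[ℓ])
    (MonoidHom.toAdditive f).toIntLinearMap hf

/-- Flatness of `ℤ_ℓ` over `ℤ`. It is applied to the kernels of a power map, of the divisor map on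
`Kˣ`, and of `σ - 1` on `Lˣ`. -/
theorem exists_map_eq {f : A →* B} {g : B →* C} (h : ∀ b, g b = 1 → ∃ a, f a = b)
    (hfg : ∀ a, g (f a) = 1) {x : LTensor ℓ B} (hx : map ℓ g x = 0) : ∃ z, map ℓ f z = x := by
  have := Module.Flat.lTensor_exact ℤ_[ℓ] (f := (MonoidHom.toAdditive f).toIntLinearMap)
    (g := (MonoidHom.toAdditive g).toIntLinearMap) (by
      intro b
      exact ⟨fun hb => h b hb, by rintro ⟨a, rfl⟩; exact hfg a⟩)
  exact (this x).1 hx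

theorem pow_smul_eq_zero {N : ℕ} (h : ∀ a : A, a ^ ℓ ^ N = 1) (x : LTensor ℓ A) :
    (ℓ : ℤ_[ℓ]) ^ N • x = 0 := by
  induction x using TensorProduct.induction_on with
  | zero => simp
  | add x y hx hy => rw [smul_add, hx, hy, add_zero]
  | tmul c a => rw [tmul_eq, smul_comm, ← Nat.cast_pow, ← ι_pow, h, ι_one, smul_zero]

theorem map_powMonoidHom (n : ℕ) (x : LTensor ℓ A) :
    map ℓ (powMonoidHom n) x = (n : ℤ_[ℓ]) • x := by
  induction x using TensorProduct.induction_on with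
  | zero => simp
  | add x y hx hy => rw [smul_add, map_add, hx, hy]
  | tmul c a =>
    rw [tmul_eq, map_smul, map_ι, smul_comm, ← ι_pow]; rfl

/-- By flatness the torsion is `ℤ_ℓ ⊗ A[ℓ^N]`, and on a group killed by `ℓ^N` the approximation of
`exists_ι_add` is exact. -/
theorem exists_ι_of_torsion {N : ℕ} {x : LTensor ℓ A} (hx : (ℓ : ℤ_[ℓ]) ^ N • x = 0) :
    ∃ a : A, a ^ ℓ ^ N = 1 ∧ x = ι ℓ a := by
  let g : A →* A := powMonoidHom (ℓ ^ N)
  obtain ⟨z, rfl⟩ := exists_map_eq (f := g.ker.subtype) (g := g)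
    (fun b hb => ⟨⟨b, hb⟩, rfl⟩) (fun a => a.2) (x := x) (by
      rw [map_powMonoidHom, Nat.cast_pow, hx])
  obtain ⟨a, y, rfl⟩ := exists_ι_add N z
  refine ⟨a.1, a.2, ?_⟩
  rw [pow_smul_eq_zero (fun a : g.ker => Subtype.ext a.2), add_zero]
  rfl

theorem ι_eq_zero_of_torsion {N : ℕ} {a : A} (ha : a ^ ℓ ^ N = 1) (h : ι ℓ a = 0) : a = 1 := by
  let g : A →* A := powMonoidHom (ℓ ^ N)
  have h1 : ι ℓ (⟨a, ha⟩ : g.ker) = 0 := by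
    apply map_injective (ℓ := ℓ) (f := g.ker.subtype) Subtype.val_injective
    rw [map_ι, map_zero]
    exact h
  obtain ⟨b, hb⟩ := exists_pow_of_ι_eq_smul (n := N) (x := 0) (by rw [h1, smul_zero])
  have : b ^ ℓ ^ N = 1 := Subtype.ext b.2
  rw [this] at hb
  exact congrArg Subtype.val hb

theorem eq_of_ι_eq {N : ℕ} {a b : A} (ha : a ^ ℓ ^ N = 1) (hb : b ^ ℓ ^ N = 1)
    (h : ι ℓ a = ι ℓ b) : a = b := by
  rw [← div_eq_one]
  apply ι_eq_zero_of_torsion (ℓ := ℓ) (N := N)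
  · rw [div_pow, ha, hb, div_one]
  · rw [ι_div, h, sub_self]

end LTensor

namespace LCompletion

open LTensor

theorem ideal_smul_top (n : ℕ) (x : LTensor ℓ A) :
    x ∈ (Ideal.span {(ℓ : ℤ_[ℓ])} ^ n • ⊤ : Submodule ℤ_[ℓ] (LTensor ℓ A)) ↔
      ∃ y, x = (ℓ : ℤ_[ℓ]) ^ n • y := by
  rw [Ideal.span_singleton_pow, Submodule.ideal_span_singleton_smul,
    Submodule.mem_smul_pointwise_iff_exists]
  simp [eq_comm]

theorem ext_eval {x y : LCompletion ℓ A}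
    (h : ∀ n, AdicCompletion.eval (Ideal.span {(ℓ : ℤ_[ℓ])}) (LTensor ℓ A) n x =
      AdicCompletion.eval (Ideal.span {(ℓ : ℤ_[ℓ])}) (LTensor ℓ A) n y) : x = y :=
  AdicCompletion.ext h

theorem eval_of (n : ℕ) (x : LTensor ℓ A) :
    AdicCompletion.eval (Ideal.span {(ℓ : ℤ_[ℓ])}) (LTensor ℓ A) n (of ℓ A x) =
      Submodule.Quotient.mk x := rfl

theorem of_eq_zero_iff (x : LTensor ℓ A) :
    of ℓ A x = 0 ↔ ∀ n, ∃ y, x = (ℓ : ℤ_[ℓ]) ^ n • y := by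
  constructor
  · intro h n
    rw [← ideal_smul_top, ← Submodule.Quotient.mk_eq_zero, ← eval_of, h, map_zero]
  · intro h
    refine ext_eval fun n => ?_
    rw [eval_of, map_zero, Submodule.Quotient.mk_eq_zero, ideal_smul_top]
    exact h n

theorem exists_pow_of_of_ι_eq_zero {a : A} (h : of ℓ A (ι ℓ a) = 0) (n : ℕ) :
    ∃ b : A, a = b ^ ℓ ^ n := by
  obtain ⟨y, hy⟩ := (of_eq_zero_iff _).1 h n
  exact exists_pow_of_ι_eq_smul hy

/-- An element killed by a power of `ℓ` comes from the torsion of `A`. -/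
theorem exists_of_torsion {s : ℕ} (hfin : {a : A | a ^ ℓ ^ s = 1}.Finite) {y : LCompletion ℓ A}
    (hy : (ℓ : ℤ_[ℓ]) ^ s • y = 0) : ∃ a : A, a ^ ℓ ^ s = 1 ∧ y = of ℓ A (ι ℓ a) := by
  set ev := AdicCompletion.eval (Ideal.span {(ℓ : ℤ_[ℓ])}) (LTensor ℓ A) with hev
  have trans : ∀ {m n : ℕ} (_ : m ≤ n) (a : A), ev n y = Submodule.Quotient.mk (ι ℓ a) →
      ev m y = Submodule.Quotient.mk (ι ℓ a) := by
    intro m n hmn a h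
    have := AdicCompletion.transitionMap_comp_eval_apply (I := Ideal.span {(ℓ : ℤ_[ℓ])})
      (M := LTensor ℓ A) hmn y
    refine this.symm.trans ?_
    change AdicCompletion.transitionMap _ _ hmn (ev n y) = _
    rw [h]
    rfl
  -- A representative `a` of `y` at level `k + s` satisfies `a^(ℓ^s) = t^(ℓ^(k+s))`. Dividing it by
  -- `t^(ℓ^k)` makes it genuinely torsion without changing its class at level `k`.
  have h1 : ∀ k : ℕ, ∃ a : A, a ^ ℓ ^ s = 1 ∧ ev k y = Submodule.Quotient.mk (ι ℓ a) := by
    intro k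
    obtain ⟨x, hx⟩ := Submodule.Quotient.mk_surjective _ (ev (k + s) y)
    obtain ⟨a, z, rfl⟩ := exists_ι_add (k + s) x
    have ha : ev (k + s) y = Submodule.Quotient.mk (ι ℓ a) := by
      rw [← hx, Submodule.Quotient.eq, ideal_smul_top]
      exact ⟨z, by abel⟩
    have h2 : Submodule.Quotient.mk (ι ℓ (a ^ ℓ ^ s)) =
        (0 : LTensor ℓ A ⧸ (Ideal.span {(ℓ : ℤ_[ℓ])} ^ (k + s) • ⊤ :
          Submodule ℤ_[ℓ] (LTensor ℓ A))) := by
      rw [ι_pow, Submodule.Quotient.mk_smul, ← ha, ← map_smul, Nat.cast_pow, hy, map_zero]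
    rw [Submodule.Quotient.mk_eq_zero, ideal_smul_top] at h2
    obtain ⟨w, hw⟩ := h2
    obtain ⟨t, ht⟩ := exists_pow_of_ι_eq_smul hw
    refine ⟨a / t ^ ℓ ^ k, ?_, ?_⟩
    · rw [div_pow, ht, ← pow_mul, ← pow_add, div_self']
    · rw [trans (Nat.le_add_right k s) a ha, Submodule.Quotient.eq, ideal_smul_top]
      refine ⟨ι ℓ t, ?_⟩
      rw [ι_div, ι_pow]
      simp
  choose a ha hay using h1
  have := hfin.to_subtype
  -- Pigeonhole: one torsion element represents `y` at infinitely many levels, hence at all of them.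
  obtain ⟨ζ, hinf⟩ := Finite.exists_infinite_fiber
    (fun k => (⟨a k, ha k⟩ : {a : A | a ^ ℓ ^ s = 1}))
  refine ⟨ζ, ζ.2, ext_eval fun n => ?_⟩
  obtain ⟨m, hm, hnm⟩ := (Set.infinite_coe_iff.1 hinf).exists_gt n
  have hm' : a m = ζ.1 := congrArg Subtype.val hm
  rw [eval_of]
  exact trans hnm.le ζ.1 (by rw [hay m, hm'])

theorem map_of (f : A →* B) (x : LTensor ℓ A) :
    AdicCompletion.map (Ideal.span {(ℓ : ℤ_[ℓ])}) (LTensor.map ℓ f) (of ℓ A x) =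
      of ℓ B (LTensor.map ℓ f x) := by
  simp [of, AdicCompletion.map_of]

/-- If finitely many elements of `A` represent `B / B ^ ℓ`, then every element of `B` is the image
of an element of `ℤ_ℓ ⊗ A` in the `ℓ`-adic compactification of `B`. -/
theorem exists_of_map_eq (f : A →* B) (S : Finset A)
    (hS : ∀ b, ∃ a ∈ S, ∃ c, b = f a * c ^ ℓ) (b : B) :
    ∃ r : LTensor ℓ A, of ℓ B (LTensor.map ℓ f r) = of ℓ B (ι ℓ b) := by
  classical
  choose α hα γ hγ using hS
  -- Iterating `b = f(a₀) c₁^ℓ`, `c₁ = f(a₁) c₂^ℓ`, … gives an infinite product of the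
  -- `f(a_j)^(ℓ^j)`. Since the `a_j` lie in the finite set `S`, the factors can be grouped: the
  -- exponent of each `a` is an `ℓ`-adic integer with partial sums `p n a`.
  let s : ℕ → B := fun j => γ^[j] b
  have hs : ∀ j, s j = f (α (s j)) * s (j + 1) ^ ℓ := by
    intro j
    simp only [s, Function.iterate_succ_apply']
    exact hγ _
  let p : ℕ → A → ℤ_[ℓ] := fun n a =>
    ∑ j ∈ Finset.range n, if α (s j) = a then (ℓ : ℤ_[ℓ]) ^ j else 0
  have hsum : ∀ n, ι ℓ b = ∑ a ∈ S, p n a • ι ℓ (f a) + (ℓ : ℤ_[ℓ]) ^ n • ι ℓ (s n) := by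
    intro n
    induction n with
    | zero => simp [p, s]
    | succ n ih =>
      rw [ih]
      conv_lhs => rw [hs n, ι_mul, ι_pow]
      simp only [p, Finset.sum_range_succ, add_smul, Finset.sum_add_distrib, ite_smul, zero_smul]
      rw [Finset.sum_ite_eq, if_pos (hα _), pow_succ, smul_add, mul_smul]
      abel
  have hlim : ∀ a, ∃ c : ℤ_[ℓ], ∀ n, ∃ d, c = p n a + (ℓ : ℤ_[ℓ]) ^ n * d := by
    intro a
    have hp := (PadicInt.maximalIdeal_eq_span_p (p := ℓ) ▸
      (inferInstance : IsAdicComplete (IsLocalRing.maximalIdeal ℤ_[ℓ]) ℤ_[ℓ])).toIsPrecomplete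
    obtain ⟨c, hc⟩ := hp.prec' (fun n => p n a) (by
      intro m n hmn
      rw [SModEq.sub_mem, smul_eq_mul, Ideal.mul_top, Ideal.span_singleton_pow,
        Ideal.mem_span_singleton, ← neg_sub, dvd_neg]
      simp only [p]
      rw [← Finset.sum_range_add_sum_Ico _ hmn, add_sub_cancel_left]
      refine Finset.dvd_sum fun j hj => ?_
      split_ifs
      · exact pow_dvd_pow _ (Finset.mem_Ico.1 hj).1
      · exact dvd_zero _)
    refine ⟨c, fun n => ?_⟩
    have := hc n
    rw [SModEq.sub_mem, smul_eq_mul, Ideal.mul_top, Ideal.span_singleton_pow,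
        Ideal.mem_span_singleton, ← neg_sub, dvd_neg] at this
    obtain ⟨d, hd⟩ := this
    exact ⟨d, by rw [← hd]; ring⟩
  choose c hc using hlim
  refine ⟨∑ a ∈ S, c a • ι ℓ a, ?_⟩
  rw [← sub_eq_zero, ← map_sub, of_eq_zero_iff]
  intro n
  choose d hd using fun a => hc a n
  refine ⟨∑ a ∈ S, d a • ι ℓ (f a) - ι ℓ (s n), ?_⟩
  rw [hsum n, map_sum]
  simp only [map_smul, map_ι]
  rw [Finset.sum_congr rfl fun a _ => by rw [hd a, add_smul, mul_smul], Finset.sum_add_distrib,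
    smul_sub, Finset.smul_sum]
  abel

end LCompletion

end Tensor

section LocalMu

/-! ### Local roots of unity as the torsion of the compactified group -/

variable {ℓ : ℕ} [Fact ℓ.Prime] {F : Type*} [Field F]

open LTensor

theorem mem_localMu_iff {y : LCompletion ℓ Fˣ} :
    y ∈ localMu ℓ F ↔ ∃ (ζ : Fˣ) (n : ℕ), ζ ^ ℓ ^ n = 1 ∧ y = LCompletion.of ℓ Fˣ (ι ℓ ζ) := by
  constructor
  · rintro ⟨z, rfl⟩
    have : ∃ a, z = ι ℓ a := by
      induction z using TensorProduct.induction_on with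
      | zero => exact ⟨1, by simp⟩
      | add x y hx hy =>
        obtain ⟨a, rfl⟩ := hx
        obtain ⟨b, rfl⟩ := hy
        exact ⟨a * b, (ι_mul a b).symm⟩
      | tmul c a =>
        obtain ⟨n, hn⟩ := a.toMul.2
        obtain ⟨k, d, rfl⟩ := exists_eq_nat_add c n
        refine ⟨a.toMul ^ k, ?_⟩
        have h1 : ι ℓ (a.toMul ^ ℓ ^ n) = 0 := by
          rw [show a.toMul ^ ℓ ^ n = 1 from Subtype.ext hn, ι_one]
        rw [ι_pow, Nat.cast_pow] at h1
        rw [tmul_eq, add_smul, ι_pow, mul_comm, mul_smul, h1, smul_zero, add_zero]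
    obtain ⟨a, rfl⟩ := this
    obtain ⟨n, hn⟩ := a.2
    exact ⟨a.1, n, hn, rfl⟩
  · rintro ⟨ζ, n, hζ, rfl⟩
    exact ⟨ι ℓ ⟨ζ, n, hζ⟩, rfl⟩

theorem finite_rootsOfUnity_set (n : ℕ) (hn : 0 < n) : {a : Fˣ | a ^ n = 1}.Finite := by
  have : NeZero n := ⟨hn.ne'⟩
  exact Set.finite_coe_iff.1 (inferInstanceAs (Finite (rootsOfUnity n F)))

/-- Together with `exists_smul_eq_zero_of_mem_localMu`, this turns the pseudo-infinitesimal
condition into a torsion condition. That form passes easily through norms and field extensions. -/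
theorem mem_localMu_of_smul_eq_zero {c : ℤ_[ℓ]} (hc : c ≠ 0) {y : LCompletion ℓ Fˣ}
    (hy : c • y = 0) : y ∈ localMu ℓ F := by
  have hy' : (ℓ : ℤ_[ℓ]) ^ c.valuation • y = 0 := by
    rw [PadicInt.unitCoeff_spec hc, mul_smul] at hy
    have := congrArg (fun z => (↑(PadicInt.unitCoeff hc)⁻¹ : ℤ_[ℓ]) • z) hy
    simpa [smul_smul] using this
  obtain ⟨a, ha, rfl⟩ := LCompletion.exists_of_torsion
    (finite_rootsOfUnity_set _ (pow_pos (Fact.out : ℓ.Prime).pos _)) hy'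
  exact mem_localMu_iff.2 ⟨a, _, ha, rfl⟩

theorem exists_smul_eq_zero_of_mem_localMu {y : LCompletion ℓ Fˣ} (hy : y ∈ localMu ℓ F) :
    ∃ n, (ℓ : ℤ_[ℓ]) ^ n • y = 0 := by
  obtain ⟨ζ, n, hζ, rfl⟩ := mem_localMu_iff.1 hy
  refine ⟨n, ?_⟩
  rw [← map_smul, ← Nat.cast_pow, ← ι_pow, hζ, ι_one, map_zero]

end LocalMu

section LocalField

/-! ### Powers and roots of unity in local fields -/

variable {F : Type*} [NontriviallyNormedField F]

theorem norm_eq_one_of_pow {x : F} {n : ℕ} (hn : n ≠ 0) (h : x ^ n = 1) : ‖x‖ = 1 := by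
  have := congrArg norm h
  rw [norm_pow, norm_one] at this
  exact (pow_eq_one_iff_of_nonneg (norm_nonneg x) hn).1 this

/-- In characteristic zero `y ↦ y^n` has the invertible strict derivative `n` at `1`, so its image
contains a neighbourhood of `1`. -/
theorem exists_pow_nhds_one [CompleteSpace F] [CharZero F] {n : ℕ} (hn : n ≠ 0) :
    ∃ ε > 0, ∀ x : F, ‖x - 1‖ < ε → ∃ y, y ^ n = x := by
  have h := (hasStrictDerivAt_pow n (1 : F)).map_nhds_eq (by simp [hn])
  have h2 : Set.range (fun y : F => y ^ n) ∈ nhds (1 : F) := by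
    have : nhds (1 : F) = Filter.map (fun y : F => y ^ n) (nhds 1) := by
      rw [h, one_pow]
    rw [this]
    exact Filter.range_mem_map
  obtain ⟨ε, hε, hb⟩ := Metric.mem_nhds_iff.1 h2
  exact ⟨ε, hε, fun x hx => hb (by rwa [Metric.mem_ball, dist_eq_norm])⟩

/-- Compactness of the unit ball in pigeonhole form, the source of all the local finiteness
statements below. -/
theorem exists_norm_sub_lt [ProperSpace F] {ι : Type*} [Infinite ι] (f : ι → F)
    (hf : ∀ i, ‖f i‖ ≤ 1) {ε : ℝ} (hε : 0 < ε) : ∃ i j, i ≠ j ∧ ‖f i - f j‖ < ε := by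
  obtain ⟨t, -, ht, hcov⟩ := (isCompact_closedBall (0 : F) 1).finite_cover_balls (half_pos hε)
  have := ht.to_subtype
  have hmem : ∀ i, ∃ c : t, f i ∈ Metric.ball c.1 (ε / 2) := by
    intro i
    have := hcov (show f i ∈ Metric.closedBall (0 : F) 1 by simpa using hf i)
    simpa using this
  choose c hc using hmem
  obtain ⟨i, j, hij, h⟩ := Finite.exists_ne_map_eq_of_infinite c
  refine ⟨i, j, hij, ?_⟩
  have h1 := hc i
  have h2 := hc j
  rw [← h] at h2
  rw [← dist_eq_norm]
  calc dist (f i) (f j) ≤ dist (f i) (c i).1 + dist (f j) (c i).1 := dist_triangle_right _ _ _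
    _ < ε / 2 + ε / 2 := add_lt_add h1 h2
    _ = ε := add_halves ε

/-- The group of `n`-th powers has finite index in `Fˣ`. -/
theorem exists_finset_units_pow [ProperSpace F] [CharZero F] {n : ℕ} (hn : n ≠ 0) :
    ∃ T : Finset Fˣ, ∀ b : Fˣ, ∃ t ∈ T, ∃ c, b = t * c ^ n := by
  obtain ⟨ε, hε, hpow⟩ := exists_pow_nhds_one (F := F) hn
  let H : Subgroup Fˣ := (powMonoidHom n : Fˣ →* Fˣ).range
  suffices hfin : Finite (Fˣ ⧸ H) by
    have := Fintype.ofFinite (Fˣ ⧸ H)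
    classical
    refine ⟨Finset.univ.image (Quotient.out : Fˣ ⧸ H → Fˣ), fun b => ?_⟩
    refine ⟨Quotient.out (b : Fˣ ⧸ H), Finset.mem_image_of_mem _ (Finset.mem_univ _), ?_⟩
    have : (Quotient.out (b : Fˣ ⧸ H))⁻¹ * b ∈ H := by
      rw [← QuotientGroup.eq]
      exact Quotient.out_eq _
    obtain ⟨c, hc⟩ := this
    exact ⟨c, by change c ^ n = _ at hc; rw [hc, mul_inv_cancel_left]⟩
  by_contra hinf
  rw [not_finite_iff_infinite] at hinf
  obtain ⟨ϖ, hϖ0, hϖ1⟩ := NormedField.exists_norm_lt_one F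
  have hϖ : ϖ ≠ 0 := norm_pos_iff.1 hϖ0
  have hρ1 : ‖ϖ ^ n‖ < 1 := by rw [norm_pow]; exact pow_lt_one₀ hϖ0.le hϖ1 hn
  have hρ0 : 0 < ‖ϖ ^ n‖ := norm_pos_iff.2 (pow_ne_zero _ hϖ)
  -- Powers of `ϖ^n` are `n`-th powers, so every coset has a representative with norm in `(‖ϖ^n‖,
  -- 1]`. Of infinitely many such representatives two are so close that their quotient is an `n`-th
  -- power.
  have hrep : ∀ q : Fˣ ⧸ H, ∃ a : Fˣ, (a : Fˣ ⧸ H) = q ∧ ‖ϖ ^ n‖ < ‖(a : F)‖ ∧ ‖(a : F)‖ ≤ 1 := by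
    intro q
    obtain ⟨b, rfl⟩ := QuotientGroup.mk_surjective q
    obtain ⟨k, hk1, hk2⟩ := exists_mem_Ioc_zpow (norm_pos_iff.2 b.ne_zero) ((one_lt_inv₀ hρ0).2 hρ1)
    refine ⟨b * (Units.mk0 ϖ hϖ ^ (k + 1)) ^ n, ?_, ?_, ?_⟩
    · rw [QuotientGroup.mk_mul_of_mem]
      exact ⟨_, rfl⟩
    all_goals
      simp only [Units.val_mul, Units.val_pow_eq_pow_val, Units.val_zpow_eq_zpow_val,
        Units.val_mk0, norm_mul]
      rw [← zpow_natCast (ϖ ^ (k + 1)), ← zpow_mul, mul_comm (k + 1), zpow_mul, zpow_natCast,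
        norm_zpow]
    · calc ‖ϖ ^ n‖ = (‖ϖ ^ n‖⁻¹) ^ k * ‖ϖ ^ n‖ ^ (k + 1) := by
            rw [inv_zpow, zpow_add₀ hρ0.ne', zpow_one, inv_mul_cancel_left₀ (zpow_ne_zero _ hρ0.ne')]
        _ < _ := by gcongr
    · calc _ ≤ (‖ϖ ^ n‖⁻¹) ^ (k + 1) * ‖ϖ ^ n‖ ^ (k + 1) := by gcongr
        _ = 1 := by rw [← mul_zpow, inv_mul_cancel₀ hρ0.ne', one_zpow]
  choose a ha1 ha2 ha3 using hrep
  obtain ⟨i, j, hij, hlt⟩ := exists_norm_sub_lt (fun q => (a q : F)) ha3 (mul_pos hε hρ0)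
  apply hij
  rw [← ha1 i, ← ha1 j, QuotientGroup.eq]
  have : ‖(a i : F)⁻¹ * a j - 1‖ < ε := by
    have h1 : (a i : F)⁻¹ * a j - 1 = -(((a i : F) - a j) / a i) := by
      have := (a i).ne_zero
      field_simp
      ring
    rw [h1, norm_neg, norm_div, div_lt_iff₀ (norm_pos_iff.2 (a i).ne_zero)]
    exact hlt.trans (by gcongr; exact ha2 i)
  obtain ⟨y, hy⟩ := hpow _ this
  have hy0 : y ≠ 0 := by
    rintro rfl
    rw [zero_pow hn] at hy
    exact mul_ne_zero (inv_ne_zero (a i).ne_zero) (a j).ne_zero hy.symm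
  exact ⟨Units.mk0 y hy0, Units.ext (by simpa using hy)⟩

variable [IsUltrametricDist F]

theorem norm_pow_sub_one_lt {x : F} {ε : ℝ} (hx : ‖x‖ = 1) (h : ‖x - 1‖ < ε) (n : ℕ) :
    ‖x ^ n - 1‖ < ε := by
  induction n with
  | zero => simpa using (norm_nonneg _).trans_lt h
  | succ n ih =>
    rw [show x ^ (n + 1) - 1 = x * (x ^ n - 1) + (x - 1) by ring]
    refine (IsUltrametricDist.norm_add_le_max _ _).trans_lt (max_lt ?_ h)
    rwa [norm_mul, hx, one_mul]

/-- The nontrivial `ℓ`-th roots of unity stay at distance at least `ε` from `1`. An infinite group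
would contain some `c ≠ 1` within `ε` of `1`. In the ultrametric all powers of `c` stay there too,
including one of exact order `ℓ`. -/
theorem finite_primaryComponent [ProperSpace F] (ℓ : ℕ) [hℓ : Fact ℓ.Prime] :
    Finite (CommGroup.primaryComponent Fˣ ℓ) := by
  by_contra hinf
  rw [not_finite_iff_infinite] at hinf
  have hfin : {a : Fˣ | a ^ ℓ = 1}.Finite := finite_rootsOfUnity_set ℓ hℓ.out.pos
  obtain ⟨ε, hε, hsep⟩ : ∃ ε > 0, ∀ a : Fˣ, a ^ ℓ = 1 → ‖(a : F) - 1‖ < ε → a = 1 := by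
    have : ∀ a : Fˣ, ∃ ε > 0, ‖(a : F) - 1‖ < ε → a = 1 := by
      intro a
      by_cases h : a = 1
      · exact ⟨1, one_pos, fun _ => h⟩
      · refine ⟨‖(a : F) - 1‖, norm_pos_iff.2 ?_, fun h' => absurd h' (lt_irrefl _)⟩
        exact sub_ne_zero.2 (fun h' => h (Units.ext h'))
    choose e he h using this
    obtain ⟨ε, hε, hle⟩ : ∃ ε > 0, ∀ a ∈ hfin.toFinset, ε ≤ e a := by
      have hne : hfin.toFinset.Nonempty := ⟨1, by simp⟩
      obtain ⟨b, hb, hmin⟩ := hfin.toFinset.exists_min_image e hne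
      exact ⟨e b, he b, hmin⟩
    exact ⟨ε, hε, fun a ha hlt => h a (hlt.trans_le (hle a (by simpa using ha)))⟩
  have hnorm : ∀ a : CommGroup.primaryComponent Fˣ ℓ, ‖((a : Fˣ) : F)‖ = 1 := by
    rintro ⟨a, n, hn⟩
    exact norm_eq_one_of_pow (n := ℓ ^ n) (pow_ne_zero _ hℓ.out.ne_zero)
      (by simpa using congrArg Units.val hn)
  obtain ⟨a, b, hab, hlt⟩ := exists_norm_sub_lt
    (fun a : CommGroup.primaryComponent Fˣ ℓ => ((a : Fˣ) : F)) (fun a => (hnorm a).le) hε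
  have hc : ‖(((a / b : CommGroup.primaryComponent Fˣ ℓ) : Fˣ) : F) - 1‖ < ε := by
    have : (((a / b : CommGroup.primaryComponent Fˣ ℓ) : Fˣ) : F) - 1 =
        (((a : Fˣ) : F) - ((b : Fˣ) : F)) / ((b : Fˣ) : F) := by
      simp [sub_div]
    rw [this, norm_div, hnorm b, div_one]
    exact hlt
  have hne : a / b ≠ 1 := fun h => hab (div_eq_one.1 h)
  obtain ⟨n, hn⟩ := CommGroup.mem_primaryComponent.1 (a / b).2
  have key : ∀ n (c : CommGroup.primaryComponent Fˣ ℓ), ‖((c : Fˣ) : F) - 1‖ < ε →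
      (c : Fˣ) ^ ℓ ^ n = 1 → c = 1 := by
    intro n
    induction n with
    | zero => intro c _ h; exact Subtype.ext (by simpa using h)
    | succ n ih =>
      intro c h1 h2
      have h3 : (c ^ ℓ ^ n : CommGroup.primaryComponent Fˣ ℓ) = 1 := by
        refine Subtype.ext (hsep _ ?_ ?_)
        · rw [Subgroup.coe_pow, ← pow_mul, ← pow_succ]; exact h2
        · have := norm_pow_sub_one_lt (hnorm c) h1 (ℓ ^ n)
          simpa using this
      exact ih c h1 (by simpa using congrArg Subtype.val h3)
  exact hne (key n _ hc hn)

/-- In `t^c - 1 = (t - 1)(1 + t + ⋯ + t^(c-1))` the second factor is congruent to `c`. Raising to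
the power `c` therefore contracts towards `1`, which is applied with `c` the residue characteristic.
-/
theorem norm_pow_sub_one_le {t : F} {c : ℕ} {ρ : ℝ} (hc : ‖(c : F)‖ ≤ ρ) (hρ : ρ < 1)
    (ht : ‖t - 1‖ ≤ ρ) : ‖t ^ c - 1‖ ≤ ρ * ‖t - 1‖ := by
  have ht1 : ‖t‖ ≤ 1 := by
    have := IsUltrametricDist.norm_add_le_max (t - 1) 1
    rw [sub_add_cancel, norm_one] at this
    exact this.trans (max_le (ht.trans hρ.le) le_rfl)
  have h1 : ∀ i, ‖t ^ i - 1‖ ≤ ‖t - 1‖ := by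
    intro i
    induction i with
    | zero => simp
    | succ i ih =>
      rw [show t ^ (i + 1) - 1 = t * (t ^ i - 1) + (t - 1) by ring]
      refine (IsUltrametricDist.norm_add_le_max _ _).trans (max_le ?_ le_rfl)
      rw [norm_mul]
      exact (mul_le_of_le_one_left (norm_nonneg _) ht1).trans ih
  have h2 : ‖∑ i ∈ Finset.range c, t ^ i‖ ≤ ρ := by
    have : ∑ i ∈ Finset.range c, t ^ i = ∑ i ∈ Finset.range c, (t ^ i - 1) + c := by
      simp
    rw [this]
    refine (IsUltrametricDist.norm_add_le_max _ _).trans (max_le ?_ hc)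
    exact IsUltrametricDist.norm_sum_le_of_forall_le_of_nonneg ((norm_nonneg _).trans ht)
      fun i _ => (h1 i).trans ht
  rw [← geom_sum_mul, norm_mul]
  gcongr

/-- Away from the residue characteristic, a unit is, up to an exponent prime to `ℓ`, the product of
a root of unity of `ℓ`-power order and an arbitrarily deep `ℓ`-power. -/
theorem exists_unit_pow_eq [ProperSpace F] [CharZero F] {ℓ : ℕ} [hℓ : Fact ℓ.Prime] {c : ℕ}
    (hc : ‖(c : F)‖ < 1) (hcℓ : c.Coprime ℓ) (N : ℕ) {u : Fˣ} (hu : ‖(u : F)‖ = 1) :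
    ∃ m : ℕ, m.Coprime ℓ ∧ ∃ (ζ t : Fˣ) (s : ℕ), ζ ^ ℓ ^ s = 1 ∧ u ^ m = ζ * t ^ ℓ ^ N := by
  -- Two powers of `u` are close by compactness, so some `u^h` is a principal unit.
  obtain ⟨h, hh0, hh⟩ : ∃ h : ℕ, h ≠ 0 ∧ ‖(u : F) ^ h - 1‖ < 1 := by
    obtain ⟨i, j, hij, hlt⟩ := exists_norm_sub_lt (fun i : ℕ => (u : F) ^ i)
      (fun i => by simp [hu]) one_pos
    wlog hlt' : i < j generalizing i j
    · exact this j i hij.symm (by rw [norm_sub_rev]; exact hlt)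
        (lt_of_le_of_ne (not_lt.1 hlt') hij.symm)
    refine ⟨j - i, by omega, ?_⟩
    have : (u : F) ^ i * ((u : F) ^ (j - i) - 1) = (u : F) ^ j - (u : F) ^ i := by
      rw [mul_sub, ← pow_add, mul_one, Nat.add_sub_cancel' hlt'.le]
    rw [norm_sub_rev, ← this, norm_mul, norm_pow, hu, one_pow, one_mul] at hlt
    exact hlt
  obtain ⟨s, m, hm, rfl⟩ := Nat.exists_eq_pow_mul_and_not_dvd hh0 ℓ hℓ.out.ne_one
  -- The exponent is `N + s` because `h = ℓ^s m`: once `u^(h c^j)` is `y^(ℓ^(N+s))`, the elements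
  -- `u^(m c^j)` and `y^(ℓ^N)` have the same `ℓ^s`-th power, and their quotient is the required root
  -- of unity.
  obtain ⟨ε, hε, hpow⟩ := exists_pow_nhds_one (F := F) (n := ℓ ^ (N + s))
    (pow_ne_zero _ hℓ.out.ne_zero)
  set t : F := (u : F) ^ (ℓ ^ s * m) with ht
  set ρ : ℝ := max ‖(c : F)‖ ‖t - 1‖ with hρ
  have hρ1 : ρ < 1 := max_lt hc hh
  have hρ0 : 0 ≤ ρ := (norm_nonneg _).trans (le_max_left _ _)
  have hit : ∀ j, ‖t ^ c ^ j - 1‖ ≤ ρ ^ j * ρ := by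
    intro j
    induction j with
    | zero =>
      rw [pow_zero, pow_one, pow_zero, one_mul]
      exact le_max_right _ _
    | succ j ih =>
      rw [pow_succ, pow_mul]
      refine (norm_pow_sub_one_le (le_max_left _ _) hρ1 (ih.trans ?_)).trans ?_
      · exact mul_le_of_le_one_left hρ0 (pow_le_one₀ hρ0 hρ1.le)
      · calc ρ * ‖t ^ c ^ j - 1‖ ≤ ρ * (ρ ^ j * ρ) := by gcongr
          _ = ρ ^ (j + 1) * ρ := by ring
  obtain ⟨j, hj⟩ := exists_pow_lt_of_lt_one hε hρ1
  obtain ⟨y, hy⟩ := hpow (t ^ c ^ j) (((hit j).trans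
    (mul_le_of_le_one_right (pow_nonneg hρ0 _) hρ1.le)).trans_lt hj)
  have hy0 : y ≠ 0 := by
    rintro rfl
    rw [zero_pow (pow_ne_zero _ hℓ.out.ne_zero), ht] at hy
    exact pow_ne_zero _ (pow_ne_zero _ u.ne_zero) hy.symm
  have hyu : Units.mk0 y hy0 ^ ℓ ^ (N + s) = (u ^ (m * c ^ j)) ^ ℓ ^ s := by
    refine Units.ext ?_
    simp only [Units.val_pow_eq_pow_val, Units.val_mk0, hy, ht, ← pow_mul]
    congr 1; ring
  refine ⟨m * c ^ j, Nat.Coprime.mul_left ?_ (Nat.Coprime.pow_left _ hcℓ),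
    u ^ (m * c ^ j) / Units.mk0 y hy0 ^ ℓ ^ N, Units.mk0 y hy0, s, ?_, by rw [div_mul_cancel]⟩
  · exact ((Nat.Prime.coprime_iff_not_dvd hℓ.out).2 hm).symm
  · rw [div_pow, ← hyu, ← pow_mul, ← pow_add, div_self']

end LocalField

section AdicCompletion

/-! ### Completions of a number field as local fields -/

variable {K : Type*} [Field K] [NumberField K] (v : HeightOneSpectrum (𝓞 K))

instance : NontriviallyNormedField (v.adicCompletion K) :=
  Valued.toNontriviallyNormedField (v.adicCompletion K) (WithZero (Multiplicative ℤ))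

instance : CharZero (v.adicCompletion K) :=
  charZero_of_injective_algebraMap (algebraMap K (v.adicCompletion K)).injective

theorem adicCompletion_norm_lt_one_iff (x : v.adicCompletion K) : ‖x‖ < 1 ↔ Valued.v x < 1 :=
  Valued.toNormedField.norm_lt_one_iff
theorem adicCompletion_norm_le_one_iff (x : v.adicCompletion K) : ‖x‖ ≤ 1 ↔ Valued.v x ≤ 1 :=
  Valued.toNormedField.norm_le_one_iff

open Valued in
instance : Finite (Valued.ResidueField (v.adicCompletion K)) := by
  let f : 𝓞 K →+* Valued.ResidueField (v.adicCompletion K) :=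
    (IsLocalRing.residue (v.adicCompletionIntegers K)).comp (algebraMap (𝓞 K) (v.adicCompletionIntegers K))
  have hker : ∀ x ∈ v.asIdeal, f x = 0 := by
    intro x hx
    change IsLocalRing.residue (v.adicCompletionIntegers K) _ = 0
    rw [IsLocalRing.residue_eq_zero_iff, IsLocalRing.mem_maximalIdeal,
      mem_nonunits_iff, adicCompletionIntegers.isUnit_iff_valued_eq_one]
    have := (v.valuation_lt_one_iff_mem (K := K) x).2 hx
    rw [← valuedAdicCompletion_eq_valuation] at this
    exact this.ne
  -- Density twice: an element of `K` approximates `y` in the completion, and an algebraic integer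
  -- approximates that element modulo `v`.
  have hsurj : Function.Surjective (Ideal.Quotient.lift v.asIdeal f hker) := by
    intro z
    obtain ⟨y, rfl⟩ : ∃ y : v.adicCompletionIntegers K,
        IsLocalRing.residue (v.adicCompletionIntegers K) y = z := IsLocalRing.residue_surjective z
    obtain ⟨k, hk⟩ := (v.denseRange_algebraMap K).exists_dist_lt (y : v.adicCompletion K) one_pos
    rw [dist_eq_norm, adicCompletion_norm_lt_one_iff] at hk
    have hk1 : v.valuation K k ≤ 1 := by
      rw [← valuedAdicCompletion_eq_valuation', ← sub_sub_cancel (y : v.adicCompletion K)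
        ((k : K) : v.adicCompletion K)]
      exact (Valuation.map_sub _ _ _).trans (max_le y.2 hk.le)
    obtain ⟨a, ha⟩ := v.exists_valuation_sub_lt_of_integer hk1 1
    refine ⟨Ideal.Quotient.mk _ a, ?_⟩
    rw [Ideal.Quotient.lift_mk]
    change IsLocalRing.residue (v.adicCompletionIntegers K) _ =
      IsLocalRing.residue (v.adicCompletionIntegers K) y
    rw [← sub_eq_zero, ← map_sub, IsLocalRing.residue_eq_zero_iff, IsLocalRing.mem_maximalIdeal,
      mem_nonunits_iff, adicCompletionIntegers.isUnit_iff_valued_eq_one]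
    refine ne_of_lt ?_
    have h1 : Valued.v ((algebraMap K (v.adicCompletion K) k) - y) < 1 := by
      rwa [Valuation.map_sub_swap]
    have h2 : Valued.v (algebraMap K (v.adicCompletion K) (algebraMap (𝓞 K) K a - k)) < 1 := by
      have := valuedAdicCompletion_eq_valuation' v (algebraMap (𝓞 K) K a - k)
      exact this.trans_lt ha
    have h3 := Valuation.map_add_lt _ h2 h1
    rw [map_sub, sub_add_sub_cancel] at h3
    exact h3
  have : Finite (𝓞 K ⧸ v.asIdeal) := Ideal.finiteQuotientOfFreeOfNeBot _ v.ne_bot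
  exact Finite.of_surjective _ hsurj

instance : ProperSpace (v.adicCompletion K) := by
  rw [Valued.integer.properSpace_iff_completeSpace_and_isDiscreteValuationRing_integer_and_finite_residueField]
  exact ⟨inferInstance, inferInstanceAs (IsDiscreteValuationRing (v.adicCompletionIntegers K)), inferInstance⟩

theorem adicCompletion_norm_eq_one_iff (x : v.adicCompletion K) : ‖x‖ = 1 ↔ Valued.v x = 1 := by
  have h1 := adicCompletion_norm_lt_one_iff v x
  have h2 := adicCompletion_norm_le_one_iff v x
  rw [le_antisymm_iff, le_antisymm_iff, h2]
  exact and_congr_right fun _ => by rw [← not_lt, h1, not_lt]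

/-- The normalized exponent on the completion. -/
def localOrd (x : (v.adicCompletion K)ˣ) : ℤ :=
  -WithZero.log (Valued.v (x : v.adicCompletion K))

theorem localOrd_mul (x y : (v.adicCompletion K)ˣ) :
    localOrd v (x * y) = localOrd v x + localOrd v y := by
  simp only [localOrd, Units.val_mul, map_mul]
  rw [WithZero.log_mul (by simp) (by simp)]
  ring

/-- The normalized exponent on the completion as a homomorphism. -/
def localOrdHom : (v.adicCompletion K)ˣ →* Multiplicative ℤ :=
  MonoidHom.mk' (fun x => Multiplicative.ofAdd (localOrd v x)) fun x y => by
    rw [localOrd_mul, ofAdd_add]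

theorem localOrd_pow (x : (v.adicCompletion K)ˣ) (n : ℕ) :
    localOrd v (x ^ n) = n * localOrd v x := by
  have := congrArg Multiplicative.toAdd (map_pow (localOrdHom v) x n)
  simpa [localOrdHom] using this

theorem localOrd_zpow (x : (v.adicCompletion K)ˣ) (n : ℤ) :
    localOrd v (x ^ n) = n * localOrd v x := by
  have := congrArg Multiplicative.toAdd (map_zpow (localOrdHom v) x n)
  simpa [localOrdHom] using this

theorem localOrd_map (x : Kˣ) :
    localOrd v (Units.map (algebraMap K (v.adicCompletion K)).toMonoidHom x) = ord v x := by
  simp only [localOrd, ord]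
  congr 2
  exact valuedAdicCompletion_eq_valuation' v (x : K)

theorem localOrd_eq_zero_iff (x : (v.adicCompletion K)ˣ) :
    localOrd v x = 0 ↔ ‖(x : v.adicCompletion K)‖ = 1 := by
  rw [adicCompletion_norm_eq_one_iff, localOrd, neg_eq_zero]
  constructor
  · intro h
    rw [← WithZero.exp_log (x := Valued.v (x : v.adicCompletion K)) (by simp), h, WithZero.exp_zero]
  · intro h
    rw [h, WithZero.log_one]

theorem exists_localOrd_eq_one : ∃ x : Kˣ, ord v x = 1 := by
  obtain ⟨π, hπ⟩ := v.valuation_exists_uniformizer K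
  have h0 : π ≠ 0 := by
    rintro rfl
    rw [map_zero] at hπ
    exact WithZero.exp_ne_zero hπ.symm
  exact ⟨Units.mk0 π h0, by simp [ord, hπ]⟩

/-- The witness is the residue characteristic, which differs from `ℓ` at a tame place. -/
theorem exists_nat_norm_lt_one {ℓ : ℕ} [hℓ : Fact ℓ.Prime] (h : (ℓ : 𝓞 K) ∉ v.asIdeal) :
    ∃ c : ℕ, ‖(c : v.adicCompletion K)‖ < 1 ∧ c.Coprime ℓ := by
  have : Finite (𝓞 K ⧸ v.asIdeal) := Ideal.finiteQuotientOfFreeOfNeBot _ v.ne_bot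
  have : v.asIdeal.IsPrime := v.isPrime
  obtain ⟨p, hp⟩ := CharP.exists (𝓞 K ⧸ v.asIdeal)
  have hp0 : p.Prime := (CharP.char_is_prime_or_zero (𝓞 K ⧸ v.asIdeal) p).resolve_right
    (CharP.char_ne_zero_of_finite (𝓞 K ⧸ v.asIdeal) p)
  have hmem : (p : 𝓞 K) ∈ v.asIdeal := by
    rw [← Ideal.Quotient.eq_zero_iff_mem, map_natCast, CharP.cast_eq_zero]
  refine ⟨p, ?_, (Nat.coprime_primes hp0 hℓ.out).2 ?_⟩
  · rw [adicCompletion_norm_lt_one_iff]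
    have := (v.valuation_lt_one_iff_mem (K := K) _).2 hmem
    rw [← valuedAdicCompletion_eq_valuation] at this
    simpa using this
  · rintro rfl
    exact h hmem

theorem norm_algebraMap_eq (x : K) :
    ‖algebraMap K (v.adicCompletion K) x‖ = HeightOneSpectrum.adicAbv K v x :=
  FinitePlace.norm_embedding v x

theorem not_isEquiv_adicAbv {v w : HeightOneSpectrum (𝓞 K)} (h : v ≠ w) :
    ¬ (HeightOneSpectrum.adicAbv K v).IsEquiv (HeightOneSpectrum.adicAbv K w) := by
  intro he
  apply h
  refine HeightOneSpectrum.ext (Ideal.ext fun x => ?_)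
  rw [← v.adicAbv_coe_lt_one_iff (K := K) (HeightOneSpectrum.one_lt_absNorm_nnreal v),
    ← w.adicAbv_coe_lt_one_iff (K := K) (HeightOneSpectrum.one_lt_absNorm_nnreal w)]
  exact he.lt_one_iff

theorem isNontrivial_adicAbv (v : HeightOneSpectrum (𝓞 K)) :
    (HeightOneSpectrum.adicAbv K v).IsNontrivial := by
  obtain ⟨x, hx⟩ := exists_localOrd_eq_one v
  refine ⟨x, x.ne_zero, ?_⟩
  rw [← norm_algebraMap_eq]
  intro h
  have := (localOrd_eq_zero_iff v
    (Units.map (algebraMap K (v.adicCompletion K)).toMonoidHom x)).2 h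
  rw [localOrd_map, hx] at this
  exact one_ne_zero this

/-- Weak approximation at finitely many finite places. -/
theorem exists_norm_sub_lt_of_finite {ι : Type*} [Finite ι] (v : ι → HeightOneSpectrum (𝓞 K))
    (hv : Function.Injective v) (b : ∀ i, (v i).adicCompletion K) {ε : ℝ} (hε : 0 < ε) :
    ∃ x : K, ∀ i, ‖b i - algebraMap K _ x‖ < ε := by
  have := Fintype.ofFinite ι
  choose k hk using fun i => ((v i).denseRange_algebraMap K).exists_dist_lt (b i) (half_pos hε)
  have hd := AbsoluteValue.denseRange_algebraMap_pi (fun i => isNontrivial_adicAbv (v i))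
    (fun i j hij => not_isEquiv_adicAbv (hv.ne hij))
  obtain ⟨x, hx⟩ := hd.exists_dist_lt (fun i => (WithAbs.equiv _).symm (k i)) (half_pos hε)
  refine ⟨x, fun i => ?_⟩
  have h1 := (dist_pi_lt_iff (half_pos hε)).1 hx i
  rw [dist_eq_norm] at h1
  have h2 : ‖algebraMap K ((v i).adicCompletion K) (k i - x)‖ < ε / 2 := by
    rw [norm_algebraMap_eq]
    exact h1
  have h3 := hk i
  rw [dist_eq_norm] at h3
  calc _ = ‖(b i - algebraMap K _ (k i)) + algebraMap K _ (k i - x)‖ := by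
        rw [map_sub, sub_add_sub_cancel]
    _ ≤ _ := norm_add_le _ _
    _ < ε / 2 + ε / 2 := add_lt_add h3 h2
    _ = ε := add_halves ε

end AdicCompletion

section Semilocal

/-! ### Semilocal approximation above `ℓ` -/

variable {ℓ : ℕ} [hℓ : Fact ℓ.Prime] {K : Type*} [Field K] [NumberField K]

instance finite_wildPlace : Finite (WildPlace ℓ K) := by
  have h0 : Ideal.span {(ℓ : 𝓞 K)} ≠ 0 := by
    rw [Ideal.zero_eq_bot, Ne, Ideal.span_singleton_eq_bot]
    exact_mod_cast hℓ.out.ne_zero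
  refine Set.finite_coe_iff.2 ((Ideal.finite_factors h0).subset fun v hv => ?_)
  rw [Set.mem_ofPred_eq, Ideal.dvd_span_singleton]
  exact hv

/-- The diagonal embedding of `Kˣ` in the product of the local groups at the places above `ℓ`. -/
def wildDiagonal (ℓ : ℕ) [Fact ℓ.Prime] (K : Type*) [Field K] [NumberField K] :
    Kˣ →* ∀ v : WildPlace ℓ K, (v.1.adicCompletion K)ˣ :=
  MonoidHom.mk' (fun x v => Units.map (algebraMap K (v.1.adicCompletion K)).toMonoidHom x)
    fun x y => by ext v; simp

/-- Weak approximation gives a global `x` so close to every `b v` that `x / b v` falls in the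
neighbourhood of `1` made of `ℓ`-th powers. -/
theorem exists_wildDiagonal_mul_pow (b : ∀ v : WildPlace ℓ K, (v.1.adicCompletion K)ˣ) :
    ∃ (a : Kˣ) (c : ∀ v : WildPlace ℓ K, (v.1.adicCompletion K)ˣ),
      b = wildDiagonal ℓ K a * c ^ ℓ := by
  cases isEmpty_or_nonempty (WildPlace ℓ K) with
  | inl h => exact ⟨1, 1, funext fun v => h.elim v⟩
  | inr hne =>
    have := Fintype.ofFinite (WildPlace ℓ K)
    choose ε hε hpow using fun v : WildPlace ℓ K =>
      exists_pow_nhds_one (F := v.1.adicCompletion K) hℓ.out.ne_zero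
    have hpos : ∀ v, 0 < min (ε v) 1 * ‖(b v : v.1.adicCompletion K)‖ := fun v =>
      mul_pos (lt_min (hε v) one_pos) (norm_pos_iff.2 (b v).ne_zero)
    obtain ⟨v₀, -, hv₀⟩ := Finset.univ.exists_min_image
      (fun v => min (ε v) 1 * ‖(b v : v.1.adicCompletion K)‖) Finset.univ_nonempty
    obtain ⟨x, hx⟩ := exists_norm_sub_lt_of_finite (fun v : WildPlace ℓ K => v.1)
      Subtype.val_injective (fun v => (b v : v.1.adicCompletion K)) (hpos v₀)
    have hx' : ∀ v : WildPlace ℓ K,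
        ‖(b v : v.1.adicCompletion K)⁻¹ * algebraMap K _ x - 1‖ < min (ε v) 1 := by
      intro v
      have h1 : (b v : v.1.adicCompletion K)⁻¹ * algebraMap K _ x - 1 =
          -((b v - algebraMap K _ x) / b v) := by
        have := (b v).ne_zero
        field_simp
        ring
      rw [h1, norm_neg, norm_div, div_lt_iff₀ (norm_pos_iff.2 (b v).ne_zero)]
      exact (hx v).trans_le (hv₀ v (Finset.mem_univ v))
    have hx0 : x ≠ 0 := by
      rintro rfl
      have := (hx' v₀).trans_le (min_le_right _ _)
      simp at this
    choose y hy using fun v => hpow v _ ((hx' v).trans_le (min_le_left _ _))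
    have hy0 : ∀ v, y v ≠ 0 := by
      intro v h
      have := hy v
      rw [h, zero_pow hℓ.out.ne_zero] at this
      exact mul_ne_zero (inv_ne_zero (b v).ne_zero)
        ((map_ne_zero (algebraMap K (v.1.adicCompletion K))).2 hx0) this.symm
    refine ⟨Units.mk0 x hx0, fun v => (Units.mk0 (y v) (hy0 v))⁻¹, ?_⟩
    refine funext fun v => Units.ext ?_
    have h2 : (b v : v.1.adicCompletion K) = algebraMap K _ x * (y v)⁻¹ ^ ℓ := by
      rw [inv_pow, hy v]
      have := (b v).ne_zero
      have := (map_ne_zero (algebraMap K (v.1.adicCompletion K))).2 hx0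
      field_simp
    simpa [wildDiagonal] using h2

/-- Local components at the wild places can be prescribed exactly once the exponents are `ℓ`-adic.
The finiteness of the local groups modulo `ℓ`-th powers supplies the finite set needed by
`LCompletion.exists_of_map_eq`. -/
theorem exists_localization_eq (b : ∀ v : WildPlace ℓ K, (v.1.adicCompletion K)ˣ) :
    ∃ r : LTensor ℓ Kˣ, ∀ v : WildPlace ℓ K,
      localization ℓ v.1 r = LCompletion.of ℓ _ (LTensor.ι ℓ (b v)) := by
  classical
  have := Fintype.ofFinite (WildPlace ℓ K)
  choose T hT using fun v : WildPlace ℓ K =>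
    exists_finset_units_pow (F := v.1.adicCompletion K) hℓ.out.ne_zero
  choose α c hc using exists_wildDiagonal_mul_pow (ℓ := ℓ) (K := K)
  obtain ⟨r, hr⟩ := LCompletion.exists_of_map_eq (wildDiagonal ℓ K)
    ((Fintype.piFinset T).image α) (by
      intro b
      choose t ht d hd using fun v => hT v (b v)
      refine ⟨α t, Finset.mem_image_of_mem _ (Fintype.mem_piFinset.2 ht), c t * d, ?_⟩
      rw [mul_pow, ← mul_assoc, ← hc]
      exact funext hd) b
  refine ⟨r, fun v => ?_⟩
  have := congrArg (AdicCompletion.map (Ideal.span {(ℓ : ℤ_[ℓ])})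
    (LTensor.map ℓ (Pi.evalMonoidHom (fun v : WildPlace ℓ K => (v.1.adicCompletion K)ˣ) v))) hr
  rw [LCompletion.map_of, LCompletion.map_of, map_comp_apply, LTensor.map_ι] at this
  exact this

end Semilocal

section Exponents

/-! ### Valuations of geometric sums -/

variable {ℓ : ℕ} [hℓ : Fact ℓ.Prime]

theorem geomSum_mul_pred {u : ℕ} (hu : 1 ≤ u) (n : ℕ) :
    (∑ i ∈ Finset.range n, u ^ i) * (u - 1) = u ^ n - 1 := by
  have h := geom_sum_mul (u : ℤ) n
  zify [hu, Nat.one_le_pow n u hu]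
  exact h

/-- Lifting the exponent; the oddness of `ℓ` enters here. -/
theorem padicValNat_pow_sub_one (hℓ2 : ℓ ≠ 2) {u : ℕ} (hu : 1 < u) (hdvd : ℓ ∣ u - 1) {n : ℕ}
    (hn : n ≠ 0) : padicValNat ℓ (u ^ n - 1) = padicValNat ℓ (u - 1) + padicValNat ℓ n := by
  have h1 : ¬ ℓ ∣ u := fun h => hℓ.out.one_lt.ne' (Nat.dvd_one.1 (by
    have := Nat.dvd_sub h hdvd
    rwa [Nat.sub_sub_self hu.le] at this))
  have := padicValNat.pow_sub_pow (hℓ.out.odd_of_ne_two hℓ2) hu hdvd h1 hn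
  rwa [one_pow] at this

theorem padicValNat_geomSum (hℓ2 : ℓ ≠ 2) {u : ℕ} (hu : 1 < u) (hdvd : ℓ ∣ u - 1) {n : ℕ}
    (hn : n ≠ 0) : padicValNat ℓ (∑ i ∈ Finset.range n, u ^ i) = padicValNat ℓ n := by
  have h := padicValNat_pow_sub_one hℓ2 hu hdvd hn
  have h0 : ∑ i ∈ Finset.range n, u ^ i ≠ 0 := by
    intro h0
    have := geomSum_mul_pred hu.le n
    rw [h0, zero_mul] at this
    have := Nat.one_lt_pow hn hu
    omega
  rw [← geomSum_mul_pred hu.le, padicValNat.mul h0 (by omega)] at h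
  omega

theorem geomSum_ne_zero {u : ℕ} (hu : 1 < u) {n : ℕ} (hn : n ≠ 0) :
    ∑ i ∈ Finset.range n, u ^ i ≠ 0 := by
  intro h0
  have := geomSum_mul_pred hu.le n
  rw [h0, zero_mul] at this
  have := Nat.one_lt_pow hn hu
  omega

theorem exists_mul_modEq {m e a b : ℕ} (hm : m ≠ 0) (ha : padicValNat ℓ m = a) (he : ℓ ^ a ∣ e) :
    ∃ f, m * f ≡ e [MOD ℓ ^ b] := by
  obtain ⟨e', rfl⟩ := he
  obtain ⟨w, hw⟩ := pow_padicValNat_dvd (p := ℓ) (n := m)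
  rw [ha] at hw
  have hcop : w.Coprime (ℓ ^ b) := by
    refine Nat.Coprime.pow_right _ (((Nat.Prime.coprime_iff_not_dvd hℓ.out).2 ?_).symm)
    rintro ⟨w', rfl⟩
    refine pow_succ_padicValNat_not_dvd (p := ℓ) hm ?_
    rw [ha, pow_succ, hw, ← mul_assoc]
    exact dvd_mul_right _ _
  have : NeZero (ℓ ^ b) := ⟨pow_ne_zero _ hℓ.out.ne_zero⟩
  refine ⟨((w : ZMod (ℓ ^ b))⁻¹ * (e' : ZMod (ℓ ^ b))).val, ?_⟩
  rw [← ZMod.natCast_eq_natCast_iff, hw]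
  push_cast
  rw [ZMod.natCast_val, ZMod.cast_id, ← mul_assoc, mul_assoc _ (w : ZMod (ℓ ^ b)),
    ZMod.coe_mul_inv_eq_one w hcop, mul_one]

/-- A cohomological vanishing in elementary form: for the cyclic group generated by `u` acting on
`ℤ/ℓ^b`, an element killed by the norm is a multiple of `u - 1`. The norm is the geometric sum, of
valuation `b - a` with `a` the valuation of `u - 1`, so it kills only multiples of `ℓ^a`. -/
theorem exists_period (hℓ2 : ℓ ≠ 2) {u : ℕ} (hu : 1 < u) (hdvd : ℓ ∣ u - 1) (b : ℕ) :
    ∃ d, d ≠ 0 ∧ u ^ d ≡ 1 [MOD ℓ ^ b] ∧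
      ∀ e, ℓ ^ b ∣ e * ∑ i ∈ Finset.range d, u ^ i → ∃ f, (u - 1) * f ≡ e [MOD ℓ ^ b] := by
  set a := padicValNat ℓ (u - 1) with ha
  have hd0 : ℓ ^ (b - a) ≠ 0 := pow_ne_zero _ hℓ.out.ne_zero
  -- Subtraction is truncated: if `a ≥ b`, then `u` acts trivially and the period is `1`.
  refine ⟨ℓ ^ (b - a), hd0, ?_, fun e he => ?_⟩
  · refine ((Nat.modEq_iff_dvd' (Nat.one_le_pow _ _ (by omega))).2 ?_).symm
    have h0 : u ^ ℓ ^ (b - a) - 1 ≠ 0 := by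
      have := Nat.one_lt_pow hd0 hu
      omega
    rw [padicValNat_dvd_iff_le h0, padicValNat_pow_sub_one hℓ2 hu hdvd hd0, padicValNat.prime_pow]
    omega
  · rcases eq_or_ne e 0 with rfl | he0
    · exact ⟨0, rfl⟩
    have hS := geomSum_ne_zero hu hd0
    rw [padicValNat_dvd_iff_le (mul_ne_zero he0 hS), padicValNat.mul he0 hS,
      padicValNat_geomSum hℓ2 hu hdvd hd0, padicValNat.prime_pow] at he
    rcases le_or_gt a b with hab | hab
    · refine exists_mul_modEq (by omega) ha.symm ?_
      rw [padicValNat_dvd_iff_le he0]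
      omega
    · refine ⟨0, ?_⟩
      rw [mul_zero]
      refine ((Nat.modEq_zero_iff_dvd).2 ?_).symm
      rw [padicValNat_dvd_iff_le he0]
      omega

end Exponents

section RootsOfUnity

/-! ### Roots of unity and radicals in cyclotomic extensions -/

variable {ℓ : ℕ} [hℓ : Fact ℓ.Prime]

/-- A generator of the finite group of roots of unity of `ℓ`-power order. -/
theorem exists_primary_generator (E : Type*) [Field E] [Finite (CommGroup.primaryComponent Eˣ ℓ)] :
    ∃ (ζ : E) (b : ℕ), IsPrimitiveRoot ζ (ℓ ^ b) ∧
      Nat.card (CommGroup.primaryComponent Eˣ ℓ) = ℓ ^ b ∧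
      ∀ z : E, (∃ n, z ^ ℓ ^ n = 1) → ∃ i < ℓ ^ b, z = ζ ^ i := by
  obtain ⟨g, hg⟩ := IsCyclic.exists_generator (α := CommGroup.primaryComponent Eˣ ℓ)
  obtain ⟨b, hb⟩ := CommGroup.mem_primaryComponent_iff_orderOf.1 g.2
  have hprim : IsPrimitiveRoot ((g : Eˣ) : E) (ℓ ^ b) := by
    rw [IsPrimitiveRoot.coe_units_iff, ← hb]
    exact IsPrimitiveRoot.orderOf _
  have : NeZero (ℓ ^ b) := ⟨pow_ne_zero _ hℓ.out.ne_zero⟩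
  refine ⟨((g : Eˣ) : E), b, hprim, ?_, ?_⟩
  · rw [← orderOf_eq_card_of_forall_mem_zpowers hg, ← hb, Subgroup.orderOf_coe]
  · rintro z ⟨n, hn⟩
    have hz0 : z ≠ 0 := by
      rintro rfl
      rw [zero_pow (pow_ne_zero _ hℓ.out.ne_zero)] at hn
      exact zero_ne_one hn
    obtain ⟨k, hk⟩ := hg ⟨Units.mk0 z hz0, n, Units.ext (by simpa using hn)⟩
    have h1 : (g : Eˣ) ^ k = Units.mk0 z hz0 := by simpa using congrArg Subtype.val hk
    have h2 : z ^ ℓ ^ b = 1 := by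
      have h3 : (Units.mk0 z hz0) ^ ℓ ^ b = 1 := by
        rw [← h1, ← zpow_natCast, ← zpow_mul, mul_comm, zpow_mul, zpow_natCast, ← hb,
          pow_orderOf_eq_one, one_zpow]
      simpa using congrArg Units.val h3
    obtain ⟨i, hi, h⟩ := hprim.eq_pow_of_pow_eq_one h2
    exact ⟨i, hi, h.symm⟩

/-- Fixing `ω` forces the exponent to be `1` modulo `ℓ`. This is where the hypothesis that `K`
contains the `ℓ`-th roots of unity acts on all the counting. -/
theorem exists_exponent {E : Type*} [Field E] {ζ ω : E} {b : ℕ} (hζ : IsPrimitiveRoot ζ (ℓ ^ b))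
    (hω : IsPrimitiveRoot ω ℓ) {E' : Type*} [FunLike E' E E] [RingHomClass E' E E] (σ : E')
    (hσ : σ ω = ω) : ∃ u, 1 < u ∧ ℓ ∣ u - 1 ∧ σ ζ = ζ ^ u := by
  cases b with
  | zero =>
    rw [pow_zero, IsPrimitiveRoot.one_right_iff] at hζ
    exact ⟨1 + ℓ, by have := hℓ.out.pos; omega, by simp, by simp [hζ]⟩
  | succ b =>
    have : NeZero (ℓ ^ (b + 1)) := ⟨pow_ne_zero _ hℓ.out.ne_zero⟩
    have : NeZero ℓ := ⟨hℓ.out.ne_zero⟩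
    obtain ⟨i, -, hi⟩ := hζ.eq_pow_of_pow_eq_one (ξ := σ ζ) (by
      rw [← map_pow, hζ.pow_eq_one, map_one])
    have hprim : IsPrimitiveRoot (ζ ^ ℓ ^ b) ℓ :=
      hζ.pow (pow_pos hℓ.out.pos _) (by rw [pow_succ])
    obtain ⟨j, -, hj⟩ := hω.eq_pow_of_pow_eq_one hprim.pow_eq_one
    have hfix : σ (ζ ^ ℓ ^ b) = ζ ^ ℓ ^ b := by rw [← hj, map_pow, hσ]
    rw [map_pow, ← hi, ← pow_mul, mul_comm, pow_mul] at hfix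
    have hi0 : 1 ≤ i := by
      rcases Nat.eq_zero_or_pos i with rfl | h
      · rw [pow_zero] at hfix
        exact absurd hfix.symm (hprim.ne_one hℓ.out.one_lt)
      · exact h
    have h1 : (ζ ^ ℓ ^ b) ^ (i - 1) = 1 := by
      have h0 : ζ ^ ℓ ^ b ≠ 0 := hprim.ne_zero hℓ.out.ne_zero
      have : (ζ ^ ℓ ^ b) ^ (i - 1) * ζ ^ ℓ ^ b = 1 * ζ ^ ℓ ^ b := by
        rw [← pow_succ, Nat.sub_add_cancel hi0, hfix, one_mul]
      exact mul_right_cancel₀ h0 this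
    -- Adding the order of `ζ` is harmless and ensures the strict inequality `1 < u` that the
    -- valuation lemmas require.
    refine ⟨i + ℓ ^ (b + 1), ?_, ?_, ?_⟩
    · have := Nat.one_lt_pow (Nat.succ_ne_zero b) hℓ.out.one_lt
      rw [Nat.succ_eq_add_one] at this
      omega
    · rw [Nat.sub_add_comm hi0]
      exact dvd_add (hprim.dvd_of_pow_eq_one _ h1) (dvd_pow_self _ (Nat.succ_ne_zero b))
    · rw [pow_add, hζ.pow_eq_one, mul_one, hi]

theorem pow_eq_pow_of_modEq {E : Type*} [Field E] {ζ : E} {k m n : ℕ} (hζ : IsPrimitiveRoot ζ k)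
    (h : m ≡ n [MOD k]) : ζ ^ m = ζ ^ n := by
  rw [← Nat.div_add_mod m k, ← Nat.div_add_mod n k, pow_add, pow_add, pow_mul, pow_mul,
    hζ.pow_eq_one, one_pow, one_pow, show m % k = n % k from h]

theorem iterate_root {E : Type*} [Field E] {ζ x : E} {u e : ℕ} {E' : Type*} [FunLike E' E E]
    [RingHomClass E' E E] (σ : E') (hσ : σ ζ = ζ ^ u) (hx : σ x = ζ ^ e * x) (n : ℕ) :
    σ^[n] ζ = ζ ^ u ^ n ∧ σ^[n] x = ζ ^ (e * ∑ i ∈ Finset.range n, u ^ i) * x := by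
  induction n with
  | zero => simp
  | succ n ih =>
    rw [Function.iterate_succ_apply', Function.iterate_succ_apply', ih.1, ih.2, map_pow, hσ,
      map_mul, map_pow, hσ, hx, Finset.sum_range_succ']
    constructor
    · rw [← pow_mul, pow_succ']
    · rw [← pow_mul, ← mul_assoc, ← pow_add]
      congr 2
      rw [mul_add, pow_zero, mul_one, mul_comm u, mul_assoc, Finset.sum_mul]
      simp only [pow_succ]

variable {F E : Type*} [Field F] [Field E] [Algebra F E]

/-- If `δ^d` fixes `ζ`, it fixes `x`, so the norm of the cocycle value `ζ^e` is trivial. By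
`exists_period` `ζ^e = ζ^((u-1)f) = δ(ζ^f) / ζ^f`, so `x / ζ^f` is invariant. -/
theorem exists_root_mul_of_mem_adjoin (hℓ2 : ℓ ≠ 2) [FiniteDimensional F E] [IsGalois F E]
    {δ : Gal(E/F)} (hδ : ∀ τ, τ ∈ Subgroup.zpowers δ) {ω : F} (hω : IsPrimitiveRoot ω ℓ)
    {ζ : E} {b : ℕ} (hζ : IsPrimitiveRoot ζ (ℓ ^ b)) {x : E} (hx0 : x ≠ 0)
    (hx : x ∈ IntermediateField.adjoin F {ζ}) {e : ℕ} (hδx : δ x = ζ ^ e * x) :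
    ∃ (f : ℕ) (k : F), x = ζ ^ f * algebraMap F E k := by
  obtain ⟨u, hu, hdvd, hu'⟩ := exists_exponent hζ (hω.map_of_injective (algebraMap F E).injective)
    δ (δ.commutes ω)
  obtain ⟨d, hd0, hd, hf⟩ := exists_period hℓ2 hu hdvd b
  obtain ⟨h1, h2⟩ := iterate_root δ hu' hδx d
  have hζ0 : ζ ≠ 0 := hζ.ne_zero (pow_ne_zero _ hℓ.out.ne_zero)
  have hiter : ∀ y, δ^[d] y = (δ ^ d) y := by
    intro y
    rw [AlgEquiv.coe_pow]
  have hfix : (δ ^ d) x = x := by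
    have hmem : IntermediateField.adjoin F {ζ} ≤
        IntermediateField.fixedField (Subgroup.zpowers (δ ^ d)) := by
      rw [IntermediateField.adjoin_le_iff, Set.singleton_subset_iff]
      rintro ⟨τ, k, rfl⟩
      have h3 : (δ ^ d) ζ = ζ := by
        rw [← hiter, h1]
        rw [pow_eq_pow_of_modEq hζ hd, pow_one]
      have h4 : δ ^ d ∈ MulAction.stabilizer Gal(E/F) ζ := h3
      exact Subgroup.zpow_mem _ h4 k
    exact hmem hx ⟨δ ^ d, Subgroup.mem_zpowers _⟩
  rw [hiter, hfix] at h2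
  have h5 : ζ ^ (e * ∑ i ∈ Finset.range d, u ^ i) = 1 :=
    mul_right_cancel₀ hx0 (by rw [← h2, one_mul])
  obtain ⟨f, hf⟩ := hf e (hζ.dvd_of_pow_eq_one _ h5)
  have h6 : ζ ^ ((u - 1) * f) = ζ ^ e := pow_eq_pow_of_modEq hζ hf
  have hy : δ (x / ζ ^ f) = x / ζ ^ f := by
    rw [map_div₀, map_pow, hu', hδx, ← h6, div_eq_div_iff (pow_ne_zero _ (pow_ne_zero _ hζ0))
      (pow_ne_zero _ hζ0), ← pow_mul, mul_right_comm, ← pow_add, mul_comm, ← Nat.succ_mul,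
      Nat.succ_eq_add_one, Nat.sub_add_cancel hu.le]
  have hall : ∀ τ : Gal(E/F), τ (x / ζ ^ f) = x / ζ ^ f := by
    intro τ
    obtain ⟨k, rfl⟩ := hδ τ
    have h4 : δ ∈ MulAction.stabilizer Gal(E/F) (x / ζ ^ f) := hy
    exact Subgroup.zpow_mem _ h4 k
  obtain ⟨k, hk⟩ := (IsGalois.mem_range_algebraMap_iff_fixed _).2 hall
  exact ⟨f, k, by rw [hk, mul_div_cancel₀ _ (pow_ne_zero _ hζ0)]⟩

theorem mem_adjoin_of_fixed [FiniteDimensional F E] [IsGalois F E] {ζ x : E}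
    (h : ∀ τ : Gal(E/F), τ ζ = ζ → τ x = x) : x ∈ IntermediateField.adjoin F {ζ} := by
  rw [← IsGalois.fixedField_fixingSubgroup (IntermediateField.adjoin F {ζ})]
  rintro ⟨τ, hτ⟩
  exact h τ (hτ ⟨ζ, IntermediateField.mem_adjoin_simple_self F ζ⟩)

theorem isIntegral_root {n : ℕ} [NeZero n] {ζ : E} (hζ : IsPrimitiveRoot ζ n) : IsIntegral F ζ :=
  ⟨Polynomial.X ^ n - 1, Polynomial.monic_X_pow_sub_C 1 (NeZero.ne _), by simp [hζ.pow_eq_one]⟩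

theorem isCyclotomicExtension_adjoin {n : ℕ} [NeZero n] {ζ : E} (hζ : IsPrimitiveRoot ζ n) :
    IsCyclotomicExtension {n} F (IntermediateField.adjoin F {ζ}) := by
  change IsCyclotomicExtension {n} F (IntermediateField.adjoin F {ζ}).toSubalgebra
  rw [IntermediateField.adjoin_simple_toSubalgebra_of_isAlgebraic
    (isIntegral_root hζ).isAlgebraic]
  exact hζ.adjoin_isCyclotomicExtension F

theorem isPrimitiveRoot_gen {n : ℕ} {ζ : E} (hζ : IsPrimitiveRoot ζ n) :
    IsPrimitiveRoot (IntermediateField.AdjoinSimple.gen F ζ) n :=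
  IsPrimitiveRoot.of_map_of_injective (f := algebraMap (IntermediateField.adjoin F {ζ}) E)
    hζ (FaithfulSMul.algebraMap_injective _ E)

/-- Over a field containing the `ℓ`-th roots of unity, the cyclotomic `ℤ_ℓ`-extension is generated
by the roots of unity of `ℓ`-power order. -/
theorem cyclotomicExt_eq_adjoin (hℓ2 : ℓ ≠ 2) {ω : F} (hω : IsPrimitiveRoot ω ℓ) :
    cyclotomicExt ℓ F E = IntermediateField.adjoin F {ζ : E | ∃ n : ℕ, ζ ^ ℓ ^ n = 1} := by
  apply le_antisymm
  · exact sSup_le fun M hM => hM.1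
  · rw [IntermediateField.adjoin_le_iff]
    rintro ζ ⟨n, hn⟩
    obtain ⟨b, -, hb⟩ := (Nat.dvd_prime_pow hℓ.out).1 (orderOf_dvd_of_pow_eq_one hn)
    have hζ : IsPrimitiveRoot ζ (ℓ ^ b) := hb ▸ IsPrimitiveRoot.orderOf ζ
    have : NeZero (ℓ ^ b) := ⟨pow_ne_zero _ hℓ.out.ne_zero⟩
    have hint : IsIntegral F ζ := isIntegral_root hζ
    have hcyc := isCyclotomicExtension_adjoin (F := F) hζ
    have hgal := IsCyclotomicExtension.isGalois {ℓ ^ b} F (IntermediateField.adjoin F {ζ})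
    have hfd := IntermediateField.adjoin.finiteDimensional hint
    refine (le_sSup (a := IntermediateField.adjoin F {ζ}) ?_ :
      IntermediateField.adjoin F {ζ} ≤ cyclotomicExt ℓ F E)
      (IntermediateField.mem_adjoin_simple_self F ζ)
    refine ⟨?_, hfd, hgal, ?_⟩
    · exact IntermediateField.adjoin.mono _ _ _ (Set.singleton_subset_iff.2 ⟨n, hn⟩)
    · rw [← IsGalois.card_aut_eq_finrank]
      -- Exponents congruent to `1` modulo `ℓ` become `1` modulo `ℓ^b` after raising to the power
      -- `ℓ^b`, so the Galois group of `F(ζ)` is an `ℓ`-group.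
      refine IsPGroup.iff_card.1 fun σ => ⟨b, ?_⟩
      have hprim := isPrimitiveRoot_gen (F := F) hζ
      obtain ⟨u, hu, hdvd, hu'⟩ := exists_exponent hprim
        (hω.map_of_injective (algebraMap F (IntermediateField.adjoin F {ζ})).injective)
        σ (σ.commutes ω)
      have h1 := (iterate_root (x := 0) (e := 0) σ hu' (by simp) (ℓ ^ b)).1
      have h2 : u ^ ℓ ^ b ≡ 1 [MOD ℓ ^ b] := by
        refine ((Nat.modEq_iff_dvd' (Nat.one_le_pow _ _ (by omega))).2 ?_).symm
        have h0 : u ^ ℓ ^ b - 1 ≠ 0 := by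
          have := Nat.one_lt_pow (NeZero.ne (ℓ ^ b)) hu
          omega
        rw [padicValNat_dvd_iff_le h0, padicValNat_pow_sub_one hℓ2 hu hdvd (NeZero.ne _),
          padicValNat.prime_pow]
        omega
      rw [pow_eq_pow_of_modEq hprim h2, pow_one, ← AlgEquiv.coe_pow] at h1
      apply AlgEquiv.coe_toAlgHom_injective
      refine (IntermediateField.adjoin.powerBasis hint).algHom_ext ?_
      rw [IntermediateField.adjoin.powerBasis_gen]
      exact h1

/-- An element of the cyclotomic extension having an `ℓ`-power in the base field is, up to the base
field, a root of unity. -/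
theorem exists_root_mul_of_mem_cyclotomic (hℓ2 : ℓ ≠ 2) [CharZero F] [IsAlgClosed E] {ω : F}
    (hω : IsPrimitiveRoot ω ℓ) {y : E} (hy0 : y ≠ 0)
    (hy : y ∈ IntermediateField.adjoin F {ζ : E | ∃ n : ℕ, ζ ^ ℓ ^ n = 1}) {n : ℕ} {a : F}
    (ha : y ^ ℓ ^ n = algebraMap F E a) :
    ∃ (z : E) (m : ℕ) (k : F), z ^ ℓ ^ m = 1 ∧ y = z * algebraMap F E k := by
  have : CharZero E := charZero_of_injective_algebraMap (algebraMap F E).injective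
  obtain ⟨T, hT, hyT⟩ := IntermediateField.exists_finset_of_mem_adjoin hy
  choose! m hm using fun ζ (h : ζ ∈ T) => hT h
  -- Large enough for one root `ζ` of order `ℓ^c` to generate both the roots of unity used to
  -- express `y` and the `ℓ^n`-th roots of unity `δ y / y`.
  set c := n + T.sup m with hc
  have hne : NeZero (ℓ ^ c) := ⟨pow_ne_zero _ hℓ.out.ne_zero⟩
  obtain ⟨ζ, hζ⟩ := HasEnoughRootsOfUnity.exists_primitiveRoot E (ℓ ^ c)
  have hroot : ∀ z : E, z ^ ℓ ^ c = 1 → ∃ i, ζ ^ i = z := fun z hz => by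
    obtain ⟨i, -, hi⟩ := hζ.eq_pow_of_pow_eq_one hz
    exact ⟨i, hi⟩
  have hyζ : y ∈ IntermediateField.adjoin F {ζ} := by
    refine (IntermediateField.adjoin_le_iff.2 ?_ :
      IntermediateField.adjoin F (T : Set E) ≤ IntermediateField.adjoin F {ζ}) hyT
    intro z hz
    have hle : m z ≤ c := (Finset.le_sup hz).trans (Nat.le_add_left _ _)
    obtain ⟨i, rfl⟩ := hroot z (by
      obtain ⟨d, hd⟩ := pow_dvd_pow ℓ hle
      rw [hd, pow_mul, hm z hz, one_pow])
    exact pow_mem (IntermediateField.mem_adjoin_simple_self F ζ) i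
  have hcyc := isCyclotomicExtension_adjoin (F := F) hζ
  have hgal := IsCyclotomicExtension.isGalois {ℓ ^ c} F (IntermediateField.adjoin F {ζ})
  have hfd := IntermediateField.adjoin.finiteDimensional (isIntegral_root (F := F) hζ)
  have hprim := isPrimitiveRoot_gen (F := F) hζ
  have := ZMod.isCyclic_units_of_prime_pow ℓ hℓ.out hℓ2 c
  have hGcyc : IsCyclic Gal(IntermediateField.adjoin F {ζ}/F) :=
    isCyclic_of_injective _ (IsPrimitiveRoot.autToPow_injective F hprim)
  obtain ⟨δ, hδ⟩ := hGcyc.exists_generator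
  set y' : IntermediateField.adjoin F {ζ} := ⟨y, hyζ⟩ with hy'
  have hy'0 : y' ≠ 0 := fun h => hy0 (congrArg Subtype.val h)
  have hpow : y' ^ ℓ ^ n = algebraMap F _ a := Subtype.ext ha
  have h1 : (δ y' / y') ^ ℓ ^ c = 1 := by
    rw [hc, pow_add, pow_mul, div_pow, ← map_pow, hpow, AlgEquiv.commutes, ← hpow,
      div_self (pow_ne_zero _ hy'0), one_pow]
  obtain ⟨e, -, he⟩ := hprim.eq_pow_of_pow_eq_one h1
  have hmem : y' ∈ IntermediateField.adjoin F {IntermediateField.AdjoinSimple.gen F ζ} := by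
    refine mem_adjoin_of_fixed fun τ hτ => ?_
    have : τ = AlgEquiv.refl := by
      apply AlgEquiv.coe_toAlgHom_injective
      refine (IntermediateField.adjoin.powerBasis (isIntegral_root (F := F) hζ)).algHom_ext ?_
      rw [IntermediateField.adjoin.powerBasis_gen]
      exact hτ
    rw [this]; rfl
  obtain ⟨f, k, hk⟩ := exists_root_mul_of_mem_adjoin hℓ2 hδ hω hprim hy'0 hmem (e := e)
    (by rw [he, div_mul_cancel₀ _ hy'0])
  refine ⟨ζ ^ f, c, k, ?_, congrArg Subtype.val hk⟩
  rw [← pow_mul, mul_comm, pow_mul, hζ.pow_eq_one, one_pow]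

end RootsOfUnity

section LocalExtension

theorem norm_eq_of_norm_sub_lt {F : Type*} [NormedField F] [IsUltrametricDist F] {x y : F}
    (h : ‖x - y‖ < ‖y‖) : ‖x‖ = ‖y‖ := by
  have := IsUltrametricDist.norm_add_eq_max_of_norm_ne_norm h.ne
  rwa [sub_add_cancel, max_eq_right h.le] at this

/-! ### Extensions of completions -/

variable {K L : Type*} [Field K] [NumberField K] [Field L] [NumberField L] [Algebra K L]
  (v : HeightOneSpectrum (𝓞 K)) (w : HeightOneSpectrum (𝓞 L)) [w.asIdeal.LiesOver v.asIdeal]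

theorem continuous_completionMap : Continuous (completionMap v w) := by
  refine (adicCompletion.continuous_ofCompletion L w).comp
    (Continuous.comp ?_ (adicCompletion.continuous_toCompletion K v))
  exact UniformSpace.Completion.continuous_map

instance completionAlgebra : Algebra (v.adicCompletion K) (w.adicCompletion L) :=
  (completionMap v w).toAlgebra

instance : ContinuousSMul (v.adicCompletion K) (w.adicCompletion L) where
  continuous_smul := by
    have : (fun p : v.adicCompletion K × w.adicCompletion L => p.1 • p.2) =
        fun p => completionMap v w p.1 * p.2 := rfl
    rw [this]
    exact ((continuous_completionMap v w).comp continuous_fst).mul continuous_snd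

instance : IsScalarTower K (v.adicCompletion K) (w.adicCompletion L) :=
  IsScalarTower.of_algebraMap_eq fun x => by
    rw [IsScalarTower.algebraMap_apply K L (w.adicCompletion L)]
    exact (completionMap_algebraMap v w x).symm

instance : FiniteDimensional (v.adicCompletion K) (w.adicCompletion L) :=
  inferInstanceAs (Module.Finite (v.adicCompletion K) (w.adicCompletion L))

/-- The compositum of `K_v` and `L` in `L_w` is dense, as it contains `L`, and closed, as it is
finite-dimensional over the complete field `K_v`. -/
theorem adjoin_range_eq_top :
    IntermediateField.adjoin (v.adicCompletion K)
      (Set.range (algebraMap L (w.adicCompletion L))) = ⊤ := by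
  set S := IntermediateField.adjoin (v.adicCompletion K)
      (Set.range (algebraMap L (w.adicCompletion L)))
  have hclosed : IsClosed (S.toSubalgebra.toSubmodule : Set (w.adicCompletion L)) :=
    Submodule.closed_of_finiteDimensional _
  have hd : Dense (S.toSubalgebra.toSubmodule : Set (w.adicCompletion L)) :=
    (w.denseRange_algebraMap L).mono (IntermediateField.subset_adjoin _ _)
  rw [eq_top_iff]
  intro x _
  have : x ∈ closure (S.toSubalgebra.toSubmodule : Set (w.adicCompletion L)) := hd x
  rwa [hclosed.closure_eq] at this

instance [IsGalois K L] : IsGalois (v.adicCompletion K) (w.adicCompletion L) := by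
  have : Normal (v.adicCompletion K) (w.adicCompletion L) := by
    rw [normal_iff]
    intro x
    refine ⟨Algebra.IsIntegral.isIntegral x, ?_⟩
    refine IntermediateField.splits_of_mem_adjoin (v.adicCompletion K) (w.adicCompletion L)
      (S := Set.range (algebraMap L (w.adicCompletion L))) ?_ (by
        rw [adjoin_range_eq_top]; trivial)
    rintro _ ⟨l, rfl⟩
    refine ⟨Algebra.IsIntegral.isIntegral _, ?_⟩
    have hl : IsIntegral K l := Algebra.IsIntegral.isIntegral l
    have h1 : ((minpoly K l).map (algebraMap K (w.adicCompletion L))).Splits := by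
      rw [IsScalarTower.algebraMap_eq K L (w.adicCompletion L), ← Polynomial.map_map]
      exact (Normal.splits (inferInstanceAs (Normal K L)) l).map _
    have h2 : minpoly (v.adicCompletion K) (algebraMap L (w.adicCompletion L) l) ∣
        (minpoly K l).map (algebraMap K (v.adicCompletion K)) := by
      apply minpoly.dvd
      rw [Polynomial.aeval_map_algebraMap, Polynomial.aeval_algebraMap_apply, minpoly.aeval,
        map_zero]
    refine h1.of_dvd ((Polynomial.map_ne_zero_iff
      (algebraMap K (w.adicCompletion L)).injective).2 (minpoly.ne_zero hl)) ?_
    rw [IsScalarTower.algebraMap_eq K (v.adicCompletion K) (w.adicCompletion L),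
      ← Polynomial.map_map]
    exact Polynomial.map_dvd _ h2
  exact ⟨⟩

/-- Restriction of local automorphisms to the global field. -/
def restrictGal [IsGalois K L] :
    Gal(w.adicCompletion L/v.adicCompletion K) →* Gal(L/K) :=
  (AlgEquiv.restrictNormalHom L).comp (AlgEquiv.restrictScalarsHom K)

theorem restrictGal_commutes [IsGalois K L] (τ : Gal(w.adicCompletion L/v.adicCompletion K))
    (x : L) : algebraMap L (w.adicCompletion L) (restrictGal v w τ x) = τ (algebraMap L _ x) :=
  AlgEquiv.restrictNormal_commutes (τ.restrictScalars K) L x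

theorem restrictGal_injective [IsGalois K L] : Function.Injective (restrictGal v w) := by
  rw [injective_iff_map_eq_one]
  intro τ hτ
  have h : IntermediateField.adjoin (v.adicCompletion K)
      (Set.range (algebraMap L (w.adicCompletion L))) ≤
      IntermediateField.fixedField (Subgroup.zpowers τ) := by
    rw [IntermediateField.adjoin_le_iff]
    rintro _ ⟨l, rfl⟩ ⟨_, k, rfl⟩
    have h1 : τ ∈ MulAction.stabilizer Gal(w.adicCompletion L/v.adicCompletion K)
        (algebraMap L (w.adicCompletion L) l) := by
      change τ _ = _
      rw [← restrictGal_commutes, hτ]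
      rfl
    exact Subgroup.zpow_mem _ h1 k
  rw [adjoin_range_eq_top] at h
  refine AlgEquiv.ext fun x => ?_
  exact h (show x ∈ ⊤ from trivial) ⟨τ, Subgroup.mem_zpowers τ⟩

instance [IsGalois K L] [IsCyclic Gal(L/K)] :
    IsCyclic Gal(w.adicCompletion L/v.adicCompletion K) :=
  isCyclic_of_injective _ (restrictGal_injective v w)

theorem localOrd_completionMap_of_global (k : Kˣ) :
    localOrd w (Units.map (completionMap v w).toMonoidHom
      (Units.map (algebraMap K (v.adicCompletion K)).toMonoidHom k)) =
      (v.asIdeal.ramificationIdx' w.asIdeal : ℤ) * ord v k := by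
  have h1 : Units.map (completionMap v w).toMonoidHom
      (Units.map (algebraMap K (v.adicCompletion K)).toMonoidHom k) =
      Units.map (algebraMap L (w.adicCompletion L)).toMonoidHom
        (Units.map (algebraMap K L).toMonoidHom k) :=
    Units.ext (completionMap_algebraMap v w (k : K))
  rw [h1, localOrd_map]
  simp only [ord]
  rw [show ((Units.map (algebraMap K L).toMonoidHom k : Lˣ) : L) =
    algebraMap K L (k : K) from rfl, ← valuation_liesOver L v w, WithZero.log_pow]
  simp

theorem norm_completionMap_of_global {k : K} (hk : ‖algebraMap K (v.adicCompletion K) k‖ = 1) :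
    ‖completionMap v w (algebraMap K (v.adicCompletion K) k)‖ = 1 := by
  have hk0 : k ≠ 0 := by
    intro h
    rw [h, map_zero, norm_zero] at hk
    exact zero_ne_one hk
  obtain ⟨x, hx⟩ : ∃ x : Kˣ, (x : K) = k := ⟨Units.mk0 k hk0, rfl⟩
  have h3 : localOrd v (Units.map (algebraMap K (v.adicCompletion K)).toMonoidHom x) = 0 := by
    rw [localOrd_eq_zero_iff, Units.coe_map, hx]
    exact hk
  have h4 := localOrd_completionMap_of_global v w x
  rw [← localOrd_map v, h3, mul_zero, localOrd_eq_zero_iff, Units.coe_map, Units.coe_map, hx] at h4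
  exact h4

theorem norm_completionMap_eq_one {u : v.adicCompletion K} (hu : ‖u‖ = 1) :
    ‖completionMap v w u‖ = 1 := by
  have hu0 : u ≠ 0 := norm_ne_zero_iff.1 (by rw [hu]; exact one_ne_zero)
  have hcu0 : 0 < ‖completionMap v w u‖ := norm_pos_iff.2 ((map_ne_zero (completionMap v w)).2 hu0)
  have hopen : IsOpen {y : v.adicCompletion K |
      ‖y - u‖ < 1 ∧ ‖completionMap v w y - completionMap v w u‖ < ‖completionMap v w u‖} :=
    (isOpen_lt (continuous_id.sub continuous_const).norm continuous_const).inter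
      (isOpen_lt ((continuous_completionMap v w).sub continuous_const).norm continuous_const)
  obtain ⟨_, ⟨h1, h2⟩, ⟨k, rfl⟩⟩ := (v.denseRange_algebraMap K).inter_open_nonempty _ hopen
    ⟨u, by rw [sub_self, norm_zero]; exact one_pos, by rw [sub_self, norm_zero]; exact hcu0⟩
  have h3 : ‖algebraMap K (v.adicCompletion K) k‖ = 1 := by
    rw [← hu]
    exact norm_eq_of_norm_sub_lt (hu.symm ▸ h1)
  rw [← norm_eq_of_norm_sub_lt h2]
  exact norm_completionMap_of_global v w h3

theorem localOrd_completionMap_eq_zero {u : (v.adicCompletion K)ˣ} (hu : localOrd v u = 0) :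
    localOrd w (Units.map (completionMap v w).toMonoidHom u) = 0 := by
  rw [localOrd_eq_zero_iff] at hu ⊢
  exact norm_completionMap_eq_one v w hu

/-- A power of a global uniformizer is split off, and the formula for elements of `K` applies to it.
The remaining unit is approximated by global elements of norm `1`. -/
theorem localOrd_completionMap (x : (v.adicCompletion K)ˣ) :
    localOrd w (Units.map (completionMap v w).toMonoidHom x) =
      (v.asIdeal.ramificationIdx' w.asIdeal : ℤ) * localOrd v x := by
  obtain ⟨π, hπ⟩ := exists_localOrd_eq_one v
  set k := π ^ localOrd v x with hk
  have hk1 : localOrd v (Units.map (algebraMap K (v.adicCompletion K)).toMonoidHom k) =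
      localOrd v x := by
    rw [hk, map_zpow, localOrd_zpow, localOrd_map, hπ, mul_one]
  obtain ⟨u, hu⟩ : ∃ u, x = Units.map (algebraMap K (v.adicCompletion K)).toMonoidHom k * u :=
    ⟨_, (mul_inv_cancel_left _ _).symm⟩
  have hu0 : localOrd v u = 0 := by
    have := localOrd_mul v (Units.map (algebraMap K (v.adicCompletion K)).toMonoidHom k) u
    rw [← hu, hk1] at this
    omega
  rw [hu, map_mul, localOrd_mul, localOrd_completionMap_eq_zero v w hu0,
    localOrd_completionMap_of_global, localOrd_mul, hu0, localOrd_map]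
  ring

end LocalExtension

section LocalKummer

/-! ### Locally cyclotomic extensions and Kummer generators -/

variable (ℓ : ℕ) [hℓ : Fact ℓ.Prime]

/-- `x` is, at every finite place `w` of `L`, the product of a root of unity of `ℓ`-power order of
`L_w` and an element of the completion of `K`. -/
def LocallyRootTimesBase (K : Type*) {L : Type*} [Field K] [NumberField K] [Field L]
    [NumberField L] [Algebra K L] (x : L) : Prop :=
  ∀ (v : HeightOneSpectrum (𝓞 K)) (w : HeightOneSpectrum (𝓞 L)) [w.asIdeal.LiesOver v.asIdeal],
    ∃ (z : w.adicCompletion L) (m : ℕ) (k : v.adicCompletion K), z ^ ℓ ^ m = 1 ∧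
      algebraMap L (w.adicCompletion L) x = z * completionMap v w k

variable {ℓ}

theorem exists_liesOver {K E : Type*} [Field K] [NumberField K] [Field E] [NumberField E]
    [Algebra K E] (v : HeightOneSpectrum (𝓞 K)) :
    ∃ w : HeightOneSpectrum (𝓞 E), w.asIdeal.LiesOver v.asIdeal := by
  have := v.isMaximal
  obtain ⟨Q, hQ, h⟩ := Ideal.exists_maximal_ideal_liesOver_of_isIntegral (S := 𝓞 E) v.asIdeal
  exact ⟨⟨Q, hQ.isPrime, Ideal.ne_bot_of_liesOver_of_ne_bot v.ne_bot Q⟩, h⟩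

/-- A primitive `ℓ`-th root of unity with `ℓ > 2` makes all infinite places complex, so the local
extension is trivial. -/
theorem isInCyclotomic_infinite {K E : Type*} [Field K] [NumberField K] [Field E] [Algebra K E]
    (hℓ2 : ℓ ≠ 2) {ω : K} (hω : IsPrimitiveRoot ω ℓ)
    (v : InfinitePlace K) (w : InfinitePlace E) [w.LiesOver v] :
    IsInCyclotomic ℓ v.Completion w.Completion
      (NumberField.LiesOver.completionMap (v := v) (w := w)) := by
  have hv : v.IsComplex := by
    rw [← InfinitePlace.not_isReal_iff_isComplex]
    intro hr
    have h0 := InfinitePlace.IsPrimitiveRoot.nrRealPlaces_eq_zero_of_two_lt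
      (lt_of_le_of_ne hℓ.out.two_le hℓ2.symm) hω
    classical exact (Fintype.card_eq_zero_iff.1 h0).elim ⟨v, hr⟩
  have hunr : w.IsUnramified K := by
    rw [InfinitePlace.isUnramified_iff, InfinitePlace.LiesOver.comap_eq w v]
    exact Or.inr hv
  let _ : Algebra v.Completion w.Completion :=
    (NumberField.LiesOver.completionMap (v := v) (w := w)).toAlgebra
  have h1 : Module.finrank v.Completion w.Completion = 1 := hunr.finrank_eq_one v
  have : FiniteDimensional v.Completion w.Completion := FiniteDimensional.of_finrank_eq_succ h1
  let f : w.Completion →ₐ[v.Completion] AlgebraicClosure v.Completion := IsAlgClosed.lift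
  refine ⟨f.toRingHom, RingHom.ext fun y => f.commutes y, fun y => ?_⟩
  have hbot : (⊥ : Subalgebra v.Completion w.Completion) = ⊤ :=
    Subalgebra.bot_eq_top_of_finrank_eq_one h1
  have hy : y ∈ (⊥ : Subalgebra v.Completion w.Completion) := hbot ▸ Algebra.mem_top
  obtain ⟨k, rfl⟩ := Algebra.mem_bot.1 hy
  have : f.toRingHom (algebraMap v.Completion w.Completion k) = algebraMap _ _ k := f.commutes k
  rw [this]
  exact (cyclotomicExt ℓ v.Completion (AlgebraicClosure v.Completion)).algebraMap_mem k

variable {K E L : Type*} [Field K] [NumberField K] [Field E] [NumberField E] [Field L]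
  [NumberField L] [Algebra K E] [Algebra E L] [Algebra K L] [IsScalarTower K E L]

theorem completionMap_comp (v : HeightOneSpectrum (𝓞 K)) (u : HeightOneSpectrum (𝓞 E))
    (w : HeightOneSpectrum (𝓞 L)) [u.asIdeal.LiesOver v.asIdeal] [w.asIdeal.LiesOver u.asIdeal]
    [w.asIdeal.LiesOver v.asIdeal] (x : v.adicCompletion K) :
    completionMap u w (completionMap v u x) = completionMap v w x := by
  refine congrFun (DenseRange.equalizer (v.denseRange_algebraMap K)
    (g := fun x => completionMap u w (completionMap v u x)) (h := completionMap v w)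
    ((continuous_completionMap u w).comp (continuous_completionMap v u))
    (continuous_completionMap v w) (funext fun k => ?_)) x
  simp only [Function.comp_apply, completionMap_algebraMap]
  rw [IsScalarTower.algebraMap_apply K E L]

/-- `E_u` is generated over `K_v` by `E`, which lies in `K(x)`. Seen inside `L_w` and then in the
algebraic closure, `x` is a root of unity times an element of `K_v`. -/
theorem isInCyclotomic_completionMap (hℓ2 : ℓ ≠ 2) {ω : K} (hω : IsPrimitiveRoot ω ℓ) {x : L}
    (hx : LocallyRootTimesBase ℓ K x)
    (hE : ∀ e : E, algebraMap E L e ∈ IntermediateField.adjoin K {x})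
    (v : HeightOneSpectrum (𝓞 K)) (u : HeightOneSpectrum (𝓞 E)) [u.asIdeal.LiesOver v.asIdeal] :
    IsInCyclotomic ℓ (v.adicCompletion K) (u.adicCompletion E) (completionMap v u) := by
  obtain ⟨w, hw⟩ := exists_liesOver (E := L) u
  have hwv : w.asIdeal.LiesOver v.asIdeal := Ideal.LiesOver.trans w.asIdeal u.asIdeal v.asIdeal
  let Q := AlgebraicClosure (v.adicCompletion K)
  let ι : w.adicCompletion L →ₐ[v.adicCompletion K] Q := IsAlgClosed.lift
  refine ⟨ι.toRingHom.comp (completionMap u w), ?_, ?_⟩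
  · ext y
    change ι (completionMap u w (completionMap v u y)) = _
    rw [completionMap_comp]
    exact ι.commutes y
  have hωv := hω.map_of_injective (algebraMap K (v.adicCompletion K)).injective
  rw [cyclotomicExt_eq_adjoin hℓ2 hωv]
  set C := IntermediateField.adjoin (v.adicCompletion K) {ζ : Q | ∃ n : ℕ, ζ ^ ℓ ^ n = 1} with hC
  let κ : u.adicCompletion E →ₐ[v.adicCompletion K] Q :=
    { ι.toRingHom.comp (completionMap u w) with
      commutes' := fun y => by
        change ι (completionMap u w (completionMap v u y)) = _
        rw [completionMap_comp]
        exact ι.commutes y }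
  let g : L →ₐ[K] Q := (ι.restrictScalars K).comp (Algebra.algHom K L (w.adicCompletion L))
  have hL : IntermediateField.adjoin K {x} ≤ (C.restrictScalars K).comap g := by
    rw [IntermediateField.adjoin_le_iff, Set.singleton_subset_iff]
    obtain ⟨z, m, k, hz, hxz⟩ := hx v w
    change ι (algebraMap L (w.adicCompletion L) x) ∈ C
    rw [hxz, map_mul]
    refine mul_mem (IntermediateField.subset_adjoin _ _ ⟨m, by rw [← map_pow, hz, map_one]⟩) ?_
    have : ι (completionMap v w k) = algebraMap _ Q k := ι.commutes k
    rw [this]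
    exact C.algebraMap_mem k
  have hle : IntermediateField.adjoin (v.adicCompletion K)
      (Set.range (algebraMap E (u.adicCompletion E))) ≤ C.comap κ := by
    rw [IntermediateField.adjoin_le_iff]
    rintro _ ⟨e, rfl⟩
    change ι (completionMap u w (algebraMap E (u.adicCompletion E) e)) ∈ C
    rw [completionMap_algebraMap]
    exact hL (hE e)
  rw [adjoin_range_eq_top] at hle
  intro y
  exact hle (show y ∈ ⊤ from trivial)

section Ω

variable {Ω : Type*} [Field Ω] [Algebra K Ω] [Algebra L Ω] [IsScalarTower K L Ω]

/-- `K(x)`, transported to `Ω`, is itself one of the fields in the supremum. -/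
theorem mem_locallyCyclotomicExt (hℓ2 : ℓ ≠ 2) {ω : K} (hω : IsPrimitiveRoot ω ℓ)
    [IsGalois K L] [IsCyclic Gal(L/K)] (hdeg : ∃ n : ℕ, Module.finrank K L = ℓ ^ n) {x : L}
    (hx : LocallyRootTimesBase ℓ K x) :
    algebraMap L Ω x ∈ locallyCyclotomicExt ℓ K Ω := by
  have : IsAbelianGalois K L := IsAbelianGalois.of_isCyclic K L
  let M : IntermediateField K L := IntermediateField.adjoin K {x}
  let f : L →ₐ[K] Ω := IsScalarTower.toAlgHom K L Ω
  let E : IntermediateField K Ω := M.map f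
  let e : M ≃ₐ[K] E := M.equivMap f
  have hfd : FiniteDimensional K E := e.toLinearEquiv.finiteDimensional
  have hnf : NumberField E := NumberField.of_module_finite K E
  have hrank : Module.finrank K E = Module.finrank K M := e.toLinearEquiv.symm.finrank_eq
  refine (le_sSup (a := E) ?_ : E ≤ locallyCyclotomicExt ℓ K Ω)
    ⟨x, IntermediateField.mem_adjoin_simple_self K x, rfl⟩
  refine ⟨hfd, IsAbelianGalois.of_algHom e.symm.toAlgHom, ?_, hnf, ?_⟩
  · obtain ⟨n, hn⟩ := hdeg
    have h1 : Module.finrank K M ∣ ℓ ^ n := by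
      rw [← hn, ← Module.finrank_mul_finrank K M L]
      exact dvd_mul_right _ _
    obtain ⟨m, -, hm⟩ := (Nat.dvd_prime_pow hℓ.out).1 h1
    exact ⟨m, hrank.trans hm⟩
  · let j : E →ₐ[K] L := M.val.comp e.symm.toAlgHom
    let _ : Algebra E L := j.toRingHom.toAlgebra
    have : IsScalarTower K E L := IsScalarTower.of_algebraMap_eq fun k => (j.commutes k).symm
    exact ⟨fun v w _ => isInCyclotomic_completionMap hℓ2 hω hx (fun e' => (e.symm e').2) v w,
      fun v w _ => isInCyclotomic_infinite hℓ2 hω v w⟩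

/-- Two embeddings of a normal extension have the same image. -/
theorem exists_eq_of_normal {F E Q : Type*} [Field F] [Field E] [Field Q] [Algebra F E]
    [Algebra F Q] [Normal F E] (f g : E →ₐ[F] Q) (x : E) : ∃ y, f y = g x := by
  let e : E ≃ₐ[F] f.fieldRange := AlgEquiv.ofInjectiveField f
  have : Normal F f.fieldRange := Normal.of_algEquiv e
  have h := AlgHom.fieldRange_of_normal (g.comp e.symm.toAlgHom)
  have : g x ∈ f.fieldRange := by
    rw [← h]
    exact ⟨e x, by simp⟩
  exact this

/-- The place `w` gives an embedding of `L` into an algebraic closure `Q` of `K_v`, extended by `j`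
to the algebraic closure of `L` in `Ω`. The preimage `D` of the local cyclotomic extension contains
every locally cyclotomic abelian `E`: the embedding of `E` given by the definition and the one given
by `j` have the same image, because `E` is normal. So `x` falls in the local cyclotomic extension,
where a radical is a root of unity times an element of the base. -/
theorem locallyRootTimesBase_of_mem (hℓ2 : ℓ ≠ 2) {ω : K} (hω : IsPrimitiveRoot ω ℓ) {x : L}
    (hx0 : x ≠ 0) {n : ℕ} {a : K} (ha : x ^ ℓ ^ n = algebraMap K L a)
    (hx : algebraMap L Ω x ∈ locallyCyclotomicExt ℓ K Ω) : LocallyRootTimesBase ℓ K x := by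
  intro v w _
  let Q := AlgebraicClosure (v.adicCompletion K)
  let ι : w.adicCompletion L →ₐ[v.adicCompletion K] Q := IsAlgClosed.lift
  have hωv := hω.map_of_injective (algebraMap K (v.adicCompletion K)).injective
  let g : L →+* Q := ι.toRingHom.comp (algebraMap L (w.adicCompletion L))
  let _ : Algebra L Q := g.toAlgebra
  let A := algebraicClosure L Ω
  let j : A →ₐ[L] Q := IsAlgClosed.lift
  let C := cyclotomicExt ℓ (v.adicCompletion K) Q
  let D : Subfield Ω := Subfield.map A.val.toRingHom (Subfield.comap j.toRingHom C.toSubfield)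
  have hgK : ∀ k : K, g (algebraMap K L k) = algebraMap (v.adicCompletion K) Q (algebraMap K _ k) := by
    intro k
    change ι (algebraMap L (w.adicCompletion L) (algebraMap K L k)) = _
    rw [← completionMap_algebraMap v w]
    exact ι.commutes _
  have hjK : ∀ (k : K) (h : algebraMap K Ω k ∈ A), j ⟨algebraMap K Ω k, h⟩ =
      algebraMap (v.adicCompletion K) Q (algebraMap K _ k) := by
    intro k h
    have : (⟨algebraMap K Ω k, h⟩ : A) = algebraMap L A (algebraMap K L k) :=
      Subtype.ext (IsScalarTower.algebraMap_apply K L Ω k)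
    rw [this, j.commutes]
    exact hgK k
  have hKA : ∀ k : K, algebraMap K Ω k ∈ A := fun k => by
    rw [IsScalarTower.algebraMap_apply K L Ω]
    exact A.algebraMap_mem _
  have hKD : ∀ k : K, algebraMap K Ω k ∈ D := fun k =>
    ⟨⟨algebraMap K Ω k, hKA k⟩, by
      change j _ ∈ C
      rw [hjK]
      exact C.algebraMap_mem _, rfl⟩
  have hle : locallyCyclotomicExt ℓ K Ω ≤ D.toIntermediateField hKD := by
    refine sSup_le ?_
    rintro E ⟨hfd, hab, -, hnf, hlc⟩ e he
    have heA : ∀ e : E, (e : Ω) ∈ A := fun e => by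
      have h1 : IsAlgebraic K (e : Ω) :=
        (Algebra.IsAlgebraic.isAlgebraic (R := K) e).algebraMap (A := Ω)
      exact mem_algebraicClosure_iff.2 (h1.tower_top L)
    obtain ⟨u, hu⟩ := exists_liesOver (E := E) v
    obtain ⟨φ, hφ, hφC⟩ := hlc.1 v u
    let _ : Algebra K Q := ((algebraMap (v.adicCompletion K) Q).comp (algebraMap K _)).toAlgebra
    let f₁ : E →ₐ[K] Q :=
      { φ.comp (algebraMap E (u.adicCompletion E)) with
        commutes' := fun k => by
          change φ (algebraMap E (u.adicCompletion E) (algebraMap K E k)) = _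
          rw [← completionMap_algebraMap v u]
          exact RingHom.congr_fun hφ _ }
    let incl : E →+* A := RingHom.codRestrict E.val.toRingHom A heA
    let f₂ : E →ₐ[K] Q :=
      { j.toRingHom.comp incl with
        commutes' := fun k => hjK k (hKA k) }
    obtain ⟨y, hy⟩ := exists_eq_of_normal f₁ f₂ ⟨e, he⟩
    refine ⟨⟨e, heA ⟨e, he⟩⟩, ?_, rfl⟩
    change f₂ ⟨e, he⟩ ∈ C
    rw [← hy]
    exact hφC _
  obtain ⟨y, hyC, hyx⟩ := hle hx
  have hy : y = algebraMap L A x := Subtype.ext hyx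
  have hgx : g x ∈ C := by
    have : j y ∈ C := hyC
    rwa [hy, j.commutes] at this
  have hgx0 : g x ≠ 0 := (map_ne_zero g).2 hx0
  obtain ⟨z, m, k, hz, hk⟩ := exists_root_mul_of_mem_cyclotomic hℓ2 hωv hgx0
    (cyclotomicExt_eq_adjoin (E := Q) hℓ2 hωv ▸ hgx) (n := n) (a := algebraMap K _ a) (by
      rw [← map_pow, ha, hgK])
  have hk0 : k ≠ 0 := by
    rintro rfl
    rw [map_zero, mul_zero] at hk
    exact hgx0 hk
  have hkw : completionMap v w k ≠ 0 := (map_ne_zero _).2 hk0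
  refine ⟨algebraMap L _ x / completionMap v w k, m, k, ι.toRingHom.injective ?_,
    (div_mul_cancel₀ _ hkw).symm⟩
  have h1 : ι (algebraMap L _ x / completionMap v w k) = z := by
    rw [map_div₀, show ι (completionMap v w k) = algebraMap _ Q k from ι.commutes k]
    exact (div_eq_iff ((map_ne_zero _).2 hk0)).2 hk
  change ι (_ ^ _) = ι 1
  rw [map_pow, h1, hz, map_one]

end Ω

end LocalKummer

section Global

/-! ### Global elements: divisors, descent and the Leopoldt conjecture -/

variable {ℓ : ℕ} [hℓ : Fact ℓ.Prime]

/-- The `ℤ_ℓ`-linear extension of an integer-valued homomorphism. -/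
def LTensor.lift {A : Type*} [CommGroup A] (f : A →* Multiplicative ℤ) :
    LTensor ℓ A →ₗ[ℤ_[ℓ]] ℤ_[ℓ] :=
  LinearMap.liftBaseChange ℤ_[ℓ]
    ((Int.castAddHom ℤ_[ℓ]).comp (MonoidHom.toAdditiveLeft f)).toIntLinearMap

theorem LTensor.lift_ι {A : Type*} [CommGroup A] (f : A →* Multiplicative ℤ) (a : A) :
    LTensor.lift f (LTensor.ι ℓ a) = (Multiplicative.toAdd (f a) : ℤ) := by
  rw [LTensor.lift, LTensor.ι, LinearMap.liftBaseChange_tmul, one_smul]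
  rfl

theorem LTensor.hom_ext {A M : Type*} [CommGroup A] [AddCommGroup M] [Module ℤ_[ℓ] M]
    {f g : LTensor ℓ A →ₗ[ℤ_[ℓ]] M} (h : ∀ a, f (LTensor.ι ℓ a) = g (LTensor.ι ℓ a)) : f = g := by
  refine LinearMap.ext fun x => ?_
  induction x using TensorProduct.induction_on with
  | zero => simp
  | add x y hx hy => rw [map_add, map_add, hx, hy]
  | tmul c a => rw [LTensor.tmul_eq, map_smul, map_smul, h]

variable {K L : Type*} [Field K] [NumberField K] [Field L] [NumberField L] [Algebra K L]

theorem localOrdHom_apply (v : HeightOneSpectrum (𝓞 K)) (x : (v.adicCompletion K)ˣ) :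
    localOrdHom v x = Multiplicative.ofAdd (localOrd v x) := rfl

/-- The normalized exponent at `v` on `ℤ_ℓ ⊗ Kˣ`. -/
def ordT (ℓ : ℕ) [Fact ℓ.Prime] (v : HeightOneSpectrum (𝓞 K)) : LTensor ℓ Kˣ →ₗ[ℤ_[ℓ]] ℤ_[ℓ] :=
  (LTensor.lift (localOrdHom v)).comp
    (LTensor.map ℓ (Units.map (algebraMap K (v.adicCompletion K)).toMonoidHom))

theorem ordT_ι (v : HeightOneSpectrum (𝓞 K)) (x : Kˣ) :
    ordT ℓ v (LTensor.ι ℓ x) = (ord v x : ℤ) := by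
  rw [ordT, LinearMap.comp_apply, LTensor.map_ι, LTensor.lift_ι, localOrdHom_apply, toAdd_ofAdd,
    localOrd_map]

theorem principalDivisor_ι (x : Kˣ) (v : TamePlace ℓ K) :
    principalDivisor ℓ K (LTensor.ι ℓ x) v = (ord v.1 x : ℤ) := by
  rw [principalDivisor, LTensor.ι, LinearMap.liftBaseChange_tmul, one_smul]
  rfl

theorem principalDivisor_apply (x : LTensor ℓ Kˣ) (v : TamePlace ℓ K) :
    principalDivisor ℓ K x v = ordT ℓ v.1 x := by
  have : (Finsupp.lapply v).comp (principalDivisor ℓ K) = ordT ℓ v.1 :=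
    LTensor.hom_ext fun a => by
      rw [ordT_ι, LinearMap.comp_apply, Finsupp.lapply_apply, principalDivisor_ι]
  exact LinearMap.congr_fun this x

theorem mem_pseudoInfinitesimal_iff (x : LTensor ℓ Kˣ) :
    x ∈ pseudoInfinitesimal ℓ K ↔
      ∀ v : WildPlace ℓ K, ∃ c : ℤ_[ℓ], c ≠ 0 ∧ c • localization ℓ v.1 x = 0 := by
  rw [pseudoInfinitesimal, Submodule.mem_iInf]
  refine forall_congr' fun v => ⟨fun h => ?_, fun ⟨c, hc, h⟩ => mem_localMu_of_smul_eq_zero hc h⟩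
  obtain ⟨n, hn⟩ := exists_smul_eq_zero_of_mem_localMu h
  exact ⟨_, pow_ne_zero n (by exact_mod_cast hℓ.out.ne_zero), hn⟩

/-- The map `ℤ_ℓ ⊗ Kˣ → ℤ_ℓ ⊗ Lˣ`. -/
abbrev extendT (ℓ : ℕ) [Fact ℓ.Prime] (K L : Type*) [Field K] [Field L] [Algebra K L] :
    LTensor ℓ Kˣ →ₗ[ℤ_[ℓ]] LTensor ℓ Lˣ :=
  LTensor.map ℓ (Units.map (algebraMap K L).toMonoidHom)

theorem localization_extendT (v : HeightOneSpectrum (𝓞 K)) (w : HeightOneSpectrum (𝓞 L))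
    [w.asIdeal.LiesOver v.asIdeal] (x : LTensor ℓ Kˣ) :
    localization ℓ w (extendT ℓ K L x) =
      AdicCompletion.map (Ideal.span {(ℓ : ℤ_[ℓ])})
        (LTensor.map ℓ (Units.map (completionMap v w).toMonoidHom)) (localization ℓ v x) := by
  simp only [localization, LinearMap.comp_apply, LCompletion.map_of, map_comp_apply]
  congr 2
  refine congrArg _ (MonoidHom.ext fun y => Units.ext ?_)
  exact (completionMap_algebraMap v w (y : K)).symm

/-- The local norm composed with `K_v → L_w` is the power by the local degree `d`. An integer
killing the localization at `w` therefore kills the one at `v` after multiplication by `d`. -/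
theorem mem_of_extendT_mem {x : LTensor ℓ Kˣ}
    (hx : extendT ℓ K L x ∈ pseudoInfinitesimal ℓ L) : x ∈ pseudoInfinitesimal ℓ K := by
  rw [mem_pseudoInfinitesimal_iff] at hx ⊢
  intro v
  obtain ⟨w, hw⟩ := exists_liesOver (E := L) v.1
  have hwℓ : (ℓ : 𝓞 L) ∈ w.asIdeal := by
    have h := v.2
    rw [hw.over, Ideal.under_def, Ideal.mem_comap, map_natCast] at h
    exact h
  obtain ⟨c, hc, h⟩ := hx ⟨w, hwℓ⟩
  set d := Module.finrank (v.1.adicCompletion K) (w.adicCompletion L) with hd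
  have hd0 : d ≠ 0 := Module.finrank_pos.ne'
  refine ⟨c * d, mul_ne_zero hc (by exact_mod_cast hd0), ?_⟩
  let N : (w.adicCompletion L)ˣ →* (v.1.adicCompletion K)ˣ :=
    Units.map (Algebra.norm (v.1.adicCompletion K))
  have hN : N.comp (Units.map (completionMap v.1 w).toMonoidHom) = powMonoidHom d :=
    MonoidHom.ext fun y => Units.ext (Algebra.norm_algebraMap (S := w.adicCompletion L)
      (y : v.1.adicCompletion K))
  rw [localization_extendT v.1 w] at h
  have h2 := congrArg (AdicCompletion.map (Ideal.span {(ℓ : ℤ_[ℓ])}) (LTensor.map ℓ N)) h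
  rw [localization, LinearMap.comp_apply, LCompletion.map_of, ← map_smul, LCompletion.map_of,
    map_smul, map_comp_apply, hN, LTensor.map_powMonoidHom, map_zero, smul_smul] at h2
  rw [localization, LinearMap.comp_apply, ← map_smul]
  exact h2

theorem eq_zero_of_forall_pow_dvd {c : ℤ_[ℓ]} (h : ∀ n, (ℓ : ℤ_[ℓ]) ^ n ∣ c) : c = 0 := by
  by_contra hc
  have h1 := h (c.valuation + 1)
  rw [← Ideal.mem_span_singleton, PadicInt.mem_span_pow_iff_le_valuation c hc] at h1
  omega

/-- An element trivial in the compactification is infinitely `ℓ`-divisible, hence so is its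
exponent, and `ℤ_ℓ` has no nonzero such element. -/
theorem ordT_eq_zero (v : HeightOneSpectrum (𝓞 K)) {x : LTensor ℓ Kˣ} {c : ℤ_[ℓ]} (hc : c ≠ 0)
    (h : c • localization ℓ v x = 0) : ordT ℓ v x = 0 := by
  rw [localization, LinearMap.comp_apply, ← map_smul, LCompletion.of_eq_zero_iff] at h
  have h1 : c * ordT ℓ v x = 0 := by
    refine eq_zero_of_forall_pow_dvd fun n => ?_
    obtain ⟨y, hy⟩ := h n
    refine ⟨LTensor.lift (localOrdHom v) y, ?_⟩
    rw [← smul_eq_mul, ordT, LinearMap.comp_apply, ← map_smul, hy, map_smul, smul_eq_mul]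
  exact (mul_eq_zero.1 h1).resolve_left hc

/-- The divisor of an element of `Kˣ`. -/
def ordAll (K : Type*) [Field K] [NumberField K] :
    Kˣ →* Multiplicative (HeightOneSpectrum (𝓞 K) →₀ ℤ) :=
  MonoidHom.mk' (fun x => Multiplicative.ofAdd (Finsupp.ofSupportFinite (fun v => ord v x)
    (finite_ord x))) fun x y => by
      rw [← ofAdd_add]
      congr 1
      ext v
      exact ord_mul v x y

theorem exists_unit_of_ord_eq_zero {x : Kˣ} (h : ∀ v : HeightOneSpectrum (𝓞 K), ord v x = 0) :
    ∃ u : (𝓞 K)ˣ, Units.map (algebraMap (𝓞 K) K).toMonoidHom u = x := by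
  have hv : ∀ (y : Kˣ), (∀ v : HeightOneSpectrum (𝓞 K), ord v y = 0) →
      ∃ a : 𝓞 K, algebraMap (𝓞 K) K a = y := by
    intro y hy
    refine HeightOneSpectrum.mem_integers_of_valuation_le_one K (y : K) fun v => ?_
    have h1 := hy v
    rw [ord, neg_eq_zero] at h1
    rw [← WithZero.exp_log (x := v.valuation K (y : K)) (by simp), h1, WithZero.exp_zero]
  obtain ⟨a, ha⟩ := hv x h
  obtain ⟨b, hb⟩ := hv x⁻¹ fun v => by
    have := ord_mul v x x⁻¹
    rw [mul_inv_cancel, h v] at this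
    simpa [ord] using this.symm
  have hab : a * b = 1 := by
    apply FaithfulSMul.algebraMap_injective (𝓞 K) K
    rw [map_mul, ha, hb, map_one, Units.mul_inv]
  exact ⟨⟨a, b, hab, by rw [mul_comm, hab]⟩, Units.ext ha⟩

/-- Tensoring commutes with direct sums, so vanishing can be tested one place at a time. -/
theorem map_ordAll_eq_zero {x : LTensor ℓ Kˣ} (h : ∀ v, ordT ℓ v x = 0) :
    LTensor.map ℓ (ordAll K) x = 0 := by
  classical
  let e := TensorProduct.finsuppRight ℤ ℤ ℤ_[ℓ] ℤ (HeightOneSpectrum (𝓞 K))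
  let f : Additive Kˣ →+ (HeightOneSpectrum (𝓞 K) →₀ ℤ) := MonoidHom.toAdditiveLeft (ordAll K)
  let φ : LTensor ℓ Kˣ →ₗ[ℤ] ℤ_[ℓ] ⊗[ℤ] (HeightOneSpectrum (𝓞 K) →₀ ℤ) :=
    LinearMap.lTensor ℤ_[ℓ] f.toIntLinearMap
  have key : ∀ (v : HeightOneSpectrum (𝓞 K)) (y : LTensor ℓ Kˣ),
      TensorProduct.rid ℤ ℤ_[ℓ] (e (φ y) v) = ordT ℓ v y := by
    intro v y
    induction y using TensorProduct.induction_on with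
    | zero => simp only [map_zero, Finsupp.zero_apply]
    | add x y hx hy => rw [map_add, map_add, Finsupp.add_apply, map_add, map_add, hx, hy]
    | tmul c a =>
      have h1 : φ (c ⊗ₜ[ℤ] a) = c ⊗ₜ[ℤ] f a := rfl
      rw [h1, TensorProduct.finsuppRight_apply_tmul_apply,
        TensorProduct.rid_tmul, LTensor.tmul_eq, map_smul, ordT_ι, zsmul_eq_mul, smul_eq_mul,
        mul_comm]
      rfl
  have h0 : φ x = 0 := by
    apply e.injective
    rw [map_zero]
    ext v
    apply (TensorProduct.rid ℤ ℤ_[ℓ]).injective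
    rw [key, h, Finsupp.zero_apply, map_zero]
  exact h0

/-- Under the Leopoldt conjecture, the pseudo-infinitesimal elements with trivial divisor are the
roots of unity. -/
theorem exists_root_of_principalDivisor_eq_zero (hLeo : Leopoldt ℓ K) {x : LTensor ℓ Kˣ}
    (hx : x ∈ pseudoInfinitesimal ℓ K) (hdiv : principalDivisor ℓ K x = 0) :
    ∃ (η : Kˣ) (N : ℕ), η ^ ℓ ^ N = 1 ∧ x = LTensor.ι ℓ η := by
  rw [mem_pseudoInfinitesimal_iff] at hx
  have hord : ∀ v, ordT ℓ v x = 0 := by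
    intro v
    by_cases hv : (ℓ : 𝓞 K) ∈ v.asIdeal
    · obtain ⟨c, hc, h⟩ := hx ⟨v, hv⟩
      exact ordT_eq_zero v hc h
    · have := DFunLike.congr_fun hdiv (⟨v, hv⟩ : TamePlace ℓ K)
      rwa [principalDivisor_apply] at this
  -- All exponents vanish, so by flatness `x` comes from `ℤ_ℓ ⊗ E_K`.
  obtain ⟨z, rfl⟩ := LTensor.exists_map_eq
    (f := Units.map (algebraMap (𝓞 K) K).toMonoidHom) (g := ordAll K) (fun b hb => by
      refine exists_unit_of_ord_eq_zero fun v => ?_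
      exact DFunLike.congr_fun (congrArg Multiplicative.toAdd hb) v) (fun u => by
      apply Multiplicative.toAdd.injective
      ext v
      change ord v _ = 0
      rw [ord, neg_eq_zero]
      have : v.valuation K (algebraMap (𝓞 K) K (u : 𝓞 K)) = 1 := by
        refine le_antisymm (v.valuation_le_one _) ?_
        have h1 := v.valuation_le_one (K := K) ((u⁻¹ : (𝓞 K)ˣ) : 𝓞 K)
        have h2 : v.valuation K (algebraMap (𝓞 K) K (u : 𝓞 K)) *
            v.valuation K (algebraMap (𝓞 K) K ((u⁻¹ : (𝓞 K)ˣ) : 𝓞 K)) = 1 := by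
          rw [← map_mul, ← map_mul, Units.mul_inv, map_one, map_one]
        calc (1 : WithZero (Multiplicative ℤ)) = _ := h2.symm
          _ ≤ _ := mul_le_of_le_one_right' h1
      exact (congrArg WithZero.log this).trans WithZero.log_one) (map_ordAll_eq_zero hord)
  choose c hc hz using hx
  have := Fintype.ofFinite (WildPlace ℓ K)
  -- A common multiple clears the torsion at all wild places together. Leopoldt injectivity then
  -- makes `z` itself torsion, that is, a root of unity.
  set C := ∏ v, c v with hC
  have hC0 : C ≠ 0 := Finset.prod_ne_zero_iff.2 fun v _ => hc v
  have hCz : C • z = 0 := by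
    apply hLeo
    rw [map_zero, map_smul]
    funext v
    obtain ⟨d, hd⟩ := Finset.dvd_prod_of_mem c (Finset.mem_univ v)
    rw [Pi.smul_apply, LinearMap.pi_apply, LinearMap.comp_apply, hC, hd, mul_comm, mul_smul, hz v,
      smul_zero, Pi.zero_apply]
  have hCz' : (ℓ : ℤ_[ℓ]) ^ C.valuation • z = 0 := by
    rw [PadicInt.unitCoeff_spec hC0, mul_smul] at hCz
    have := congrArg (fun z => (↑(PadicInt.unitCoeff hC0)⁻¹ : ℤ_[ℓ]) • z) hCz
    simpa [smul_smul] using this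
  obtain ⟨u, hu, rfl⟩ := LTensor.exists_ι_of_torsion hCz'
  exact ⟨Units.map (algebraMap (𝓞 K) K).toMonoidHom u, _, by rw [← map_pow, hu, map_one], rfl⟩

end Global

section Tower

/-! ### Extension of divisors in towers -/

theorem under_under {K L M : Type*} [Field K] [Field L] [Field M] [Algebra K L] [Algebra L M]
    [Algebra K M] [IsScalarTower K L M] (w : HeightOneSpectrum (𝓞 M)) :
    HeightOneSpectrum.under (𝓞 K) (HeightOneSpectrum.under (𝓞 L) w) =
      HeightOneSpectrum.under (𝓞 K) w := by
  refine HeightOneSpectrum.ext (Ideal.ext fun x => ?_)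
  change algebraMap (𝓞 L) (𝓞 M) (algebraMap (𝓞 K) (𝓞 L) x) ∈ w.asIdeal ↔
    algebraMap (𝓞 K) (𝓞 M) x ∈ w.asIdeal
  have : algebraMap (𝓞 L) (𝓞 M) (algebraMap (𝓞 K) (𝓞 L) x) = algebraMap (𝓞 K) (𝓞 M) x :=
    RingOfIntegers.ext (IsScalarTower.algebraMap_apply K L M (x : K)).symm
  rw [this]

variable {ℓ : ℕ} [hℓ : Fact ℓ.Prime] {K L M : Type*} [Field K] [NumberField K] [Field L]
  [NumberField L] [Field M] [NumberField M] [Algebra K L] [Algebra L M] [Algebra K M]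
  [IsScalarTower K L M]

theorem ord_map (w : HeightOneSpectrum (𝓞 L)) (x : Kˣ) :
    ord w (Units.map (algebraMap K L).toMonoidHom x) =
      (ramIdx K w : ℤ) * ord (HeightOneSpectrum.under (𝓞 K) w) x := by
  have : w.asIdeal.LiesOver (HeightOneSpectrum.under (𝓞 K) w).asIdeal := ⟨rfl⟩
  simp only [ord, ramIdx]
  rw [show ((Units.map (algebraMap K L).toMonoidHom x : Lˣ) : L) =
    algebraMap K L (x : K) from rfl, ← valuation_liesOver L (HeightOneSpectrum.under (𝓞 K) w) w,
    WithZero.log_pow]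
  simp

/-- Both sides are read off from the exponent at `w` of a uniformizer of `K`. -/
theorem ramIdx_mul (w : HeightOneSpectrum (𝓞 M)) :
    ramIdx K w = ramIdx L w * ramIdx K (HeightOneSpectrum.under (𝓞 L) w) := by
  obtain ⟨x, hx⟩ := exists_localOrd_eq_one (HeightOneSpectrum.under (𝓞 K) w)
  have h1 := ord_map (K := K) w x
  have h2 := ord_map (K := L) w (Units.map (algebraMap K L).toMonoidHom x)
  rw [ord_map (K := K), under_under, hx, mul_one] at h2
  have h3 : Units.map (algebraMap L M).toMonoidHom (Units.map (algebraMap K L).toMonoidHom x) =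
      Units.map (algebraMap K M).toMonoidHom x :=
    Units.ext (IsScalarTower.algebraMap_apply K L M (x : K)).symm
  rw [h3, h1, hx, mul_one] at h2
  exact_mod_cast h2

theorem extendDivisor_apply (a : TameDivisor ℓ K) (w : TamePlace ℓ L) :
    extendDivisor ℓ K L a w = (ramIdx K w.1 : ℤ_[ℓ]) * a (TamePlace.under ℓ K w) := rfl

theorem extendDivisor_extendDivisor (a : TameDivisor ℓ K) :
    extendDivisor ℓ L M (extendDivisor ℓ K L a) = extendDivisor ℓ K M a := by
  ext w
  rw [extendDivisor_apply, extendDivisor_apply, extendDivisor_apply, ramIdx_mul (K := K) (L := L) w.1]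
  have : TamePlace.under ℓ K (TamePlace.under ℓ L w) = TamePlace.under ℓ K w :=
    Subtype.ext (under_under w.1)
  rw [this, Nat.cast_mul, ← mul_assoc]
  rfl

theorem extendDivisor_injective : Function.Injective (extendDivisor ℓ K L) := by
  rw [← LinearMap.ker_eq_bot, LinearMap.ker_eq_bot']
  intro a ha
  ext v
  obtain ⟨w, hw⟩ := exists_liesOver (E := L) v.1
  have hwv : HeightOneSpectrum.under (𝓞 K) w = v.1 := HeightOneSpectrum.ext hw.over.symm
  have hwℓ : (ℓ : 𝓞 L) ∉ w.asIdeal := fun h => v.2 (by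
    rw [hw.over, Ideal.under_def, Ideal.mem_comap, map_natCast]
    exact h)
  have h1 := DFunLike.congr_fun ha (⟨w, hwℓ⟩ : TamePlace ℓ L)
  rw [extendDivisor_apply, Finsupp.zero_apply] at h1
  have h2 : TamePlace.under ℓ K (⟨w, hwℓ⟩ : TamePlace ℓ L) = v := Subtype.ext hwv
  rw [h2] at h1
  refine (mul_eq_zero.1 h1).resolve_left ?_
  have h3 : ramIdx K w ≠ 0 := by
    have : w.asIdeal.LiesOver (HeightOneSpectrum.under (𝓞 K) w).asIdeal := ⟨rfl⟩
    exact Ideal.IsDedekindDomain.ramificationIdx'_ne_zero_of_liesOver w.asIdeal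
      (HeightOneSpectrum.under (𝓞 K) w).ne_bot
  exact_mod_cast h3

end Tower

section Galois

/-! ### Galois action on `ℤ_ℓ ⊗ Lˣ` -/

variable {ℓ : ℕ} [hℓ : Fact ℓ.Prime] {K L : Type*} [Field K] [Field L] [Algebra K L]

/-- The action of an automorphism on `ℤ_ℓ ⊗ Lˣ`. -/
abbrev galT (ℓ : ℕ) [Fact ℓ.Prime] {K L : Type*} [Field K] [Field L] [Algebra K L]
    (σ : Gal(L/K)) : LTensor ℓ Lˣ →ₗ[ℤ_[ℓ]] LTensor ℓ Lˣ :=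
  LTensor.map ℓ (Units.map (σ : L →+* L).toMonoidHom)

theorem galT_extendT (σ : Gal(L/K)) (r : LTensor ℓ Kˣ) :
    galT ℓ σ (extendT ℓ K L r) = extendT ℓ K L r := by
  rw [map_comp_apply]
  congr 1
  exact congrArg _ (MonoidHom.ext fun a => Units.ext (σ.commutes (a : K)))

variable [NumberField L]

/-- `σ` is regarded as a structure of extension of `L` over itself, so functoriality in extensions
applies. The same device serves for divisors. -/
theorem galT_mem (σ : Gal(L/K)) {x : LTensor ℓ Lˣ} (hx : x ∈ pseudoInfinitesimal ℓ L) :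
    galT ℓ σ x ∈ pseudoInfinitesimal ℓ L :=
  @map_mem_pseudoInfinitesimal ℓ _ L L _ _ _ _ (σ : L →+* L).toAlgebra x hx

variable [NumberField K]

theorem principalDivisor_galT (σ : Gal(L/K)) {x : LTensor ℓ Lˣ} {a : TameDivisor ℓ K}
    (hx : principalDivisor ℓ L x = extendDivisor ℓ K L a) :
    principalDivisor ℓ L (galT ℓ σ x) = extendDivisor ℓ K L a := by
  let alg : Algebra L L := (σ : L →+* L).toAlgebra
  have h1 := @extendDivisor_principalDivisor ℓ _ L L _ _ _ _ alg x
  have ht : @IsScalarTower K L L _ alg.toSMul _ :=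
    @IsScalarTower.of_algebraMap_eq K L L _ _ _ _ alg _ fun k => (σ.commutes k).symm
  have h2 := @extendDivisor_extendDivisor ℓ _ K L L _ _ _ _ _ _ _ alg _ ht a
  rw [hx] at h1
  exact h1.symm.trans h2

/-- Flatness applied to `Kˣ → Lˣ → Lˣ`, with second map `b ↦ σ b / b`. -/
theorem exists_extendT_eq [IsGalois K L] {σ : Gal(L/K)} (hσ : ∀ τ, τ ∈ Subgroup.zpowers σ)
    {x : LTensor ℓ Lˣ} (hx : galT ℓ σ x = x) : ∃ r, extendT ℓ K L r = x := by
  let g : Lˣ →* Lˣ := Units.map (σ : L →+* L).toMonoidHom / MonoidHom.id Lˣ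
  have hg : LTensor.map ℓ g = galT ℓ σ - LinearMap.id := LTensor.hom_ext fun a => by
    rw [LTensor.map_ι, LinearMap.sub_apply, LTensor.map_ι, LinearMap.id_apply, ← LTensor.ι_div]
    rfl
  refine LTensor.exists_map_eq (g := g) (fun b hb => ?_) (fun a => ?_) (x := x) (by
    rw [hg, LinearMap.sub_apply, hx, LinearMap.id_apply, sub_self])
  · have h1 : σ (b : L) = b := by
      have := div_eq_one.1 (show Units.map (σ : L →+* L).toMonoidHom b / b = 1 from hb)
      exact congrArg Units.val this
    have hall : ∀ τ : Gal(L/K), τ (b : L) = b := by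
      intro τ
      obtain ⟨k, rfl⟩ := hσ τ
      have h4 : σ ∈ MulAction.stabilizer Gal(L/K) (b : L) := h1
      exact Subgroup.zpow_mem _ h4 k
    obtain ⟨k, hk⟩ := (IsGalois.mem_range_algebraMap_iff_fixed _).2 hall
    have hk0 : k ≠ 0 := by
      rintro rfl
      rw [map_zero] at hk
      exact b.ne_zero hk.symm
    exact ⟨Units.mk0 k hk0, Units.ext hk⟩
  · exact div_eq_one.2 (Units.ext (σ.commutes (a : K)))

end Galois

section Local

/-! ### Radicals over local fields -/

variable {ℓ : ℕ} [hℓ : Fact ℓ.Prime] {F E : Type*} [Field F] [Field E] [Algebra F E]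

/-- A Kummer generator whose quotients by the automorphisms fixing all roots of unity are, up to
exponents prime to `ℓ`, highly divisible, is the product of a root of unity and an element of the
base field. -/
theorem exists_root_mul_of_quotient_pow (hℓ2 : ℓ ≠ 2) [FiniteDimensional F E] [IsGalois F E]
    [IsCyclic Gal(E/F)] [Finite (CommGroup.primaryComponent Eˣ ℓ)] {ω : F}
    (hω : IsPrimitiveRoot ω ℓ) {x : Eˣ} {n : ℕ} {a : F} (hx : (x : E) ^ ℓ ^ n = algebraMap F E a)
    (h : ∀ (b : ℕ) (τ : Gal(E/F)), (∀ (z : Eˣ) (s : ℕ), z ^ ℓ ^ s = 1 →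
      Units.map (τ : E →+* E).toMonoidHom z = z) → ∃ m : ℕ, m.Coprime ℓ ∧
      ∃ φ : Eˣ, (Units.map (τ : E →+* E).toMonoidHom x / x) ^ m = φ ^ ℓ ^ b) :
    ∃ (z : E) (m : ℕ) (k : F), z ^ ℓ ^ m = 1 ∧ (x : E) = z * algebraMap F E k := by
  obtain ⟨ζ, b, hζ, -, hgen⟩ := exists_primary_generator (ℓ := ℓ) E
  have hroot : ∀ τ : Gal(E/F), (Units.map (τ : E →+* E).toMonoidHom x / x) ^ ℓ ^ n = 1 := by
    intro τ
    rw [div_pow, ← map_pow, div_eq_one]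
    apply Units.ext
    change τ ((x ^ ℓ ^ n : Eˣ) : E) = ((x ^ ℓ ^ n : Eˣ) : E)
    rw [Units.val_pow_eq_pow_val, hx, τ.commutes]
  have hkill : ∀ (φ : Eˣ) (s : ℕ), φ ^ ℓ ^ s = 1 → φ ^ ℓ ^ b = 1 := by
    intro φ s hφ
    obtain ⟨i, -, hi⟩ := hgen (φ : E) ⟨s, by rw [← Units.val_pow_eq_pow_val, hφ, Units.val_one]⟩
    apply Units.ext
    rw [Units.val_pow_eq_pow_val, hi, ← pow_mul, mul_comm, pow_mul, hζ.pow_eq_one, one_pow,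
      Units.val_one]
  -- If `τ` fixes `ζ`, it fixes all `ℓ`-power roots of unity of `E`. Then `τ x / x` has `ℓ`-power
  -- order, and a prime-to-`ℓ` power of it is `φ^(ℓ^b)`. Here `φ` is itself a root of unity of
  -- `ℓ`-power order, so `φ^(ℓ^b) = 1` and `τ x = x`.
  have hmem : (x : E) ∈ IntermediateField.adjoin F {ζ} := by
    refine mem_adjoin_of_fixed fun τ hτ => ?_
    obtain ⟨m, hm, φ, hφ⟩ := h b τ (by
      intro z s hz
      obtain ⟨i, -, hi⟩ := hgen (z : E) ⟨s, by rw [← Units.val_pow_eq_pow_val, hz, Units.val_one]⟩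
      apply Units.ext
      change τ (z : E) = z
      rw [hi, map_pow, hτ])
    have h1 : φ ^ ℓ ^ b = 1 := hkill φ (b + n) (by
      rw [pow_add, pow_mul, ← hφ, ← pow_mul, mul_comm, pow_mul, hroot, one_pow])
    rw [h1] at hφ
    have h2 : Units.map (τ : E →+* E).toMonoidHom x / x = 1 :=
      (pow_eq_one_iff_of_coprime ((hm.pow_right n))).1 ⟨hφ, hroot τ⟩
    exact congrArg Units.val (div_eq_one.1 h2)
  obtain ⟨δ, hδ⟩ := IsCyclic.exists_generator (α := Gal(E/F))
  obtain ⟨e, -, he⟩ := hgen ((Units.map (δ : E →+* E).toMonoidHom x / x : Eˣ) : E)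
    ⟨n, by rw [← Units.val_pow_eq_pow_val, hroot, Units.val_one]⟩
  have hδx : δ (x : E) = ζ ^ e * x := by
    rw [← he, ← Units.val_mul, div_mul_cancel]
    rfl
  obtain ⟨f, k, hk⟩ := exists_root_mul_of_mem_adjoin hℓ2 hδ hω hζ x.ne_zero hmem hδx
  exact ⟨ζ ^ f, b, k, by rw [← pow_mul, mul_comm, pow_mul, hζ.pow_eq_one, one_pow], hk⟩

end Local

section Kummer

/-! ### Kummer generators and pseudo-infinitesimal elements -/

variable {ℓ : ℕ} [hℓ : Fact ℓ.Prime] {K L : Type*} [Field K] [NumberField K] [Field L]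
  [NumberField L] [Algebra K L]

theorem ordT_extendT (w : HeightOneSpectrum (𝓞 L)) (r : LTensor ℓ Kˣ) :
    ordT ℓ w (extendT ℓ K L r) = ramIdx K w * ordT ℓ (HeightOneSpectrum.under (𝓞 K) w) r := by
  have : (ordT ℓ w).comp (extendT ℓ K L) =
      (ramIdx K w : ℤ_[ℓ]) • ordT ℓ (HeightOneSpectrum.under (𝓞 K) w) :=
    LTensor.hom_ext fun a => by
      rw [LinearMap.comp_apply, LTensor.map_ι, ordT_ι, ord_map, LinearMap.smul_apply, ordT_ι,
        smul_eq_mul]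
      push_cast
      rfl
  exact LinearMap.congr_fun this r

theorem map_tau_extendT (v : HeightOneSpectrum (𝓞 K)) (w : HeightOneSpectrum (𝓞 L))
    [w.asIdeal.LiesOver v.asIdeal] (τ : Gal(w.adicCompletion L/v.adicCompletion K))
    (r : LTensor ℓ Kˣ) :
    AdicCompletion.map (Ideal.span {(ℓ : ℤ_[ℓ])}) (LTensor.map ℓ
      (Units.map (τ : w.adicCompletion L →+* w.adicCompletion L).toMonoidHom))
      (localization ℓ w (extendT ℓ K L r)) = localization ℓ w (extendT ℓ K L r) := by
  simp only [localization, LinearMap.comp_apply, LCompletion.map_of, map_comp_apply]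
  congr 2
  refine congrArg _ (MonoidHom.ext fun y => Units.ext ?_)
  change τ (algebraMap L (w.adicCompletion L) (algebraMap K L y)) =
    algebraMap L (w.adicCompletion L) (algebraMap K L y)
  rw [← completionMap_algebraMap v w]
  exact τ.commutes _

theorem localization_ι (v : HeightOneSpectrum (𝓞 K)) (x : Kˣ) :
    localization ℓ v (LTensor.ι ℓ x) = LCompletion.of ℓ _
      (LTensor.ι ℓ (Units.map (algebraMap K (v.adicCompletion K)).toMonoidHom x)) := by
  rw [localization, LinearMap.comp_apply, LTensor.map_ι]

/-- In the compactification `x` times an element from `K` is a root of unity, and `τ` fixes both the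
latter and the element from `K`. Hence `τ x / x` has trivial image, i.e. is infinitely
`ℓ`-divisible. -/
theorem exists_quotient_pow_of_wild (v : HeightOneSpectrum (𝓞 K)) (w : HeightOneSpectrum (𝓞 L))
    [w.asIdeal.LiesOver v.asIdeal] {x : Lˣ} {r : LTensor ℓ Kˣ}
    (h : localization ℓ w (LTensor.ι ℓ x + extendT ℓ K L r) ∈ localMu ℓ (w.adicCompletion L))
    {τ : Gal(w.adicCompletion L/v.adicCompletion K)} (hτ : ∀ (z : (w.adicCompletion L)ˣ) (s : ℕ),
      z ^ ℓ ^ s = 1 →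
        Units.map (τ : w.adicCompletion L →+* w.adicCompletion L).toMonoidHom z = z) (b : ℕ) :
    ∃ φ, Units.map (τ : w.adicCompletion L →+* w.adicCompletion L).toMonoidHom
      (Units.map (algebraMap L (w.adicCompletion L)).toMonoidHom x) /
      Units.map (algebraMap L (w.adicCompletion L)).toMonoidHom x = φ ^ ℓ ^ b := by
  obtain ⟨ξ, s, hξ, hloc⟩ := mem_localMu_iff.1 h
  apply LCompletion.exists_pow_of_of_ι_eq_zero (ℓ := ℓ)
  have h1 := congrArg (AdicCompletion.map (Ideal.span {(ℓ : ℤ_[ℓ])}) (LTensor.map ℓ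
    (Units.map (τ : w.adicCompletion L →+* w.adicCompletion L).toMonoidHom))) hloc
  rw [map_add, map_add, map_tau_extendT, localization_ι, LCompletion.map_of, LTensor.map_ι,
    LCompletion.map_of, LTensor.map_ι, hτ ξ s hξ, ← hloc, map_add, localization_ι,
    add_left_inj] at h1
  rw [LTensor.ι_div, map_sub, h1, sub_self]

/-- The `ℓ`-part of the ramification index divides the exponent of `x`. A prime-to-`ℓ` power of `x`
is therefore a unit times a power of a uniformizer of `K_v`. By `exists_unit_pow_eq`, a further
prime-to-`ℓ` power of that unit is a root of unity times an `ℓ^b`-th power. Only the last factor is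
moved by `τ`. -/
theorem exists_quotient_pow_of_tame (v : HeightOneSpectrum (𝓞 K)) (w : HeightOneSpectrum (𝓞 L))
    [w.asIdeal.LiesOver v.asIdeal] (hw : (ℓ : 𝓞 L) ∉ w.asIdeal) {x : Lˣ} {c : ℤ_[ℓ]}
    (h : ((ord w x : ℤ) : ℤ_[ℓ]) = (v.asIdeal.ramificationIdx' w.asIdeal : ℤ_[ℓ]) * c)
    {τ : Gal(w.adicCompletion L/v.adicCompletion K)} (hτ : ∀ (z : (w.adicCompletion L)ˣ) (s : ℕ),
      z ^ ℓ ^ s = 1 →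
        Units.map (τ : w.adicCompletion L →+* w.adicCompletion L).toMonoidHom z = z) (b : ℕ) :
    ∃ m : ℕ, m.Coprime ℓ ∧
      ∃ φ, (Units.map (τ : w.adicCompletion L →+* w.adicCompletion L).toMonoidHom
      (Units.map (algebraMap L (w.adicCompletion L)).toMonoidHom x) /
      Units.map (algebraMap L (w.adicCompletion L)).toMonoidHom x) ^ m = φ ^ ℓ ^ b := by
  set T := Units.map (τ : w.adicCompletion L →+* w.adicCompletion L).toMonoidHom with hT
  set X := Units.map (algebraMap L (w.adicCompletion L)).toMonoidHom x with hX
  set e := v.asIdeal.ramificationIdx' w.asIdeal with he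
  have he0 : e ≠ 0 := Ideal.IsDedekindDomain.ramificationIdx'_ne_zero_of_liesOver w.asIdeal v.ne_bot
  obtain ⟨s, m, hm, hem⟩ := Nat.exists_eq_pow_mul_and_not_dvd he0 ℓ hℓ.out.ne_one
  have hdvd : ((ℓ : ℤ) ^ s) ∣ ord w x := by
    rw [← PadicInt.pow_p_dvd_int_iff, h, hem]
    push_cast
    rw [mul_assoc]
    exact dvd_mul_right _ _
  obtain ⟨d, hd⟩ := hdvd
  obtain ⟨π, hπ⟩ := exists_localOrd_eq_one v
  set P : (v.adicCompletion K)ˣ := Units.map (algebraMap K (v.adicCompletion K)).toMonoidHom π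
    with hP
  set Q := Units.map (completionMap v w).toMonoidHom P with hQ
  have hTQ : T Q = Q := Units.ext (τ.commutes (P : v.adicCompletion K))
  have hQord : localOrd w Q = e := by
    rw [hQ, localOrd_completionMap, hP, localOrd_map, hπ, mul_one]
  have hu : localOrd w (X ^ m * Q ^ (-d)) = 0 := by
    rw [localOrd_mul, localOrd_pow, localOrd_zpow, hQord, hX, localOrd_map, hd, hem]
    push_cast
    ring
  obtain ⟨c', hc', hcℓ⟩ := exists_nat_norm_lt_one (v := w) hw
  obtain ⟨m', hm', ζ, t, s', hζ, hut⟩ :=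
    exists_unit_pow_eq hc' hcℓ b ((localOrd_eq_zero_iff w _).1 hu)
  refine ⟨m * m', Nat.Coprime.mul_left ?_ hm', T t / t, ?_⟩
  · exact ((hℓ.out.coprime_iff_not_dvd).2 hm).symm
  · have h1 := congrArg T hut
    rw [map_pow, map_mul, map_mul, map_pow, map_pow, map_zpow, hTQ, hτ ζ s' hζ] at h1
    rw [pow_mul, div_pow (T t), div_pow (T X), div_pow]
    have h2 : (T X ^ m) ^ m' / (X ^ m) ^ m' =
        (T X ^ m * Q ^ (-d)) ^ m' / (X ^ m * Q ^ (-d)) ^ m' := by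
      rw [mul_pow, mul_pow, mul_div_mul_right_eq_div]
    rw [h2, h1, hut, mul_div_mul_left_eq_div]

/-- The Kummer generators attached to pseudo-infinitesimal elements with divisor coming from the
base field are locally products of roots of unity and elements of the base. -/
theorem locallyRootTimesBase_of_pseudoInfinitesimal (hℓ2 : ℓ ≠ 2) [IsGalois K L]
    [IsCyclic Gal(L/K)] {ω : K} (hω : IsPrimitiveRoot ω ℓ) {x : Lˣ} {n : ℕ} {y : K}
    (hx : (x : L) ^ ℓ ^ n = algebraMap K L y) {r : LTensor ℓ Kˣ} {a : TameDivisor ℓ K}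
    (hmem : LTensor.ι ℓ x + extendT ℓ K L r ∈ pseudoInfinitesimal ℓ L)
    (hdiv : principalDivisor ℓ L (LTensor.ι ℓ x + extendT ℓ K L r) = extendDivisor ℓ K L a) :
    LocallyRootTimesBase ℓ K (x : L) := by
  intro v w hvw
  have hfin : Finite (CommGroup.primaryComponent (w.adicCompletion L)ˣ ℓ) :=
    finite_primaryComponent ℓ
  have hund : HeightOneSpectrum.under (𝓞 K) w = v := HeightOneSpectrum.ext hvw.over.symm
  refine exists_root_mul_of_quotient_pow (F := v.adicCompletion K)
    (x := Units.map (algebraMap L (w.adicCompletion L)).toMonoidHom x) (n := n)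
    (a := algebraMap K _ y) hℓ2
    (hω.map_of_injective (algebraMap K (v.adicCompletion K)).injective) ?_ ?_
  · change (algebraMap L (w.adicCompletion L) x) ^ ℓ ^ n = completionMap v w _
    rw [← map_pow, hx, completionMap_algebraMap]
  · intro b τ hτ
    by_cases hw : (ℓ : 𝓞 L) ∈ w.asIdeal
    · rw [pseudoInfinitesimal, Submodule.mem_iInf] at hmem
      obtain ⟨φ, hφ⟩ := exists_quotient_pow_of_wild v w (hmem ⟨w, hw⟩) hτ b
      exact ⟨1, Nat.coprime_one_left ℓ, φ, by rw [pow_one, hφ]⟩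
    · have h1 := DFunLike.congr_fun hdiv (⟨w, hw⟩ : TamePlace ℓ L)
      rw [principalDivisor_apply, extendDivisor_apply, map_add, ordT_ι, ordT_extendT,
        ← eq_sub_iff_add_eq, ← mul_sub] at h1
      obtain ⟨c, hc⟩ : ∃ c, ((ord w x : ℤ) : ℤ_[ℓ]) = (ramIdx K w : ℤ_[ℓ]) * c := ⟨_, h1⟩
      subst hund
      exact exists_quotient_pow_of_tame _ w hw hc hτ b

/-- The local components in the base field of a Kummer generator which is locally a root of unity
times an element of the base. -/
theorem exists_local_components {ℓ : ℕ} {x : Lˣ} {n : ℕ} {y : K}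
    (hx : (x : L) ^ ℓ ^ n = algebraMap K L y) (h : LocallyRootTimesBase ℓ K (x : L)) :
    ∃ k : ∀ v : HeightOneSpectrum (𝓞 K), (v.adicCompletion K)ˣ,
      ∀ (v : HeightOneSpectrum (𝓞 K)) (w : HeightOneSpectrum (𝓞 L)) [w.asIdeal.LiesOver v.asIdeal],
      ∃ M : ℕ, Units.map (algebraMap L (w.adicCompletion L)).toMonoidHom x ^ ℓ ^ M =
        Units.map (completionMap v w).toMonoidHom (k v) ^ ℓ ^ M := by
  have key : ∀ v : HeightOneSpectrum (𝓞 K), ∃ k : (v.adicCompletion K)ˣ,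
      ∀ (w : HeightOneSpectrum (𝓞 L)) [w.asIdeal.LiesOver v.asIdeal],
      ∃ M : ℕ, Units.map (algebraMap L (w.adicCompletion L)).toMonoidHom x ^ ℓ ^ M =
        Units.map (completionMap v w).toMonoidHom k ^ ℓ ^ M := by
    intro v
    obtain ⟨w, hw⟩ := exists_liesOver (E := L) v
    obtain ⟨z, m, k, hz, hk⟩ := h v w
    have hk0 : k ≠ 0 := by
      rintro rfl
      rw [map_zero, mul_zero, map_eq_zero] at hk
      exact x.ne_zero hk
    -- A high `ℓ`-power of `x` lies in `K`, so the `k` found at one place `w` has the right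
    -- `ℓ`-power at every place above `v`.
    have hM : ∀ (w : HeightOneSpectrum (𝓞 L)) [w.asIdeal.LiesOver v.asIdeal],
        algebraMap L (w.adicCompletion L) x ^ ℓ ^ (n + m) =
          completionMap v w (algebraMap K _ (y ^ ℓ ^ m)) := by
      intro w _
      rw [completionMap_algebraMap, map_pow, ← hx, pow_add, pow_mul, ← map_pow, ← map_pow]
    have hkM : k ^ ℓ ^ (n + m) = algebraMap K _ (y ^ ℓ ^ m) := by
      apply (completionMap v w).injective
      rw [← hM w, hk, mul_pow, pow_add ℓ n m, mul_comm (ℓ ^ n), pow_mul z, hz, one_pow, one_mul,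
        map_pow]
    refine ⟨Units.mk0 k hk0, fun w' _ => ⟨n + m, Units.ext ?_⟩⟩
    change algebraMap L (w'.adicCompletion L) x ^ ℓ ^ (n + m) = completionMap v w' k ^ ℓ ^ (n + m)
    rw [hM w', ← hkM, map_pow]
  choose k hk using key
  exact ⟨k, hk⟩

/-- The element `r` is chosen with components `(k v)⁻¹` at the wild places, which makes `x` times
`r` torsion there. At the tame places the exponents of `x` are those of the `k v` multiplied by the
ramification indices, so the divisor comes from `K`. -/
theorem exists_pseudoInfinitesimal_of_locallyRootTimesBase {x : Lˣ} {n : ℕ} {y : K}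
    (hx : (x : L) ^ ℓ ^ n = algebraMap K L y) (h : LocallyRootTimesBase ℓ K (x : L)) :
    ∃ (r : LTensor ℓ Kˣ) (a : TameDivisor ℓ K),
      LTensor.ι ℓ x + extendT ℓ K L r ∈ pseudoInfinitesimal ℓ L ∧
      principalDivisor ℓ L (LTensor.ι ℓ x + extendT ℓ K L r) = extendDivisor ℓ K L a := by
  obtain ⟨k, hk⟩ := exists_local_components hx h
  have hord : ∀ (v : HeightOneSpectrum (𝓞 K)) (w : HeightOneSpectrum (𝓞 L))
      [w.asIdeal.LiesOver v.asIdeal],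
      ord w x = (v.asIdeal.ramificationIdx' w.asIdeal : ℤ) * localOrd v (k v) := by
    intro v w _
    obtain ⟨M, hM⟩ := hk v w
    have h1 := congrArg (localOrd w) hM
    rw [localOrd_pow, localOrd_pow, localOrd_map, localOrd_completionMap] at h1
    refine mul_left_cancel₀ ?_ h1
    exact_mod_cast pow_ne_zero M hℓ.out.ne_zero
  have hfin : {v : HeightOneSpectrum (𝓞 K) | localOrd v (k v) ≠ 0}.Finite := by
    choose W hW using exists_liesOver (K := K) (E := L)
    have hinj : Function.Injective W := fun v v' hv => by
      apply HeightOneSpectrum.ext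
      rw [(hW v).over, (hW v').over, hv]
    refine ((finite_ord x).preimage hinj.injOn).subset fun v hv => ?_
    change ord (W v) x ≠ 0
    have := hW v
    rw [hord v (W v)]
    refine mul_ne_zero ?_ hv
    exact_mod_cast Ideal.IsDedekindDomain.ramificationIdx'_ne_zero_of_liesOver (W v).asIdeal
      v.ne_bot
  let a : TameDivisor ℓ K := Finsupp.ofSupportFinite
    (fun v => ((localOrd v.1 (k v.1) : ℤ) : ℤ_[ℓ])) <|
      (hfin.preimage Subtype.val_injective.injOn).subset fun v hv h =>
        hv (by simp only at h ⊢; rw [h, Int.cast_zero])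
  obtain ⟨r, hr⟩ := exists_localization_eq (ℓ := ℓ) (fun v : WildPlace ℓ K => (k v.1)⁻¹)
  refine ⟨r, a + principalDivisor ℓ K r, ?_, ?_⟩
  · rw [mem_pseudoInfinitesimal_iff]
    intro w
    let v : WildPlace ℓ K := ⟨HeightOneSpectrum.under (𝓞 K) w.1, by
      change algebraMap (𝓞 K) (𝓞 L) (ℓ : 𝓞 K) ∈ w.1.asIdeal
      rw [map_natCast]
      exact w.2⟩
    have : w.1.asIdeal.LiesOver v.1.asIdeal := ⟨rfl⟩
    obtain ⟨M, hM⟩ := hk v.1 w.1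
    refine ⟨((ℓ ^ M : ℕ) : ℤ_[ℓ]), by exact_mod_cast pow_ne_zero M hℓ.out.ne_zero, ?_⟩
    rw [map_add, localization_ι, localization_extendT v.1 w.1, hr v, LCompletion.map_of,
      LTensor.map_ι, ← map_add, ← LTensor.ι_mul, ← map_smul, ← LTensor.ι_pow, mul_pow, hM,
      ← mul_pow, ← map_mul, mul_inv_cancel, map_one, one_pow, LTensor.ι_one, map_zero]
  · rw [map_add, map_add, extendDivisor_principalDivisor]
    congr 1
    ext w
    rw [principalDivisor_ι, extendDivisor_apply]
    have : w.1.asIdeal.LiesOver (HeightOneSpectrum.under (𝓞 K) w.1).asIdeal := ⟨rfl⟩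
    rw [hord (HeightOneSpectrum.under (𝓞 K) w.1) w.1, Int.cast_mul]
    rfl

end Kummer

section KummerRoots

/-! ### Roots of unity of the form `σ x / x` -/

variable {ℓ : ℕ} [hℓ : Fact ℓ.Prime]

/-- A form of Hilbert's theorem 90 for the powers of a root of unity. -/
theorem exists_map_eq_root_mul {K M : Type*} [Field K] [Field M] [Algebra K M]
    [FiniteDimensional K M] [IsGalois K M] {g : Gal(M/K)}
    (hg : ∀ τ, τ ∈ Subgroup.zpowers g) {ζ : M} {u i : ℕ} (hζ0 : ζ ≠ 0) (hu : g ζ = ζ ^ u)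
    (h : ζ ^ (i * ∑ j ∈ Finset.range (Module.finrank K M), u ^ j) = 1) :
    ∃ x : M, x ≠ 0 ∧ g x = ζ ^ i * x := by
  set d := Module.finrank K M with hd
  have hord : orderOf g = d := by
    rw [orderOf_eq_card_of_forall_mem_zpowers hg, IsGalois.card_aut_eq_finrank]
  have hd0 : 0 < d := Module.finrank_pos
  set c : ℕ → M := fun j => ζ ^ (i * ∑ t ∈ Finset.range j, u ^ t) with hc
  have hinj : Function.Injective
      fun j : Fin d => (((g ^ (j : ℕ) : Gal(M/K)) : M →+* M) : M →* M) := by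
    intro j k hjk
    have h1 : g ^ (j : ℕ) = g ^ (k : ℕ) := AlgEquiv.ext fun y => DFunLike.congr_fun hjk y
    exact Fin.ext (pow_injOn_Iio_orderOf (by simp [hord]) (by simp [hord]) h1)
  have hli := (linearIndependent_monoidHom M M).comp _ hinj
  rw [Fintype.linearIndependent_iff] at hli
  -- A Lagrange resolvent; linear independence of the characters `g^j` makes it nonzero for some
  -- `y`.
  obtain ⟨y, hy⟩ : ∃ y : M, ∑ j ∈ Finset.range d, c j * (g ^ j) y ≠ 0 := by
    by_contra! hcon
    have h2 := hli (fun j => c j) (by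
      funext y
      rw [Finset.sum_apply]
      have := hcon y
      rw [Finset.sum_range] at this
      exact this) ⟨0, hd0⟩
    simp [hc] at h2
  have hstep : ∀ j, ζ ^ i * g (c j * (g ^ j) y) = c (j + 1) * (g ^ (j + 1)) y := by
    intro j
    rw [map_mul, pow_succ' g, AlgEquiv.mul_apply, ← mul_assoc, hc]
    congr 1
    simp only [map_pow, hu]
    rw [← pow_mul, ← pow_add, geom_sum_succ]
    congr 1
    ring
  set f := ∑ j ∈ Finset.range d, c j * (g ^ j) y with hf
  have hgf : ζ ^ i * g f = f := by
    rw [hf, map_sum, Finset.mul_sum, Finset.sum_congr rfl fun j _ => hstep j]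
    have h3 := Finset.sum_range_succ (fun j => c j * (g ^ j) y) d
    rw [Finset.sum_range_succ'] at h3
    -- The norm condition `h` says `c d = 1`, which closes the cyclic sum.
    have h4 : c d * (g ^ d) y = c 0 * (g ^ 0) y := by
      rw [← hord, pow_orderOf_eq_one, pow_zero, hord, hc]
      simp only [h, Finset.range_zero, Finset.sum_empty, mul_zero, pow_zero]
    rw [h4] at h3
    exact add_right_cancel h3
  refine ⟨f⁻¹, inv_ne_zero hy, ?_⟩
  rw [map_inv₀]
  have h5 : g f ≠ 0 := (map_ne_zero g).2 hy
  rw [inv_eq_iff_eq_inv, mul_inv, inv_inv, ← hgf, ← mul_assoc, hgf, inv_mul_cancel₀ (pow_ne_zero _ hζ0), one_mul]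

/-- By Hilbert 90 the left side says that the norm `ζ^(i · ∑ u^j)` is trivial. The geometric sum has
`ℓ`-valuation exactly `c`, so the condition is the same as being killed by `ℓ^c`. -/
theorem exists_map_eq_root_mul_iff (hℓ2 : ℓ ≠ 2) {K M : Type*} [Field K] [Field M] [Algebra K M]
    [FiniteDimensional K M] [IsGalois K M] {g : Gal(M/K)}
    (hg : ∀ τ, τ ∈ Subgroup.zpowers g) {c : ℕ} (hc : Module.finrank K M = ℓ ^ c)
    {ω : K} (hω : IsPrimitiveRoot ω ℓ) {ζ : M} {b : ℕ} (hζ : IsPrimitiveRoot ζ (ℓ ^ b)) (i : ℕ) :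
    (∃ x : M, x ≠ 0 ∧ g x = ζ ^ i * x) ↔ (ζ ^ i) ^ ℓ ^ c = 1 := by
  obtain ⟨u, hu1, hdvd, hu⟩ := exists_exponent hζ
    (hω.map_of_injective (algebraMap K M).injective) g (g.commutes ω)
  have hd0 : ℓ ^ c ≠ 0 := pow_ne_zero _ hℓ.out.ne_zero
  have hord : orderOf g = ℓ ^ c := by
    rw [orderOf_eq_card_of_forall_mem_zpowers hg, IsGalois.card_aut_eq_finrank, hc]
  have hiff : ζ ^ (i * ∑ j ∈ Finset.range (ℓ ^ c), u ^ j) = 1 ↔ (ζ ^ i) ^ ℓ ^ c = 1 := by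
    have hS0 := geomSum_ne_zero hu1 hd0
    obtain ⟨s, S', hS', hS⟩ := Nat.exists_eq_pow_mul_and_not_dvd hS0 ℓ hℓ.out.ne_one
    have hv := padicValNat_geomSum hℓ2 hu1 hdvd hd0
    have hS'0 : S' ≠ 0 := by
      rintro rfl
      exact hS' (dvd_zero _)
    rw [hS, padicValNat.mul (pow_ne_zero _ hℓ.out.ne_zero) hS'0, padicValNat.prime_pow,
      padicValNat.prime_pow, padicValNat.eq_zero_of_not_dvd hS', add_zero] at hv
    rw [hS, hv, ← pow_mul, hζ.pow_eq_one_iff_dvd, hζ.pow_eq_one_iff_dvd, ← mul_assoc]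
    exact Nat.Coprime.dvd_mul_right (Nat.Coprime.pow_left b ((hℓ.out.coprime_iff_not_dvd).2 hS'))
  constructor
  · rintro ⟨x, hx0, hx⟩
    have h1 := (iterate_root g hu hx (ℓ ^ c)).2
    rw [← AlgEquiv.coe_pow, ← hord, pow_orderOf_eq_one, hord, AlgEquiv.one_apply] at h1
    rw [← hiff]
    exact mul_right_cancel₀ hx0 (by rw [← h1, one_mul])
  · intro h
    exact exists_map_eq_root_mul hg (hζ.ne_zero (pow_ne_zero _ hℓ.out.ne_zero)) hu
      (by rw [hc, hiff, h])

variable {K L : Type*} [Field K] [Field L] [Algebra K L]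

/-- The multiplicative operator `x ↦ σ x / x`. -/
def quotientHom (σ : Gal(L/K)) : Lˣ →* Lˣ :=
  Units.map (σ : L →+* L).toMonoidHom / MonoidHom.id Lˣ

theorem quotientHom_eq_iff {σ : Gal(L/K)} {x η : Lˣ} :
    quotientHom σ x = η ↔ σ (x : L) = η * x := by
  change Units.map (σ : L →+* L).toMonoidHom x / x = η ↔ _
  rw [div_eq_iff_eq_mul, Units.ext_iff]
  rfl

theorem exists_map_eq_of_quotientHom_eq_one [FiniteDimensional K L] [IsGalois K L]
    {σ : Gal(L/K)} (hσ : ∀ τ, τ ∈ Subgroup.zpowers σ) {x : Lˣ} (hx : quotientHom σ x = 1) :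
    ∃ k : Kˣ, Units.map (algebraMap K L).toMonoidHom k = x := by
  rw [quotientHom_eq_iff, Units.val_one, one_mul] at hx
  have hall : ∀ τ : Gal(L/K), τ (x : L) = x := by
    intro τ
    obtain ⟨k, rfl⟩ := hσ τ
    have h4 : σ ∈ MulAction.stabilizer Gal(L/K) (x : L) := hx
    exact Subgroup.zpow_mem _ h4 k
  obtain ⟨k, hk⟩ := (IsGalois.mem_range_algebraMap_iff_fixed _).2 hall
  have hk0 : k ≠ 0 := by
    rintro rfl
    rw [map_zero] at hk
    exact x.ne_zero hk.symm
  exact ⟨Units.mk0 k hk0, Units.ext hk⟩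

/-- The roots of unity of `ℓ`-power order of the form `σ x / x` with `x` in `Λ`. -/
def quotientRoots (ℓ : ℕ) [Fact ℓ.Prime] (σ : Gal(L/K)) (Λ : Subgroup Lˣ) : Subgroup Lˣ :=
  CommGroup.primaryComponent Lˣ ℓ ⊓ Λ.map (quotientHom σ)

theorem mem_quotientRoots {σ : Gal(L/K)} {Λ : Subgroup Lˣ} {η : Lˣ} :
    η ∈ quotientRoots ℓ σ Λ ↔ (∃ n, η ^ ℓ ^ n = 1) ∧ ∃ x ∈ Λ, quotientHom σ x = η := Iff.rfl

/-- The units of an intermediate field. -/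
def unitsOf (Λ : IntermediateField K L) : Subgroup Lˣ :=
  Λ.toSubfield.toSubmonoid.units

theorem mem_unitsOf {Λ : IntermediateField K L} {x : Lˣ} : x ∈ unitsOf Λ ↔ (x : L) ∈ Λ := by
  rw [unitsOf, Submonoid.mem_units_iff]
  refine ⟨fun h => h.1, fun h => ⟨h, ?_⟩⟩
  have : ((x⁻¹ : Lˣ) : L) ∈ Λ := by
    rw [Units.val_inv_eq_inv_val]
    exact inv_mem h
  exact this

/-- The criterion is applied to the restriction of `σ` to `Λ`, a generator of `Gal(Λ/K)`. Since `Λ`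
contains all `ℓ`-power roots of unity of `L`, the only constraints on `η` are `ℓ^b` and `ℓ^c`. -/
theorem quotientRoots_unitsOf (hℓ2 : ℓ ≠ 2) [FiniteDimensional K L] [IsGalois K L]
    {σ : Gal(L/K)} (hσ : ∀ τ, τ ∈ Subgroup.zpowers σ)
    {ω : K} (hω : IsPrimitiveRoot ω ℓ) {ζ : L} {b : ℕ} (hζ : IsPrimitiveRoot ζ (ℓ ^ b))
    (hgen : ∀ z : L, (∃ n, z ^ ℓ ^ n = 1) → ∃ i < ℓ ^ b, z = ζ ^ i)
    {Λ : IntermediateField K L} (hζΛ : ζ ∈ Λ) {c : ℕ} (hc : Module.finrank K Λ = ℓ ^ c) :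
    quotientRoots ℓ σ (unitsOf Λ) = rootsOfUnity (ℓ ^ min b c) L := by
  have : IsCyclic Gal(L/K) := ⟨σ, hσ⟩
  have : IsAbelianGalois K L := IsAbelianGalois.of_isCyclic K L
  let g : Gal(Λ/K) := AlgEquiv.restrictNormalHom Λ σ
  have hgg : ∀ τ, τ ∈ Subgroup.zpowers g := by
    intro τ
    obtain ⟨τ, rfl⟩ := AlgEquiv.restrictNormalHom_surjective (F := K) (K₁ := Λ) L τ
    obtain ⟨k, rfl⟩ := hσ τ
    exact ⟨k, (map_zpow _ _ _).symm⟩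
  have hcomm : ∀ x : Λ, ((g x : Λ) : L) = σ x := AlgEquiv.restrictNormal_commutes σ Λ
  have hζ' : IsPrimitiveRoot (⟨ζ, hζΛ⟩ : Λ) (ℓ ^ b) :=
    IsPrimitiveRoot.of_map_of_injective (f := algebraMap Λ L) hζ (algebraMap Λ L).injective
  ext η
  rw [mem_quotientRoots, mem_rootsOfUnity]
  have hmain : ∀ i : ℕ, (η : L) = ζ ^ i →
      ((∃ x ∈ unitsOf Λ, quotientHom σ x = η) ↔ η ^ ℓ ^ c = 1) := by
    intro i hi
    have h1 := exists_map_eq_root_mul_iff hℓ2 hgg hc hω hζ' i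
    have h2 : ((⟨ζ, hζΛ⟩ : Λ) ^ i) ^ ℓ ^ c = 1 ↔ η ^ ℓ ^ c = 1 := by
      rw [Units.ext_iff, Units.val_pow_eq_pow_val, hi, Subtype.ext_iff]
      rfl
    rw [← h2, ← h1]
    constructor
    · rintro ⟨x, hx, hxη⟩
      rw [mem_unitsOf] at hx
      rw [quotientHom_eq_iff] at hxη
      refine ⟨⟨x, hx⟩, fun h => x.ne_zero (congrArg Subtype.val h), Subtype.ext ?_⟩
      rw [hcomm]
      change σ (x : L) = ζ ^ i * x
      rw [hxη, hi]
    · rintro ⟨x, hx0, hx⟩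
      have hx0' : (x : L) ≠ 0 := fun h => hx0 (Subtype.ext h)
      refine ⟨Units.mk0 x hx0', mem_unitsOf.2 x.2, quotientHom_eq_iff.2 ?_⟩
      have := congrArg Subtype.val hx
      rw [hcomm] at this
      change σ (x : L) = η * x
      rw [this, hi]
      rfl
  constructor
  · rintro ⟨⟨n, hn⟩, hx⟩
    obtain ⟨i, -, hi⟩ := hgen η ⟨n, by rw [← Units.val_pow_eq_pow_val, hn, Units.val_one]⟩
    have h1 : η ^ ℓ ^ b = 1 := by
      apply Units.ext
      rw [Units.val_pow_eq_pow_val, hi, ← pow_mul, mul_comm, pow_mul, hζ.pow_eq_one, one_pow,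
        Units.val_one]
    rcases min_choice b c with h | h
    · rw [h, h1]
    · rw [h]
      exact (hmain i hi).1 hx
  · intro h
    have h1 : ∀ m, min b c ≤ m → η ^ ℓ ^ m = 1 := by
      intro m hm
      obtain ⟨k, hk⟩ := pow_dvd_pow ℓ hm
      rw [hk, pow_mul, h, one_pow]
    have hb := h1 b (min_le_left _ _)
    obtain ⟨i, -, hi⟩ := hgen η ⟨b, by rw [← Units.val_pow_eq_pow_val, hb, Units.val_one]⟩
    exact ⟨⟨b, hb⟩, (hmain i hi).2 (h1 c (min_le_right _ _))⟩

theorem card_rootsOfUnity_min {ζ : L} {b : ℕ} (hζ : IsPrimitiveRoot ζ (ℓ ^ b)) (c : ℕ) :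
    Nat.card (rootsOfUnity (ℓ ^ min b c) L) = ℓ ^ min b c := by
  have : NeZero (ℓ ^ min b c) := ⟨pow_ne_zero _ hℓ.out.ne_zero⟩
  have h : IsPrimitiveRoot (ζ ^ ℓ ^ (b - min b c)) (ℓ ^ min b c) :=
    hζ.pow (pow_pos hℓ.out.pos _) (by rw [← pow_add, Nat.sub_add_cancel (min_le_left _ _)])
  exact h.card_rootsOfUnity

/-- The number of quotients `σ z / z` of roots of unity. -/
theorem card_map_quotientHom_mul {ℓ : ℕ} [FiniteDimensional K L] [IsGalois K L]
    {σ : Gal(L/K)} (hσ : ∀ τ, τ ∈ Subgroup.zpowers σ) :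
    Nat.card ((CommGroup.primaryComponent Lˣ ℓ).map (quotientHom σ)) *
      Nat.card (CommGroup.primaryComponent Kˣ ℓ) = Nat.card (CommGroup.primaryComponent Lˣ ℓ) := by
  let D : CommGroup.primaryComponent Lˣ ℓ →* Lˣ :=
    (quotientHom σ).comp (CommGroup.primaryComponent Lˣ ℓ).subtype
  have hD : D.range = (CommGroup.primaryComponent Lˣ ℓ).map (quotientHom σ) := by
    rw [MonoidHom.range_comp, Subgroup.range_subtype]
  let J : CommGroup.primaryComponent Kˣ ℓ → D.ker := fun z =>
    ⟨⟨Units.map (algebraMap K L).toMonoidHom z.1, by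
      obtain ⟨n, hn⟩ := z.2
      exact ⟨n, by rw [← map_pow, hn, map_one]⟩⟩, by
      rw [MonoidHom.mem_ker]
      change quotientHom σ (Units.map (algebraMap K L).toMonoidHom z.1) = 1
      rw [quotientHom_eq_iff, Units.val_one, one_mul]
      exact σ.commutes _⟩
  have hJ : Function.Bijective J := by
    constructor
    · intro y z h
      have h1 := congrArg (fun t : D.ker => ((t : CommGroup.primaryComponent Lˣ ℓ) : Lˣ)) h
      exact Subtype.ext (Units.map_injective (algebraMap K L).injective h1)
    · rintro ⟨⟨x, n, hn⟩, hx⟩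
      obtain ⟨k, rfl⟩ := exists_map_eq_of_quotientHom_eq_one hσ hx
      refine ⟨⟨k, n, ?_⟩, rfl⟩
      apply Units.map_injective (f := (algebraMap K L).toMonoidHom) (algebraMap K L).injective
      rw [map_pow, hn, map_one]
  rw [← hD, ← Subgroup.index_ker, Nat.card_congr (Equiv.ofBijective J hJ), mul_comm,
    Subgroup.card_mul_index]

end KummerRoots

/-- `C` is the quotient of `Y` by `B + ker Ψ`, which `Ψ` identifies with `Ψ(Y) / Ψ(B)`. -/
theorem card_mul_card_map {Y C M : Type*} [AddCommGroup Y] [AddCommGroup C] [AddCommGroup M]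
    {Φ : Y →+ C} (hΦ : Function.Surjective Φ) {Ψ : Y →+ M} {B : AddSubgroup Y}
    (h : Φ.ker = B ⊔ Ψ.ker) : Nat.card C * Nat.card (B.map Ψ) = Nat.card Ψ.range := by
  have h1 : (B.map Ψ.rangeRestrict).index = Nat.card C := by
    rw [AddSubgroup.index_map, AddMonoidHom.range_eq_top.2 Ψ.rangeRestrict_surjective,
      AddSubgroup.index_top, mul_one, AddMonoidHom.ker_rangeRestrict, ← h, AddSubgroup.index_ker,
      AddMonoidHom.range_eq_top.2 hΦ, AddSubgroup.card_top]
  have h2 : (B.map Ψ.rangeRestrict).map Ψ.range.subtype = B.map Ψ := by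
    rw [AddSubgroup.map_map]
    rfl
  rw [← h1, ← h2, ← Nat.card_congr ((B.map Ψ.rangeRestrict).equivMapOfInjective Ψ.range.subtype
    Subtype.val_injective).toEquiv, mul_comm, AddSubgroup.card_mul_index]

section Capitulation

/-! ### The capitulation kernel through `σ - 1` -/

variable {ℓ : ℕ} [hℓ : Fact ℓ.Prime]

/-- The additive subgroup of `ℤ_ℓ ⊗ A` generated by a subgroup of `A`. -/
def tensorSubgroup (ℓ : ℕ) [Fact ℓ.Prime] {A : Type*} [CommGroup A] (H : Subgroup A) :
    AddSubgroup (LTensor ℓ A) where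
  carrier := LTensor.ι ℓ '' H
  zero_mem' := ⟨1, H.one_mem, LTensor.ι_one⟩
  add_mem' := by
    rintro _ _ ⟨a, ha, rfl⟩ ⟨b, hb, rfl⟩
    exact ⟨a * b, H.mul_mem ha hb, LTensor.ι_mul a b⟩
  neg_mem' := by
    rintro _ ⟨a, ha, rfl⟩
    exact ⟨a⁻¹, H.inv_mem ha, LTensor.ι_inv a⟩

theorem card_tensorSubgroup {A : Type*} [CommGroup A] {H : Subgroup A}
    (hH : H ≤ CommGroup.primaryComponent A ℓ) :
    Nat.card (tensorSubgroup ℓ H) = Nat.card H := by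
  refine Nat.card_image_of_injOn (s := (H : Set A)) (f := LTensor.ι ℓ) ?_
  intro a ha b hb h
  obtain ⟨m, hm⟩ := hH ha
  obtain ⟨n, hn⟩ := hH hb
  refine LTensor.eq_of_ι_eq (N := m + n) ?_ ?_ h
  · rw [pow_add, pow_mul, hm, one_pow]
  · rw [add_comm, pow_add, pow_mul, hn, one_pow]

theorem galT_sub_ι {K L : Type*} [Field K] [Field L] [Algebra K L]
    (σ : Gal(L/K)) (x : Lˣ) :
    galT ℓ σ (LTensor.ι ℓ x) - LTensor.ι ℓ x = LTensor.ι ℓ (quotientHom σ x) := by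
  rw [LTensor.map_ι, ← LTensor.ι_div]
  rfl

variable {K L : Type*} [Field K] [NumberField K] [Field L] [NumberField L] [Algebra K L]

theorem ι_mem_pseudoInfinitesimal {η : Kˣ} {n : ℕ} (h : η ^ ℓ ^ n = 1) :
    LTensor.ι ℓ η ∈ pseudoInfinitesimal ℓ K := by
  rw [mem_pseudoInfinitesimal_iff]
  intro v
  refine ⟨((ℓ ^ n : ℕ) : ℤ_[ℓ]), by exact_mod_cast pow_ne_zero n hℓ.out.ne_zero, ?_⟩
  rw [← map_smul, ← LTensor.ι_pow, h, LTensor.ι_one, map_zero]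

theorem principalDivisor_ι_eq_zero {η : Kˣ} {n : ℕ} (h : η ^ ℓ ^ n = 1) :
    principalDivisor ℓ K (LTensor.ι ℓ η) = 0 := by
  have h1 : ((ℓ ^ n : ℕ) : ℤ_[ℓ]) • principalDivisor ℓ K (LTensor.ι ℓ η) = 0 := by
    rw [← map_smul, ← LTensor.ι_pow, h, LTensor.ι_one, map_zero]
  exact (smul_eq_zero.1 h1).resolve_left (by exact_mod_cast pow_ne_zero n hℓ.out.ne_zero)

variable (ℓ K L) in
/-- The pseudo-infinitesimal elements of `L` whose divisor comes from `K`. -/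
def descentModule : Submodule ℤ_[ℓ] (LTensor ℓ Lˣ) :=
  pseudoInfinitesimal ℓ L ⊓
    (LinearMap.range (extendDivisor ℓ K L)).comap (principalDivisor ℓ L)

variable (ℓ K L) in
/-- The divisor of `K` attached to an element of `descentModule`. -/
def descentDivisor : descentModule ℓ K L →ₗ[ℤ_[ℓ]] TameDivisor ℓ K :=
  (LinearEquiv.ofInjective (extendDivisor ℓ K L) extendDivisor_injective).symm.toLinearMap.comp
    (((principalDivisor ℓ L).comp (descentModule ℓ K L).subtype).codRestrict _ fun X => X.2.2)

theorem extendDivisor_descentDivisor (X : descentModule ℓ K L) :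
    extendDivisor ℓ K L (descentDivisor ℓ K L X) = principalDivisor ℓ L X := by
  have := LinearEquiv.apply_symm_apply
    (LinearEquiv.ofInjective (extendDivisor ℓ K L) extendDivisor_injective)
    ((((principalDivisor ℓ L).comp (descentModule ℓ K L).subtype).codRestrict _ fun X => X.2.2) X)
  exact congrArg Subtype.val this

variable (ℓ K L) in
/-- The capitulating class attached to an element of `descentModule`. -/
def descentClass : descentModule ℓ K L →ₗ[ℤ_[ℓ]] Cap ℓ K L :=
  ((principalBP ℓ K).mkQ.comp (descentDivisor ℓ K L)).codRestrict _ fun X => by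
    rw [Cap, LinearMap.mem_ker, LinearMap.comp_apply, extendClass, Submodule.mkQ_apply,
      Submodule.mapQ_apply, Submodule.Quotient.mk_eq_zero, extendDivisor_descentDivisor]
    exact ⟨X, X.2.1, rfl⟩

theorem descentClass_surjective : Function.Surjective (descentClass ℓ K L) := by
  rintro ⟨c, hc⟩
  obtain ⟨a, rfl⟩ := Submodule.mkQ_surjective _ c
  rw [Cap, LinearMap.mem_ker, extendClass, Submodule.mkQ_apply, Submodule.mapQ_apply,
    Submodule.Quotient.mk_eq_zero] at hc
  obtain ⟨X, hX, hXa⟩ := hc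
  refine ⟨⟨X, hX, a, hXa.symm⟩, Subtype.ext ?_⟩
  change (principalBP ℓ K).mkQ (descentDivisor ℓ K L ⟨X, hX, a, hXa.symm⟩) = _
  congr 1
  apply extendDivisor_injective (L := L)
  rw [extendDivisor_descentDivisor, hXa]

theorem descentClass_eq_zero_iff (X : descentModule ℓ K L) :
    descentClass ℓ K L X = 0 ↔ ∃ r ∈ pseudoInfinitesimal ℓ K,
      principalDivisor ℓ L X = principalDivisor ℓ L (extendT ℓ K L r) := by
  rw [← Subtype.coe_inj]
  change Submodule.Quotient.mk (descentDivisor ℓ K L X) = 0 ↔ _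
  rw [Submodule.Quotient.mk_eq_zero, principalBP]
  constructor
  · rintro ⟨r, hr, h⟩
    exact ⟨r, hr, by rw [← extendDivisor_descentDivisor, ← h, extendDivisor_principalDivisor]⟩
  · rintro ⟨r, hr, h⟩
    refine ⟨r, hr, ?_⟩
    apply extendDivisor_injective (L := L)
    rw [extendDivisor_descentDivisor, h, extendDivisor_principalDivisor]

/-- An element whose quotient by its conjugate is a root of unity is, up to the base field, a
Kummer generator. -/
theorem exists_eq_ι_add_extendT [IsGalois K L] {σ : Gal(L/K)}
    (hσ : ∀ τ, τ ∈ Subgroup.zpowers σ) {X : LTensor ℓ Lˣ} {η : Lˣ} {s : ℕ} (hη : η ^ ℓ ^ s = 1)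
    (h : galT ℓ σ X - X = LTensor.ι ℓ η) :
    ∃ (x : Lˣ) (n : ℕ) (y : Kˣ) (r : LTensor ℓ Kˣ),
      x ^ ℓ ^ n = Units.map (algebraMap K L).toMonoidHom y ∧ X = LTensor.ι ℓ x + extendT ℓ K L r ∧
      quotientHom σ x = η := by
  -- `ℓ^s X` is invariant, hence comes from `ℤ_ℓ ⊗ Kˣ`. Approximating it modulo `ℓ^s` by some `k` in
  -- `Kˣ` makes `k` an `ℓ^s`-th power `b^(ℓ^s)` in `L`, and `X` differs from `b` and an element from
  -- `K` only by torsion.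
  have h1 : galT ℓ σ ((ℓ : ℤ_[ℓ]) ^ s • X) = (ℓ : ℤ_[ℓ]) ^ s • X := by
    rw [← sub_eq_zero, map_smul, ← smul_sub, h, ← Nat.cast_pow, ← LTensor.ι_pow, hη, LTensor.ι_one]
  obtain ⟨r0, hr0⟩ := exists_extendT_eq hσ h1
  obtain ⟨k, r, rfl⟩ := LTensor.exists_ι_add s r0
  rw [map_add, LTensor.map_ι, map_smul, ← eq_sub_iff_add_eq, ← smul_sub] at hr0
  obtain ⟨b, hb⟩ := LTensor.exists_pow_of_ι_eq_smul hr0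
  rw [hb, LTensor.ι_pow, Nat.cast_pow, eq_comm, ← sub_eq_zero, ← smul_sub] at hr0
  obtain ⟨ξ, hξ, hX⟩ := LTensor.exists_ι_of_torsion hr0
  have hX' : X = LTensor.ι ℓ (b * ξ) + extendT ℓ K L r := by
    rw [LTensor.ι_mul, ← hX]
    abel
  have hpow : (b * ξ) ^ ℓ ^ s = Units.map (algebraMap K L).toMonoidHom k := by
    rw [mul_pow, hξ, mul_one, ← hb]
  refine ⟨b * ξ, s, k, r, hpow, hX', ?_⟩
  refine LTensor.eq_of_ι_eq (ℓ := ℓ) (N := s) ?_ hη ?_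
  · rw [← map_pow, hpow, quotientHom_eq_iff, Units.val_one, one_mul]
    exact σ.commutes _
  · rw [← h, ← galT_sub_ι, hX', map_add, galT_extendT]
    abel

/-- The capitulation kernel counted by Kummer theory. -/
theorem card_cap_mul (hℓ2 : ℓ ≠ 2) [IsGalois K L] {ω : K} (hω : IsPrimitiveRoot ω ℓ)
    {σ : Gal(L/K)} (hσ : ∀ τ, τ ∈ Subgroup.zpowers σ) (hLeo : Leopoldt ℓ L) {Λ : Subgroup Lˣ}
    (hΛ : ∀ (x : Lˣ) (n : ℕ) (y : Kˣ), x ^ ℓ ^ n = Units.map (algebraMap K L).toMonoidHom y →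
      (x ∈ Λ ↔ LocallyRootTimesBase ℓ K (x : L))) :
    Nat.card (Cap ℓ K L) *
      Nat.card ((CommGroup.primaryComponent Lˣ ℓ).map (quotientHom σ)) =
      Nat.card (quotientRoots ℓ σ Λ) := by
  have : IsCyclic Gal(L/K) := ⟨σ, hσ⟩
  set μ := CommGroup.primaryComponent Lˣ ℓ with hμ
  let Y := descentModule ℓ K L
  let Ψ : Y →+ LTensor ℓ Lˣ := ((galT ℓ σ - LinearMap.id).comp Y.subtype).toAddMonoidHom
  have hΨ : ∀ X : Y, Ψ X = galT ℓ σ X - X := fun X => rfl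
  let Φ : Y →+ Cap ℓ K L := (descentClass ℓ K L).toAddMonoidHom
  let B : AddSubgroup Y := (tensorSubgroup ℓ μ).comap Y.subtype.toAddMonoidHom
  have hB : ∀ (η : Lˣ) (n : ℕ), η ^ ℓ ^ n = 1 → LTensor.ι ℓ η ∈ Y := fun η n h =>
    ⟨ι_mem_pseudoInfinitesimal h, 0, by rw [map_zero, principalDivisor_ι_eq_zero h]⟩
  have hroot : ∀ {X : LTensor ℓ Lˣ}, X ∈ pseudoInfinitesimal ℓ L → principalDivisor ℓ L X = 0 →
      ∃ η ∈ μ, X = LTensor.ι ℓ η := by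
    intro X hX hdiv
    obtain ⟨η, n, h, hXη⟩ := exists_root_of_principalDivisor_eq_zero hLeo hX hdiv
    exact ⟨η, ⟨n, h⟩, hXη⟩
  -- If the class of `X` is trivial, `X` and some `r` from `K` have the same divisor, so Leopoldt
  -- makes them differ by a root of unity. Conversely a `σ`-fixed element comes from `K`, and is
  -- pseudo-infinitesimal there by `mem_of_extendT_mem`.
  have hker : Φ.ker = B ⊔ Ψ.ker := by
    ext X
    rw [AddMonoidHom.mem_ker, AddSubgroup.mem_sup]
    change descentClass ℓ K L X = 0 ↔ _
    rw [descentClass_eq_zero_iff]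
    constructor
    · rintro ⟨r, hr, h⟩
      have hr' := map_mem_pseudoInfinitesimal ℓ K L r hr
      obtain ⟨η, hη, hX⟩ := hroot ((pseudoInfinitesimal ℓ L).sub_mem X.2.1 hr')
        (by rw [map_sub, h, sub_self])
      obtain ⟨n, hn⟩ := hη
      refine ⟨⟨LTensor.ι ℓ η, hB η n hn⟩, ⟨η, ⟨n, hn⟩, rfl⟩,
        X - ⟨LTensor.ι ℓ η, hB η n hn⟩, ?_, add_sub_cancel _ _⟩
      rw [AddMonoidHom.mem_ker, hΨ]
      have : ((X - ⟨LTensor.ι ℓ η, hB η n hn⟩ : Y) : LTensor ℓ Lˣ) = extendT ℓ K L r := by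
        change (X : LTensor ℓ Lˣ) - LTensor.ι ℓ η = _
        rw [← hX]
        abel
      rw [this, galT_extendT, sub_self]
    · rintro ⟨Z, ⟨η, ⟨n, hn⟩, hZ⟩, W, hW, rfl⟩
      rw [AddMonoidHom.mem_ker, hΨ, sub_eq_zero] at hW
      obtain ⟨r, hr⟩ := exists_extendT_eq hσ hW
      refine ⟨r, mem_of_extendT_mem (L := L) (by rw [hr]; exact W.2.1), ?_⟩
      have hZ' : (Z : LTensor ℓ Lˣ) = LTensor.ι ℓ η := hZ.symm
      rw [hr, Submodule.coe_add, map_add, hZ', principalDivisor_ι_eq_zero hn, zero_add]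
  have hmap : B.map Ψ = tensorSubgroup ℓ (μ.map (quotientHom σ)) := by
    ext Z
    constructor
    · rintro ⟨X, ⟨η, hη, hX⟩, rfl⟩
      refine ⟨quotientHom σ η, ⟨η, hη, rfl⟩, ?_⟩
      have hX' : (X : LTensor ℓ Lˣ) = LTensor.ι ℓ η := hX.symm
      rw [hΨ, hX', galT_sub_ι]
    · rintro ⟨_, ⟨η, hη, rfl⟩, rfl⟩
      obtain ⟨n, hn⟩ := id hη
      exact ⟨⟨LTensor.ι ℓ η, hB η n hn⟩, ⟨η, hη, rfl⟩, galT_sub_ι σ η⟩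
  -- `(σ - 1) X` has trivial divisor, hence is a root of unity, and `X` reduces to a Kummer
  -- generator `x`. `hΛ` exchanges the local condition on `x` for membership in `Λ`.
  have hrange : Ψ.range = tensorSubgroup ℓ (quotientRoots ℓ σ Λ) := by
    ext Z
    constructor
    · rintro ⟨X, rfl⟩
      obtain ⟨hX, a, ha⟩ := X.2
      obtain ⟨η, ⟨n, hn⟩, h⟩ := hroot
        ((pseudoInfinitesimal ℓ L).sub_mem (galT_mem σ hX) hX)
        (by rw [map_sub, principalDivisor_galT σ ha.symm, ha, sub_self])
      obtain ⟨x, m, y, r, hxy, hXx, hxη⟩ := exists_eq_ι_add_extendT hσ hn h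
      refine ⟨η, ⟨⟨n, hn⟩, x, (hΛ x m y hxy).2 ?_, hxη⟩, h.symm⟩
      have hxy' : (x : L) ^ ℓ ^ m = algebraMap K L y := by
        rw [← Units.val_pow_eq_pow_val, hxy]
        rfl
      refine locallyRootTimesBase_of_pseudoInfinitesimal hℓ2 hω hxy' (r := r) (a := a) ?_ ?_
      · rw [← hXx]
        exact hX
      · rw [← hXx, ha]
    · rintro ⟨η, ⟨⟨n, hn⟩, x, hx, hxη⟩, rfl⟩
      obtain ⟨y, hy⟩ := exists_map_eq_of_quotientHom_eq_one hσ (x := x ^ ℓ ^ n)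
        (by rw [map_pow, hxη, hn])
      have hxy' : (x : L) ^ ℓ ^ n = algebraMap K L y := by
        rw [← Units.val_pow_eq_pow_val, ← hy]
        rfl
      obtain ⟨r, a, hmem, hdiv⟩ := exists_pseudoInfinitesimal_of_locallyRootTimesBase (ℓ := ℓ) hxy'
        ((hΛ x n y hy.symm).1 hx)
      refine ⟨⟨_, hmem, a, hdiv.symm⟩, ?_⟩
      rw [hΨ]
      change galT ℓ σ (LTensor.ι ℓ x + extendT ℓ K L r) - (LTensor.ι ℓ x + extendT ℓ K L r) = _
      rw [map_add, galT_extendT, add_sub_add_right_eq_sub, galT_sub_ι, hxη]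
  have hcard := card_mul_card_map (Φ := Φ) descentClass_surjective hker
  have hle : quotientRoots ℓ σ Λ ≤ μ := inf_le_left
  rw [hmap, hrange, card_tensorSubgroup hle, card_tensorSubgroup] at hcard
  · exact hcard
  · rintro _ ⟨η, ⟨n, hn⟩, rfl⟩
    exact ⟨n, by rw [← map_pow, hn, map_one]⟩

end Capitulation

section Degrees

/-! ### Comparison with the cyclotomic part and the final count -/

variable {ℓ : ℕ} [hℓ : Fact ℓ.Prime]

theorem finite_primaryComponent_numberField (ℓ : ℕ) [Fact ℓ.Prime] (K : Type*) [Field K]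
    [NumberField K] : Finite (CommGroup.primaryComponent Kˣ ℓ) := by
  obtain ⟨M, hM⟩ := Ideal.exists_maximal (𝓞 K)
  let v : HeightOneSpectrum (𝓞 K) := ⟨M, hM.isPrime,
    Ring.ne_bot_of_isMaximal_of_not_isField hM (RingOfIntegers.not_isField K)⟩
  have hfin : Finite (CommGroup.primaryComponent (v.adicCompletion K)ˣ ℓ) :=
    finite_primaryComponent ℓ
  refine Finite.of_injective (β := CommGroup.primaryComponent (v.adicCompletion K)ˣ ℓ)
    (fun z => ⟨Units.map (algebraMap K (v.adicCompletion K)).toMonoidHom z.1, by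
      obtain ⟨n, hn⟩ := z.2
      exact ⟨n, by rw [← map_pow, hn, map_one]⟩⟩) fun y z h => ?_
  exact Subtype.ext (Units.map_injective (algebraMap K (v.adicCompletion K)).injective
    (congrArg Subtype.val h))

variable {K L : Type*} [Field K] [NumberField K] [Field L] [NumberField L] [Algebra K L]
  {Ω : Type*} [Field Ω] [IsAlgClosed Ω] [Algebra K Ω] [Algebra L Ω] [IsScalarTower K L Ω]

/-- A radical in the cyclotomic tower is a root of unity times an element `k` of `K`, and `k`
disappears in `σ x / x`. -/
theorem quotientRoots_of_cyclotomic (hℓ2 : ℓ ≠ 2) [IsGalois K L] {ω : K}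
    (hω : IsPrimitiveRoot ω ℓ) {σ : Gal(L/K)} (hσ : ∀ τ, τ ∈ Subgroup.zpowers σ)
    {Λ : IntermediateField K L}
    (hroot : ∀ z : Lˣ, z ∈ CommGroup.primaryComponent Lˣ ℓ → (z : L) ∈ Λ)
    (hΛ : ∀ x ∈ Λ, algebraMap L Ω x ∈
      IntermediateField.adjoin K {ζ : Ω | ∃ n : ℕ, ζ ^ ℓ ^ n = 1}) :
    quotientRoots ℓ σ (unitsOf Λ) = (CommGroup.primaryComponent Lˣ ℓ).map (quotientHom σ) := by
  ext η
  constructor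
  · rintro ⟨⟨n, hn⟩, x, hx, rfl⟩
    obtain ⟨y, hy⟩ := exists_map_eq_of_quotientHom_eq_one hσ (x := x ^ ℓ ^ n) (by rw [map_pow, hn])
    have hxy : (algebraMap L Ω x) ^ ℓ ^ n = algebraMap K Ω y := by
      rw [← map_pow, ← Units.val_pow_eq_pow_val, ← hy, IsScalarTower.algebraMap_apply K L Ω]
      rfl
    obtain ⟨z, m, k, hz, hk⟩ := exists_root_mul_of_mem_cyclotomic hℓ2 hω
      ((map_ne_zero (algebraMap L Ω)).2 x.ne_zero) (hΛ x (mem_unitsOf.1 hx)) hxy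
    have hk0 : k ≠ 0 := by
      rintro rfl
      rw [map_zero, mul_zero, map_eq_zero] at hk
      exact x.ne_zero hk
    set k' : Lˣ := Units.map (algebraMap K L).toMonoidHom (Units.mk0 k hk0) with hk'
    have hkL : (k' : L) = algebraMap K L k := rfl
    have hxk : algebraMap L Ω ((x / k' : Lˣ) : L) = z := by
      rw [Units.val_div_eq_div_val, map_div₀, hkL, ← IsScalarTower.algebraMap_apply, hk,
        mul_div_cancel_right₀]
      exact (map_ne_zero _).2 hk0
    refine ⟨x / k', ⟨m, ?_⟩, ?_⟩
    · apply Units.ext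
      apply (algebraMap L Ω).injective
      rw [Units.val_pow_eq_pow_val, map_pow, hxk, hz, Units.val_one, map_one]
    · have hk1 : quotientHom σ k' = 1 := by
        rw [quotientHom_eq_iff, Units.val_one, one_mul]
        exact σ.commutes k
      rw [map_div, hk1, div_one]
  · rintro ⟨z, hz, rfl⟩
    obtain ⟨n, hn⟩ := id hz
    exact ⟨⟨n, by rw [← map_pow, hn, map_one]⟩, z, mem_unitsOf.2 (hroot z hz), rfl⟩

end Degrees

end BertrandiasPayan
end

theorem mainTheorem2 (ℓ : ℕ) [Fact ℓ.Prime] (hℓ : ℓ ≠ 2)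
    (K L Ω : Type*) [Field K] [NumberField K] [Field L] [NumberField L] [Algebra K L]
    [Field Ω] [IsAlgClosed Ω] [Algebra K Ω] [Algebra L Ω] [IsScalarTower K L Ω]
    (hζ : ∃ ζ : K, IsPrimitiveRoot ζ ℓ)
    (hGal : IsGalois K L) (hcyc : IsCyclic (L ≃ₐ[K] L))
    (hdeg : ∃ n : ℕ, Module.finrank K L = ℓ ^ n)
    (hLeo : BertrandiasPayan.Leopoldt ℓ L)
    (K' L' : IntermediateField K Ω)
    (hK' : K' = BertrandiasPayan.cyclotomicExt ℓ K Ω ⊓ (IsScalarTower.toAlgHom K L Ω).fieldRange)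
    (hL' : L' = BertrandiasPayan.locallyCyclotomicExt ℓ K Ω ⊓
      (IsScalarTower.toAlgHom K L Ω).fieldRange) :
    Nat.card (BertrandiasPayan.Cap ℓ K L) =
      min (Nat.card (CommGroup.primaryComponent Kˣ ℓ)) (IntermediateField.relfinrank K' L') := by
  open BertrandiasPayan in
  have hℓp : ℓ.Prime := Fact.out
  obtain ⟨ω, hω⟩ := hζ
  obtain ⟨σ, hσ⟩ := IsCyclic.exists_generator (α := L ≃ₐ[K] L)
  have : Finite (CommGroup.primaryComponent Lˣ ℓ) := finite_primaryComponent_numberField ℓ L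
  have : Finite (CommGroup.primaryComponent Kˣ ℓ) := finite_primaryComponent_numberField ℓ K
  obtain ⟨ζ, b, hζ, hb, hgen⟩ := exists_primary_generator (ℓ := ℓ) L
  obtain ⟨ζK, a, hζK, ha, -⟩ := exists_primary_generator (ℓ := ℓ) K
  -- Needed below: `min b c + a = b` with `a > 0` forces `min b c = c`.
  have ha1 : a ≠ 0 := by
    rintro rfl
    rw [pow_zero, Nat.card_eq_one_iff_unique] at ha
    have hω0 : ω ≠ 0 := hω.ne_zero hℓp.ne_zero
    have h1 : (⟨Units.mk0 ω hω0, 1, Units.ext (by simpa using hω.pow_eq_one)⟩ :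
        CommGroup.primaryComponent Kˣ ℓ) = 1 := ha.1.elim _ _
    exact hω.ne_one hℓp.one_lt (congrArg Units.val (congrArg Subtype.val h1))
  set f : L →ₐ[K] Ω := IsScalarTower.toAlgHom K L Ω with hf
  set Λ : IntermediateField K L := (locallyCyclotomicExt ℓ K Ω).comap f with hΛdef
  set Λc : IntermediateField K L := (cyclotomicExt ℓ K Ω).comap f with hΛcdef
  have hpow : ∀ M : IntermediateField K L, ∃ c, Module.finrank K M = ℓ ^ c := by
    intro M
    obtain ⟨n, hn⟩ := hdeg
    have h1 : Module.finrank K M ∣ ℓ ^ n := by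
      rw [← hn, ← Module.finrank_mul_finrank K M L]
      exact dvd_mul_right _ _
    obtain ⟨m, -, hm⟩ := (Nat.dvd_prime_pow hℓp).1 h1
    exact ⟨m, hm⟩
  have hΛ : ∀ (x : Lˣ) (n : ℕ) (y : Kˣ),
      x ^ ℓ ^ n = Units.map (algebraMap K L).toMonoidHom y →
      (x ∈ unitsOf Λ ↔ LocallyRootTimesBase ℓ K (x : L)) := by
    intro x n y hxy
    rw [mem_unitsOf]
    refine ⟨fun h => ?_, fun h => mem_locallyCyclotomicExt hℓ hω hdeg h⟩
    refine locallyRootTimesBase_of_mem hℓ hω x.ne_zero (n := n) (a := (y : K)) ?_ h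
    rw [← Units.val_pow_eq_pow_val, hxy]
    rfl
  have hζ1 : ζ ^ ℓ ^ b = 1 := hζ.pow_eq_one
  have hζΛ : ζ ∈ Λ := mem_locallyCyclotomicExt hℓ hω hdeg fun v w _ =>
    ⟨algebraMap L _ ζ, b, 1, by rw [← map_pow, hζ1, map_one], by rw [map_one, mul_one]⟩
  have hΛc : ∀ x ∈ Λc, algebraMap L Ω x ∈
      IntermediateField.adjoin K {ζ : Ω | ∃ n : ℕ, ζ ^ ℓ ^ n = 1} := by
    intro x hx
    rw [← cyclotomicExt_eq_adjoin hℓ hω]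
    exact hx
  have hζΛc : ζ ∈ Λc := by
    change f ζ ∈ cyclotomicExt ℓ K Ω
    rw [cyclotomicExt_eq_adjoin hℓ hω]
    exact IntermediateField.subset_adjoin _ _ ⟨b, by rw [← map_pow, hζ1, map_one]⟩
  have hμ : ∀ {M : IntermediateField K L}, ζ ∈ M →
      ∀ z : Lˣ, z ∈ CommGroup.primaryComponent Lˣ ℓ → (z : L) ∈ M := by
    rintro M hM z ⟨n, hn⟩
    obtain ⟨i, -, hi⟩ := hgen z ⟨n, by rw [← Units.val_pow_eq_pow_val, hn, Units.val_one]⟩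
    rw [hi]
    exact pow_mem hM i
  have hQ := card_map_quotientHom_mul (ℓ := ℓ) hσ
  -- The quotients `σ x / x` with `x` in `M` are counted twice: Hilbert 90 gives `ℓ^min(b, c)`, and
  -- the cyclotomic description gives `|(σ - 1) μ_L| = ℓ^(b - a)`.
  have hcyclo : ∀ M : IntermediateField K L, ζ ∈ M → M ≤ Λc →
      ∃ c, Module.finrank K M = ℓ ^ c ∧ c + a = b ∧
        Nat.card ((CommGroup.primaryComponent Lˣ ℓ).map (quotientHom σ)) = ℓ ^ c := by
    intro M hM hle
    obtain ⟨c, hc⟩ := hpow M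
    have h1 := quotientRoots_of_cyclotomic hℓ hω hσ (hμ hM) fun x hx => hΛc x (hle hx)
    rw [quotientRoots_unitsOf hℓ hσ hω hζ hgen hM hc] at h1
    have h2 := hQ
    rw [← h1, card_rootsOfUnity_min hζ, ha, hb, ← pow_add] at h2
    have h3 := Nat.pow_right_injective hℓp.two_le h2
    have h4 : min b c = c := by omega
    refine ⟨c, hc, by omega, ?_⟩
    rw [← h1, card_rootsOfUnity_min hζ, h4]
  obtain ⟨c, hc, hca, hcQ⟩ := hcyclo Λc hζΛc le_rfl
  have hadj : IntermediateField.adjoin K {ζ} = Λc := by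
    have hle : IntermediateField.adjoin K {ζ} ≤ Λc := by
      rw [IntermediateField.adjoin_le_iff, Set.singleton_subset_iff]
      exact hζΛc
    -- The degree is determined by `c + a = b`, so `K(ζ)` and `Λc` coincide. This gives `Λc ≤ Λ`
    -- without comparing the two suprema in `Ω`.
    obtain ⟨c', hc', hca', -⟩ := hcyclo _ (IntermediateField.mem_adjoin_simple_self K ζ) hle
    refine IntermediateField.eq_of_le_of_finrank_eq hle ?_
    rw [hc, hc', show c' = c by omega]
  have hle : Λc ≤ Λ := by
    rw [← hadj, IntermediateField.adjoin_le_iff, Set.singleton_subset_iff]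
    exact hζΛ
  obtain ⟨d, hd⟩ := hpow Λ
  have hcap := card_cap_mul hℓ hω hσ hLeo hΛ
  rw [hcQ, quotientRoots_unitsOf hℓ hσ hω hζ hgen hζΛ hd, card_rootsOfUnity_min hζ] at hcap
  have hrel : ℓ ^ c * IntermediateField.relfinrank K' L' = ℓ ^ d := by
    rw [hK', hL', ← IntermediateField.map_comap_eq, ← IntermediateField.map_comap_eq,
      IntermediateField.relfinrank_map_map, ← hc, ← hd]
    exact IntermediateField.finrank_bot_mul_relfinrank hle
  have hcd : c ≤ d := (Nat.pow_dvd_pow_iff_le_right hℓp.one_lt).1 ⟨_, hrel.symm⟩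
  have hpos : 0 < ℓ ^ c := pow_pos hℓp.pos c
  have hrel' : IntermediateField.relfinrank K' L' = ℓ ^ (d - c) := by
    apply Nat.eq_of_mul_eq_mul_left hpos
    rw [hrel, ← pow_add, Nat.add_sub_cancel' hcd]
  -- Since `b = c + a`, `min b d = min a (d - c) + c`.
  have hcap' : Nat.card (Cap ℓ K L) = ℓ ^ min a (d - c) := by
    apply Nat.eq_of_mul_eq_mul_right hpos
    rw [hcap, ← pow_add]
    congr 1
    omega
  rw [hcap', ha, hrel']
  rcases le_total a (d - c) with h | h
  · rw [min_eq_left h, min_eq_left (Nat.pow_le_pow_right hℓp.pos h)]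
  · rw [min_eq_right h, min_eq_right (Nat.pow_le_pow_right hℓp.pos h)]
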